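/- **Setting.** Let $X$, $Y$ be real Hilbert spaces with norms $|\cdot|$ and $\|\cdot\|$, $Y$ densely and continuously embedded in $X$ with $|y|\le\|y\|$. For each $y\in Y$ let $A(y)$ be a closed linear operator on $X$. Let $S:Y\to X$ be a surjective isometry that is self-adjoint as an operator on $X$ with domain $Y$. Let $p,q$ be integers with $q<p\le 2q$. Assume that for every $R>0$ there are constants $M_R^A,M_{k,R},L_R^A,L_R^B$ such that: (K1) For every $y\in Y$, $A(y)$ has the open left complex half-plane in its resolvent set, $(w,A(y)w)\ge 0$ for all $w\in D(A(y))$, and $Y\subset D(A(y))$; and $|A(y)w|\le M_R^A\|w\|$ for all $w\in Y$ if $\|y\|\le R$. (K2) For $k=1,\dots,p-q$ and every $y\in Y$, $S^kA(y)S^{-k}=A(y)+B_k(y)$ with equality of domains, where $B_k(y)$ is a bounded operator on $X$ with $|B_k(y)v|\le M_{k,R}|v|$ for all $v\in X$ if $\|y\|\le R$. (K3) For $\|y\|,\|\tilde y\|\le R$: $|(A(y)-A(\tilde y))w|\le L_R^A|y-\tilde y|\,\|w\|$ for all $w\in Y$, and $|(B_1(y)-B_1(\tilde y))v|\le L_R^B\|y-\tilde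 y\|\,|v|$ for all $v\in X$. (Smoothness) The maps $y\mapsto A(y)\in L(Y,X)$ and $y\mapsto B_k(y)\in L(X,X)$ ($1\le k\le p-q$) on $Y$ are arbitrarily differentiable, and each of their derivatives is bounded on bounded subsets of $Y$. Let $T>0$ and let $u:[0,T]\to Y$ be a solution of $\dot u+A(u)u=0$ with $u\in C^{p+1}([0,T],Y)$ and $S^ku\in C^{p+1-k}([0,T],Y)$ for $k=1,\dots,p-q$. **Method.** Consider an $m$-stage Runge–Kutta method with coefficients $a_{ij}$, weights $b_i$ and nodes $c_i=\sum_j a_{ij}$. Applied with step size $\tau>0$ and $u_0=u(0)$, it reads $$U_{ni}=u_n+\tau\sum_{j}a_{ij}\dot U_{nj},\qquad u_{n+1}=u_n+\tau\sum_i b_i\dot U_{ni},\qquad \dot U_{ni}+A(U_{ni})U_{ni}=0,$$ with $u_n,U_{ni}\in Y$. Assume that it * is algebraically stable: all $b_i>0$ and $(b_ia_{ij}+b_ja_{ji}-b_ib_j)_{i,j}$ is positive semidefinite; * is coercive: $\mathcal A=(a_{ij})$ is invertible and there are a positive diagonal matrix $\mathcal D$ and $\alpha>0$ with $v^T\mathcal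 D\mathcal A^{-1}v\ge\alpha\,v^T\mathcal Dv$ for all $v\in\mathbb R^m$; * has stage order $q$: $\sum_j a_{ij}c_j^{k-1}=c_i^k/k$ for all $i$ and $k=1,\dots,q$; * has classical order $p$: for every ordinary differential equation $\dot y=g(y)$ in some $\mathbb R^N$ with smooth $g$, the error after one step of size $\tau$ starting from the exact solution is $O(\tau^{p+1})$ as $\tau\to0$ (the stages being those that tend to the initial value as $\tau\to 0$). **Theorem.** There are constants $\rho_0$ and $C$ such that for every $\rho\ge\rho_0$ there is $\bar\tau>0$ with the following property. For every step size $0<\tau\le\bar\tau$ and every integer $N\ge 0$ with $N\tau\le T$, the Runge–Kutta equations for $0\le n<N$ have exactly one solution $(u_n)_{0\le n\le N}$, $(U_{ni})_{0\le n<N,\,1\le i\le m}$ in $Y$ with $\|U_{ni}\|\le\rho$ for all $n,i$, and it satisfies $$\|u_n-u(n\tau)\|\le C\,\tau^p\qquad\text{for } 0\le n\le N .$$ -/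

import Mathlib

open scoped ContDiff Topology Matrix

noncomputable section

namespace Kato

/-! ### Unbounded operators -/

section Operators

variable {X Y : Type*}
  [NormedAddCommGroup X] [InnerProductSpace ℝ X]
  [NormedAddCommGroup Y] [InnerProductSpace ℝ Y]

/-- The composition `g ∘ f` of two partially defined operators on its natural domain
`{x ∈ D(f) | f x ∈ D(g)}`. -/
def pcomp (g f : X →ₗ.[ℝ] X) : X →ₗ.[ℝ] X where
  domain := (g.domain.comap f.toFun).map f.domain.subtype
  toFun := (g.comp (f.domRestrict ((g.domain.comap f.toFun).map f.domain.subtype)) (by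
    rintro ⟨x, hx⟩
    obtain ⟨z, hz, hzx⟩ := Submodule.mem_map.1 hx.1
    have hfz : f.domRestrict ((g.domain.comap f.toFun).map f.domain.subtype) ⟨x, hx⟩ = f z :=
      LinearPMap.domRestrict_apply hzx.symm
    rw [hfz]
    exact hz)).toFun ∘ₗ Submodule.inclusion (by
      intro x hx
      obtain ⟨z, hz, rfl⟩ := Submodule.mem_map.1 hx
      exact ⟨hx, z.2⟩)

/-- `pcomp g f` maps `x` to `z` iff `f` maps `x` to some `w` which `g` maps to `z`. -/
theorem mem_graph_pcomp (g f : X →ₗ.[ℝ] X) (x z : X) :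
    (x, z) ∈ (pcomp g f).graph ↔ ∃ w, (x, w) ∈ f.graph ∧ (w, z) ∈ g.graph := by
  have key : ∀ (x : X) (hx : x ∈ (pcomp g f).domain) (v : f.domain) (hv : (v : X) = x)
      (hg : f v ∈ g.domain), pcomp g f ⟨x, hx⟩ = g ⟨f v, hg⟩ := by
    intro x hx v hv hg
    change g ⟨_, _⟩ = g ⟨_, _⟩
    congr 1
    apply Subtype.ext
    exact LinearPMap.domRestrict_apply hv.symm
  constructor
  · intro h
    obtain ⟨⟨x', hx'⟩, rfl, rfl⟩ := (LinearPMap.mem_graph_iff _).1 h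
    obtain ⟨v, hv, hvx⟩ := Submodule.mem_map.1 hx'
    have hv' : f v ∈ g.domain := hv
    have e := key x' hx' v hvx hv'
    refine ⟨f v, ?_, ?_⟩
    · exact (LinearPMap.mem_graph_iff _).2 ⟨v, hvx, rfl⟩
    · exact (LinearPMap.mem_graph_iff _).2 ⟨⟨f v, hv'⟩, rfl, e.symm⟩
  · rintro ⟨w, hf, hg⟩
    obtain ⟨v, hv1, hv2⟩ := (LinearPMap.mem_graph_iff _).1 hf
    obtain ⟨u, hu1, hu2⟩ := (LinearPMap.mem_graph_iff _).1 hg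
    dsimp only at hv1 hv2 hu1 hu2
    have hgv : f v ∈ g.domain := by
      rw [hv2, ← hu1]; exact u.2
    have hx : x ∈ (pcomp g f).domain := Submodule.mem_map.2 ⟨v, hgv, hv1⟩
    refine (LinearPMap.mem_graph_iff _).2 ⟨⟨x, hx⟩, rfl, ?_⟩
    rw [key x hx v hv1 hgv, ← hu2]
    congr 1
    exact Subtype.ext (hv2.trans hu1.symm)

/-- Powers of a partially defined operator, on their natural domains. -/
def ppow (S : X →ₗ.[ℝ] X) : ℕ → (X →ₗ.[ℝ] X)
  | 0 => (LinearMap.id : X →ₗ[ℝ] X).toPMap ⊤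
  | k + 1 => pcomp S (ppow S k)

/-- An isometry `S : Y → X` regarded as an operator on `X` with domain `Y`, where
`ι : Y → X` is the embedding: the operator with graph `{(ι y, S y) | y ∈ Y}`. -/
def opOnX (ι : Y →L[ℝ] X) (S : Y ≃ₗᵢ[ℝ] X) : X →ₗ.[ℝ] X :=
  (LinearMap.range
    ((ι : Y →ₗ[ℝ] X).prod (S.toLinearEquiv : Y →ₗ[ℝ] X))).toLinearPMap

theorem mem_graph_opOnX {ι : Y →L[ℝ] X} (hι : Function.Injective ι) (S : Y ≃ₗᵢ[ℝ] X)
    (x z : X) : (x, z) ∈ (opOnX ι S).graph ↔ ∃ y : Y, ι y = x ∧ S y = z := by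
  unfold opOnX
  rw [Submodule.toLinearPMap_graph_eq]
  · simp
  · rintro ⟨a, b⟩ ⟨y, hy⟩ ha
    dsimp only at ha
    have h0 : ι y = ι 0 := by rw [map_zero, ← ha]; exact congrArg Prod.fst hy
    have hy0 : y = 0 := hι h0
    have h1 : S y = b := congrArg Prod.snd hy
    rw [← h1, hy0, map_zero]

/-- The inverse `S⁻¹ : X → Y ⊆ X`, a bounded operator on `X`. -/
def invOnX (ι : Y →L[ℝ] X) (S : Y ≃ₗᵢ[ℝ] X) : X →L[ℝ] X :=
  ι ∘L (S.symm.toContinuousLinearEquiv : X →L[ℝ] Y)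

/-- The conjugated operator `S^k A S^{-k}` on its natural domain
`{v ∈ X | S^{-k} v ∈ D(A), A S^{-k} v ∈ D(S^k)}`. -/
def conj (ι : Y →L[ℝ] X) (S : Y ≃ₗᵢ[ℝ] X) (k : ℕ) (A : X →ₗ.[ℝ] X) : X →ₗ.[ℝ] X :=
  pcomp (ppow (opOnX ι S) k)
    (pcomp A (((invOnX ι S ^ k : X →L[ℝ] X) : X →ₗ[ℝ] X).toPMap ⊤))

/-- The open left complex half-plane lies in the resolvent set of (the complexification of) the
closed operator `A`: for `λ = a + b i` with `a < 0`, the equation `(A - λ)(w + i z) = f + i g`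
has exactly one solution `w, z ∈ D(A)`, for all `f, g ∈ X`. (The inverse is then bounded, since
`A` is closed.) -/
def LeftHalfPlaneInResolventSet (A : X →ₗ.[ℝ] X) : Prop :=
  ∀ a b : ℝ, a < 0 → ∀ f g : X, ∃! wz : A.domain × A.domain,
    A wz.1 - a • (wz.1 : X) + b • (wz.2 : X) = f ∧
    A wz.2 - a • (wz.2 : X) - b • (wz.1 : X) = g

end Operators

/-! ### Kato's conditions -/

section Conditions

variable {X Y : Type*}
  [NormedAddCommGroup X] [InnerProductSpace ℝ X]
  [NormedAddCommGroup Y] [InnerProductSpace ℝ Y]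

/-- `Y` is densely and continuously embedded in `X` by `ι`, with `|y| ≤ ‖y‖`. -/
structure IsDenseEmbedding (ι : Y →L[ℝ] X) : Prop where
  injective : Function.Injective ι
  denseRange : DenseRange ι
  norm_le : ∀ y, ‖ι y‖ ≤ ‖y‖

/-- Condition (K1): m-accretivity of the closed operators `A(y)`, whose domains contain `Y`,
and the `Y`-locally uniform bound of `A(y)` from `Y` to `X`. -/
structure MAccretive (ι : Y →L[ℝ] X) (A : Y → (X →ₗ.[ℝ] X)) : Prop where
  closed : ∀ y, (A y).IsClosed
  resolvent : ∀ y, LeftHalfPlaneInResolventSet (A y)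
  accretive : ∀ y, ∀ w : (A y).domain, 0 ≤ inner ℝ (w : X) (A y w)
  domain : ∀ y, ∀ w : Y, ι w ∈ (A y).domain
  bound : ∀ R : ℝ, 0 < R → ∃ M : ℝ, ∀ y : Y, ‖y‖ ≤ R →
    ∀ (w : Y) (z : X), (ι w, z) ∈ (A y).graph → ‖z‖ ≤ M * ‖w‖

/-- The commutator condition `S^k A(y) S^{-k} = A(y) + B(y)` for all `y ∈ Y`, with equality of
domains, with a family `B(y)` that is `Y`-locally uniformly bounded on `X`. -/
structure Commutator (ι : Y →L[ℝ] X) (S : Y ≃ₗᵢ[ℝ] X) (k : ℕ) (A : Y → (X →ₗ.[ℝ] X))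
    (B : Y → (X →L[ℝ] X)) : Prop where
  eq : ∀ y, conj ι S k (A y) = A y + ((B y : X →ₗ[ℝ] X).toPMap ⊤)
  bound : ∀ R : ℝ, 0 < R → ∃ M : ℝ, ∀ y : Y, ‖y‖ ≤ R → ∀ v : X, ‖B y v‖ ≤ M * ‖v‖

/-- Condition (K3): `Y`-local Lipschitz conditions for `A` and `B`. -/
structure LocallyLip (ι : Y →L[ℝ] X) (A : Y → (X →ₗ.[ℝ] X)) (B : Y → (X →L[ℝ] X)) :
    Prop where
  lipA : ∀ R : ℝ, 0 < R → ∃ L : ℝ, ∀ y y' : Y, ‖y‖ ≤ R → ‖y'‖ ≤ R → ∀ (w : Y) (z z' : X),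
    (ι w, z) ∈ (A y).graph → (ι w, z') ∈ (A y').graph → ‖z - z'‖ ≤ L * ‖ι y - ι y'‖ * ‖w‖
  lipB : ∀ R : ℝ, 0 < R → ∃ L : ℝ, ∀ y y' : Y, ‖y‖ ≤ R → ‖y'‖ ≤ R → ∀ v : X,
    ‖B y v - B y' v‖ ≤ L * ‖y - y'‖ * ‖v‖

/-- A function on `Y` is arbitrarily differentiable, with derivatives of every order that are
uniformly bounded on bounded subsets of `Y`. -/
def SmoothLocallyBounded {E : Type*} [NormedAddCommGroup E] [NormedSpace ℝ E] (F : Y → E) :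
    Prop :=
  ContDiff ℝ ∞ F ∧
    ∀ (j : ℕ) (R : ℝ), 0 < R → ∃ M : ℝ, ∀ y : Y, ‖y‖ ≤ R → ‖iteratedFDeriv ℝ j F y‖ ≤ M

/-- `y ↦ A(y)`, as a map from `Y` to the Banach space `L(Y, X)`, is arbitrarily differentiable
with derivatives bounded on bounded sets. -/
def SmoothInLYX (ι : Y →L[ℝ] X) (A : Y → (X →ₗ.[ℝ] X)) : Prop :=
  ∃ AY : Y → (Y →L[ℝ] X), (∀ y w, (ι w, AY y w) ∈ (A y).graph) ∧ SmoothLocallyBounded AY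

/-- `u : [0,T] → Y` solves `u' + A(u) u = 0` in `X`. -/
def IsSolution (ι : Y →L[ℝ] X) (A : Y → (X →ₗ.[ℝ] X)) (T : ℝ) (u : ℝ → Y) : Prop :=
  ∀ t ∈ Set.Icc 0 T, ∃ u' : X,
    HasDerivWithinAt (fun s => ι (u s)) u' (Set.Icc 0 T) t ∧ (ι (u t), -u') ∈ (A (u t)).graph

/-- `S^k u ∈ C^r([0,T], Y)`: for `t ∈ [0,T]`, `u(t)` is in the domain of `S^k`, and
`S^k u(t) ∈ Y` is `r` times continuously differentiable with values in `Y`. -/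
def PowRegular (ι : Y →L[ℝ] X) (S : Y ≃ₗᵢ[ℝ] X) (T : ℝ) (u : ℝ → Y) (k r : ℕ) : Prop :=
  ∃ v : ℝ → Y, ContDiffOn ℝ r v (Set.Icc 0 T) ∧
    ∀ t ∈ Set.Icc 0 T, (ι (u t), ι (v t)) ∈ (ppow (opOnX ι S) k).graph

end Conditions

/-! ### Runge–Kutta methods -/

/-- The coefficients of an `m`-stage Runge–Kutta method. -/
structure RungeKutta (m : ℕ) where
  a : Matrix (Fin m) (Fin m) ℝ
  b : Fin m → ℝ

namespace RungeKutta

variable {m : ℕ} (M : RungeKutta m)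

/-- The nodes `c_i = ∑ j, a_ij`. -/
def c (i : Fin m) : ℝ := ∑ j, M.a i j

/-- Stage order `q`. -/
def HasStageOrder (q : ℕ) : Prop :=
  ∀ k : ℕ, 1 ≤ k → k ≤ q → ∀ i, ∑ j, M.a i j * M.c j ^ (k - 1) = M.c i ^ k / (k : ℝ)

/-- Algebraic stability. -/
def AlgebraicallyStable : Prop :=
  (∀ i, 0 < M.b i) ∧
    (Matrix.of fun i j => M.b i * M.a i j + M.b j * M.a j i - M.b i * M.b j).PosSemidef

/-- Coercivity. -/
def Coercive : Prop :=
  IsUnit M.a ∧ ∃ (d : Fin m → ℝ) (α : ℝ), (∀ i, 0 < d i) ∧ 0 < α ∧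
    ∀ v : Fin m → ℝ,
      α * (v ⬝ᵥ (Matrix.diagonal d *ᵥ v)) ≤ v ⬝ᵥ ((Matrix.diagonal d * M.a⁻¹) *ᵥ v)

/-- Classical order (at least) `p`: for every ordinary differential equation `y' = f(y)` in
`ℝ^N` with smooth `f`, the error after one step of size `h`, starting from the exact solution,
is `O(h^(p+1))` as `h → 0+`. The stages `V h i` of the step are those that tend to the initial
value (for small `h`, the implicit equations have exactly one such solution). -/
def HasClassicalOrder (p : ℕ) : Prop :=
  ∀ (N : ℕ) (f : EuclideanSpace ℝ (Fin N) → EuclideanSpace ℝ (Fin N)), ContDiff ℝ ∞ f →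
    ∀ y : ℝ → EuclideanSpace ℝ (Fin N), (∀ᶠ t in 𝓝 0, HasDerivAt y (f (y t)) t) →
    ∀ V : ℝ → Fin m → EuclideanSpace ℝ (Fin N),
      (∀ i, Filter.Tendsto (fun h => V h i) (𝓝[>] 0) (𝓝 (y 0))) →
      (∀ᶠ h in 𝓝[>] (0 : ℝ), ∀ i, V h i = y 0 + h • ∑ j, M.a i j • f (V h j)) →
      (fun h : ℝ => y 0 + h • ∑ i, M.b i • f (V h i) - y h)
        =O[𝓝[>] 0] (fun h : ℝ => h ^ (p + 1))

/-- `u n ∈ Y` (`0 ≤ n ≤ N`) and `U n i ∈ Y` (`0 ≤ n < N`) are the approximations and internal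
stages of `N` steps with step size `τ` of the Runge–Kutta method applied to `u' + A(u) u = 0`
with initial value `u₀`. -/
def IsNumericalSolution {X Y : Type*}
    [NormedAddCommGroup X] [InnerProductSpace ℝ X]
    [NormedAddCommGroup Y] [InnerProductSpace ℝ Y]
    (ι : Y →L[ℝ] X) (A : Y → (X →ₗ.[ℝ] X)) (u₀ : Y) (τ : ℝ) (N : ℕ)
    (u : Fin (N + 1) → Y) (U : Fin N → Fin m → Y) : Prop :=
  u 0 = u₀ ∧
  ∃ dU : Fin N → Fin m → X,
    (∀ n i, (ι (U n i), -(dU n i)) ∈ (A (U n i)).graph) ∧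
    (∀ n i, ι (U n i) = ι (u n.castSucc) + τ • ∑ j, M.a i j • dU n j) ∧
    (∀ n, ι (u n.succ) = ι (u n.castSucc) + τ • ∑ i, M.b i • dU n i)

end RungeKutta

end Kato

end

/-! Three facts about a single step give the theorem: for small τ the step is solvable with bounded
stages, it is stable in `Y`, and the exact solution satisfies its equations up to `Y`-defects of
size τ^(p+1). A discrete Gronwall argument combines them; it also keeps the approximations in the
ball on which the three facts hold.

Solvability (`exists_isStep`). With K = a⁻¹ the stage equations read Σ_j K_ij (U_j - u₀) + τ A(U_i)
U_i = 0. They are solved by a relaxed iteration that freezes A at the old iterate w and inverts μ +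
τ A(w_i). Since S A S⁻¹ = A + B₁, this resolvent also acts on `Y`. Coercivity keeps a weighted ball
of `Y` invariant. Differences of iterates are contracted in `X`, since A(y) is Lipschitz in y only
as an operator from `Y` to `X`. The limit stays in `Y` because balls of `Y` are closed in `X`.
Uniqueness (`IsStep.unique`) is likewise an estimate in `X`.

Stability (`IsStep.stability`). Writing ⟨E, D - F⟩ in `Y` as ⟨S E, S (D - F)⟩ in `X` and commuting S
past A gives a one-sided Lipschitz condition in `Y` (`inner_sub_le`), provided the comparison stage
is S⁻¹ v with v bounded in `Y`. Algebraic stability propagates it through the step, and coercivity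
bounds the stage errors.

Consistency (`exists_consistent_stages`). Taylor polynomials of u at the nodes leave stage defects
of order τ^(q+1), which is r - 1 powers short of τ^(p+1), where r = p - q. They are therefore
corrected r times by V_{i+1} = δ_i + τ a G_i V_i, where δ_i carries the quadrature defect of degree
q + 1 + i and G_i is the linearized vector field. Each multiplication by G_i costs one power of S
and each factor τ gains one order; conjugating the vector field with S^(r+1-i) at level i keeps
everything bounded in `Y`, and this uses exactly the regularity S^k u ∈ C^(p+1-k). The corrections
telescope, leaving τ a G_r V_r = O(τ^(p+1)) in the stages. Quadratic remainders are O(τ^(2q+2)),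
hence negligible because p ≤ 2q.

In the update the terms bᵀ G_i V_i must be O(τ^p), although V_i is only O(τ^(q+i)). Expanding G_i in
powers of c_l τ reduces this to the order conditions bᵀ Z₁ ⋯ Z_k (a c^(j-1) - c^j / j) = 0 with each
Z either a or diag c (`Chain.order_condition`). These follow from the classical order, applied to
polynomial systems for which the exact solution and the stages are explicit monomials. -/

open scoped ContDiff Topology Matrix
noncomputable section
namespace Kato

/-! ### Graphs of unbounded operators, conjugation by powers of S, and resolvents. -/

section Operators

variable {X Y : Type*}
  [NormedAddCommGroup X] [InnerProductSpace ℝ X]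
  [NormedAddCommGroup Y] [InnerProductSpace ℝ Y]

/-- The inverse `S⁻¹` as a bounded operator on `Y`. -/
def invOnY (ι : Y →L[ℝ] X) (S : Y ≃ₗᵢ[ℝ] X) : Y →L[ℝ] Y :=
  (S.symm.toContinuousLinearEquiv : X →L[ℝ] Y) ∘L ι

variable {ι : Y →L[ℝ] X} {S : Y ≃ₗᵢ[ℝ] X}

@[simp] theorem invOnX_apply (x : X) : invOnX ι S x = ι (S.symm x) := rfl

@[simp] theorem invOnY_apply (y : Y) : invOnY ι S y = S.symm (ι y) := rfl

theorem invOnX_pow_embedding (k : ℕ) (y : Y) :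
    (invOnX ι S ^ k) (ι y) = ι ((invOnY ι S ^ k) y) := by
  induction k generalizing y with
  | zero => simp
  | succ k ih =>
    rw [pow_succ, pow_succ, mul_apply_eq_comp, mul_apply_eq_comp,
      ← ih]
    rfl

theorem invOnX_pow_succ_apply (k : ℕ) (x : X) :
    (invOnX ι S ^ (k + 1)) x = ι ((invOnY ι S ^ k) (S.symm x)) := by
  rw [pow_succ, mul_apply_eq_comp, invOnX_apply, invOnX_pow_embedding]

theorem norm_invOnY_le (hι : IsDenseEmbedding ι) (y : Y) : ‖invOnY ι S y‖ ≤ ‖y‖ := by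
  rw [invOnY_apply, LinearIsometryEquiv.norm_map]
  exact hι.norm_le y

theorem invOnX_injective (hι : IsDenseEmbedding ι) : Function.Injective (invOnX ι S) :=
  hι.injective.comp S.symm.injective

theorem graph_unique (T : X →ₗ.[ℝ] X) {x z z' : X} (h : (x, z) ∈ T.graph)
    (h' : (x, z') ∈ T.graph) : z = z' :=
  T.mem_graph_snd_inj h h' rfl

theorem mem_graph_toPMap_top (f : X →ₗ[ℝ] X) (x z : X) :
    (x, z) ∈ (f.toPMap ⊤).graph ↔ z = f x := by
  rw [LinearPMap.mem_graph_iff]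
  constructor
  · rintro ⟨y, rfl, rfl⟩
    rfl
  · rintro rfl
    exact ⟨⟨x, trivial⟩, rfl, rfl⟩

theorem mem_graph_add_toPMap_top (T : X →ₗ.[ℝ] X) (f : X →ₗ[ℝ] X) (x z : X) :
    (x, z) ∈ (T + f.toPMap ⊤).graph ↔ (x, z - f x) ∈ T.graph := by
  rw [LinearPMap.mem_graph_iff, LinearPMap.mem_graph_iff]
  constructor
  · rintro ⟨y, rfl, rfl⟩
    refine ⟨⟨y, y.2.1⟩, rfl, ?_⟩
    rw [LinearPMap.add_apply]
    exact (add_sub_cancel_right _ _).symm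
  · rintro ⟨y, rfl, h⟩
    refine ⟨⟨y, y.2, trivial⟩, rfl, ?_⟩
    rw [LinearPMap.add_apply]
    exact (eq_sub_iff_add_eq.1 h)

theorem mem_graph_opOnX_iff (hι : IsDenseEmbedding ι) (x z : X) :
    (x, z) ∈ (opOnX ι S).graph ↔ x = invOnX ι S z := by
  rw [mem_graph_opOnX hι.injective]
  constructor
  · rintro ⟨y, rfl, rfl⟩
    simp
  · rintro rfl
    exact ⟨S.symm z, rfl, S.apply_symm_apply z⟩

theorem mem_graph_ppow_opOnX (hι : IsDenseEmbedding ι) (k : ℕ) (x z : X) :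
    (x, z) ∈ (ppow (opOnX ι S) k).graph ↔ x = (invOnX ι S ^ k) z := by
  induction k generalizing x z with
  | zero =>
    rw [ppow, mem_graph_toPMap_top]
    simp [eq_comm]
  | succ k ih =>
    rw [ppow, mem_graph_pcomp]
    simp_rw [ih, mem_graph_opOnX_iff hι]
    rw [pow_succ, mul_apply_eq_comp]
    constructor
    · rintro ⟨w, rfl, rfl⟩
      rfl
    · intro h
      exact ⟨_, h, rfl⟩

/-- The graph of S^k is the flipped graph of the everywhere defined operator S⁻ᵏ. Domain questions
about S^k T S⁻ᵏ thereby become membership in the graph of T. -/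
theorem mem_graph_conj (hι : IsDenseEmbedding ι) (k : ℕ) (T : X →ₗ.[ℝ] X) (v z : X) :
    (v, z) ∈ (conj ι S k T).graph ↔ ((invOnX ι S ^ k) v, (invOnX ι S ^ k) z) ∈ T.graph := by
  unfold conj
  simp_rw [mem_graph_pcomp, mem_graph_ppow_opOnX hι, mem_graph_toPMap_top]
  constructor
  · rintro ⟨w, ⟨w', rfl, h⟩, rfl⟩
    exact h
  · intro h
    exact ⟨_, ⟨_, rfl, h⟩, rfl⟩

theorem Commutator.mem_graph_iff (hι : IsDenseEmbedding ι) {k : ℕ} {A : Y → (X →ₗ.[ℝ] X)}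
    {B : Y → (X →L[ℝ] X)} (h : Commutator ι S k A B) (y : Y) (v z : X) :
    ((invOnX ι S ^ k) v, (invOnX ι S ^ k) z) ∈ (A y).graph ↔ (v, z - B y v) ∈ (A y).graph := by
  rw [← mem_graph_conj hι, h.eq, mem_graph_add_toPMap_top]
  rfl

/-- `A(y) S⁻ᵏ v = S⁻ᵏ (A(y) + Bₖ(y)) v` for `v ∈ Y`. -/
theorem Commutator.apply_invOnY_pow (hι : IsDenseEmbedding ι) {k : ℕ}
    {A : Y → (X →ₗ.[ℝ] X)} {B : Y → (X →L[ℝ] X)} (h : Commutator ι S k A B)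
    {AY : Y → (Y →L[ℝ] X)} (hAY : ∀ y w, (ι w, AY y w) ∈ (A y).graph) (y v : Y) :
    AY y ((invOnY ι S ^ k) v) = (invOnX ι S ^ k) (AY y v + B y (ι v)) := by
  refine graph_unique (A y) (hAY _ _) ?_
  rw [← invOnX_pow_embedding, h.mem_graph_iff hι, add_sub_cancel_right]
  exact hAY y v

/-- `S (A(y) w) = (A(y) + B₁(y)) S w` if `w ∈ Y` and `A(y) w ∈ Y`. -/
theorem Commutator.graph_of_mem (hι : IsDenseEmbedding ι)
    {A : Y → (X →ₗ.[ℝ] X)} {B : Y → (X →L[ℝ] X)} (h : Commutator ι S 1 A B)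
    {y w z : Y} (hw : (ι w, ι z) ∈ (A y).graph) : (S w, S z - B y (S w)) ∈ (A y).graph := by
  rw [← h.mem_graph_iff hι]
  simpa using hw

theorem inner_embedding_comm (hι : IsDenseEmbedding ι) [CompleteSpace X]
    (hS : IsSelfAdjoint (opOnX ι S)) (y z : Y) :
    inner ℝ (S y) (ι z) = inner ℝ (ι y) (S z) := by
  have h := LinearPMap.adjoint_isFormalAdjoint hS.dense_domain
  rw [LinearPMap.isSelfAdjoint_def.1 hS] at h
  have hm : ∀ y : Y, (ι y, S y) ∈ (opOnX ι S).graph := fun y =>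
    (mem_graph_opOnX hι.injective S _ _).2 ⟨y, rfl, rfl⟩
  obtain ⟨y', hy1, hy2⟩ := (LinearPMap.mem_graph_iff _).1 (hm y)
  obtain ⟨z', hz1, hz2⟩ := (LinearPMap.mem_graph_iff _).1 (hm z)
  have := h y' z'
  simp only at hy1 hy2 hz1 hz2
  rwa [hy1, hy2, hz1, hz2] at this

/-- Balls of `Y` are closed in `X`. -/
theorem exists_of_tendsto_embedding [CompleteSpace X] (hι : IsDenseEmbedding ι)
    (hS : IsSelfAdjoint (opOnX ι S)) {y : ℕ → Y} {x : X} {r : ℝ} (hy : ∀ k, ‖y k‖ ≤ r)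
    (hx : Filter.Tendsto (fun k => ι (y k)) Filter.atTop (𝓝 x)) :
    ∃ y₀ : Y, ι y₀ = x ∧ ‖y₀‖ ≤ r := by
  have hb : ∀ z : Y, |inner ℝ x (S z)| ≤ r * ‖ι z‖ := by
    intro z
    refine le_of_tendsto ((hx.inner tendsto_const_nhds).abs) (Filter.Eventually.of_forall ?_)
    intro k
    rw [← inner_embedding_comm hι hS]
    refine (abs_real_inner_le_norm _ _).trans ?_
    rw [LinearIsometryEquiv.norm_map]
    exact mul_le_mul_of_nonneg_right (hy k) (norm_nonneg _)
  -- By `hb` the functional S z ↦ ⟨x, S z⟩ is bounded in terms of |z|, so x lies in the domain of S*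
  -- = S, which is `Y`.
  have hdom : x ∈ ((opOnX ι S).adjoint).domain := by
    rw [LinearPMap.mem_adjoint_domain_iff]
    refine AddMonoidHomClass.continuous_of_bound _ r ?_
    intro v
    obtain ⟨z, hz1, hz2⟩ := (mem_graph_opOnX hι.injective S _ _).1
      ((LinearPMap.mem_graph_iff _).2 ⟨v, rfl, rfl⟩)
    have := hb z
    rw [hz1, hz2] at this
    exact this
  rw [LinearPMap.isSelfAdjoint_def.1 hS] at hdom
  obtain ⟨y₀, hy1, -⟩ := (mem_graph_opOnX hι.injective S _ _).1
      ((LinearPMap.mem_graph_iff _).2 ⟨⟨x, hdom⟩, rfl, rfl⟩)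
  refine ⟨y₀, hy1, ?_⟩
  have hr : 0 ≤ r := (norm_nonneg _).trans (hy 0)
  have hb2 : ∀ w : X, |inner ℝ (S y₀) w| ≤ r * ‖w‖ := by
    intro w
    refine hι.denseRange.induction_on (p := fun w => |inner ℝ (S y₀) w| ≤ r * ‖w‖) w ?_ ?_
    · exact isClosed_le (by fun_prop) (by fun_prop)
    · intro z
      rw [inner_embedding_comm hι hS, hy1]
      exact hb z
  have h := hb2 (S y₀)
  rw [real_inner_self_eq_norm_sq, abs_of_nonneg (sq_nonneg _), LinearIsometryEquiv.norm_map] at h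
  by_contra! hlt
  nlinarith

/-- The resolvent of an m-accretive operator. -/
theorem exists_resolvent {T : X →ₗ.[ℝ] X} (hT : LeftHalfPlaneInResolventSet T) {μ τ : ℝ}
    (hμ : 0 < μ) (hτ : 0 < τ) (f : X) : ∃ v x : X, (v, x) ∈ T.graph ∧ μ • v + τ • x = f := by
  -- A real spectral parameter and a real right-hand side decouple the two components; the real one
  -- is the resolvent equation.
  obtain ⟨⟨w, z⟩, ⟨h, -⟩, -⟩ := hT (-(μ / τ)) 0 (by simpa using div_pos hμ hτ) (τ⁻¹ • f) 0
  refine ⟨w, T w, T.mem_graph w, ?_⟩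
  simp only [zero_smul, add_zero, neg_smul, sub_neg_eq_add] at h
  have : f = τ • (T w + (μ / τ) • (w : X)) := by rw [h, smul_inv_smul₀ hτ.ne']
  rw [this, smul_add, smul_smul, mul_div_cancel₀ _ hτ.ne', add_comm]

theorem MAccretive.inner_nonneg {A : Y → (X →ₗ.[ℝ] X)} (hA : MAccretive ι A) {y : Y} {v x : X}
    (h : (v, x) ∈ (A y).graph) : 0 ≤ inner ℝ v x := by
  obtain ⟨w, rfl, rfl⟩ := (LinearPMap.mem_graph_iff _).1 h
  exact hA.accretive y w

theorem graph_sub {T : X →ₗ.[ℝ] X} {v x v' x' : X} (h : (v, x) ∈ T.graph)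
    (h' : (v', x') ∈ T.graph) : (v - v', x - x') ∈ T.graph :=
  T.graph.sub_mem h h'

/-- The resolvent of `A(y) + B(y)` for small `τ`. -/
theorem exists_resolvent_add [CompleteSpace X] {A : Y → (X →ₗ.[ℝ] X)} (hA : MAccretive ι A)
    {y : Y} {B : X →L[ℝ] X} {b μ τ : ℝ} (hμ : 0 < μ) (hτ : 0 < τ) (hB : ∀ v, ‖B v‖ ≤ b * ‖v‖)
    (hb : τ * b ≤ μ / 2) (f : X) :
    ∃ v x : X, (v, x) ∈ (A y).graph ∧ μ • v + τ • (x + B v) = f := by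
  choose r x hr hx using fun g : X => exists_resolvent (hA.resolvent y) hμ hτ g
  -- Accretivity makes the resolvent Lipschitz with constant 1/μ, and τ b ≤ μ/2 leaves the factor
  -- 1/2. The fixed point solves the perturbed equation.
  have hlip : LipschitzWith (1 / 2) fun v => r (f - τ • B v) := by
    refine LipschitzWith.of_dist_le_mul fun v w => ?_
    rw [dist_eq_norm, dist_eq_norm]
    set d := r (f - τ • B v) - r (f - τ • B w)
    have h1 := hA.inner_nonneg (graph_sub (hr (f - τ • B v)) (hr (f - τ • B w)))
    have h2 : μ • d + τ • (x (f - τ • B v) - x (f - τ • B w)) = -(τ • B (v - w)) := by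
      have e1 := hx (f - τ • B v)
      have e2 := hx (f - τ • B w)
      rw [map_sub]
      have e3 : μ • d + τ • (x (f - τ • B v) - x (f - τ • B w)) =
          (f - τ • B v) - (f - τ • B w) := by
        conv_rhs => rw [← e1, ← e2]
        module
      rw [e3]
      module
    have h3 : μ * ‖d‖ ^ 2 ≤ inner ℝ d (-(τ • B (v - w))) := by
      rw [← h2, inner_add_right, inner_smul_right, inner_smul_right, real_inner_self_eq_norm_sq]
      have := mul_nonneg hτ.le h1
      linarith
    have h4 : inner ℝ d (-(τ • B (v - w))) ≤ ‖d‖ * (μ / 2 * ‖v - w‖) := by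
      refine (real_inner_le_norm _ _).trans ?_
      rw [norm_neg, norm_smul, Real.norm_of_nonneg hτ.le]
      refine mul_le_mul_of_nonneg_left ?_ (norm_nonneg _)
      have := mul_le_mul_of_nonneg_left (hB (v - w)) hτ.le
      have := mul_le_mul_of_nonneg_right hb (norm_nonneg (v - w))
      linarith
    have h5 : ‖d‖ ≤ 1 / 2 * ‖v - w‖ := by
      rcases (norm_nonneg d).eq_or_lt with h0 | h0
      · rw [← h0]; positivity
      · have : (μ * ‖d‖) * ‖d‖ ≤ (μ * ‖d‖) * (1 / 2 * ‖v - w‖) := by linarith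
        exact le_of_mul_le_mul_left this (by positivity)
    simpa using h5
  have hc : ContractingWith (1 / 2) fun v => r (f - τ • B v) :=
    ⟨by rw [← NNReal.coe_lt_coe]; norm_num, hlip⟩
  refine ⟨hc.fixedPoint, x (f - τ • B hc.fixedPoint), ?_, ?_⟩
  · have h1 := hr (f - τ • B hc.fixedPoint)
    have h2 : r (f - τ • B hc.fixedPoint) = hc.fixedPoint := hc.fixedPoint_isFixedPt
    rwa [h2] at h1
  · have h1 := hx (f - τ • B hc.fixedPoint)
    have h2 : r (f - τ • B hc.fixedPoint) = hc.fixedPoint := hc.fixedPoint_isFixedPt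
    rw [h2] at h1
    rw [smul_add, ← add_assoc, h1, sub_add_cancel]

end Operators
end Kato
end

/-! ### Order conditions deduced from the classical order. -/

open scoped ContDiff Topology Matrix
noncomputable section
namespace Kato

theorem eq_zero_of_isBigO_pow {d p : ℕ} (hd : d ≤ p) {K : ℝ}
    (h : (fun h : ℝ => h ^ d * K) =O[𝓝[>] 0] fun h : ℝ => h ^ (p + 1)) : K = 0 := by
  obtain ⟨C, hC⟩ := h.bound
  have h1 : ∀ᶠ h : ℝ in 𝓝[>] 0, |K| ≤ C * h ^ (p + 1 - d) := by
    filter_upwards [hC, self_mem_nhdsWithin] with h hh hpos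
    have hpos : 0 < h := hpos
    rw [norm_mul, norm_pow, norm_pow, Real.norm_of_nonneg hpos.le, Real.norm_eq_abs] at hh
    have e : h ^ (p + 1) = h ^ d * h ^ (p + 1 - d) := by
      rw [← pow_add]; congr 1; omega
    rw [e] at hh
    have : h ^ d * |K| ≤ h ^ d * (C * h ^ (p + 1 - d)) := by linarith
    exact le_of_mul_le_mul_left this (by positivity)
  have h2 : Filter.Tendsto (fun h : ℝ => C * h ^ (p + 1 - d)) (𝓝[>] 0) (𝓝 0) := by
    have : Filter.Tendsto (fun h : ℝ => C * h ^ (p + 1 - d)) (𝓝 0)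
        (𝓝 (C * 0 ^ (p + 1 - d))) := (by fun_prop : Continuous _).tendsto 0
    rw [zero_pow (by omega), mul_zero] at this
    exact this.mono_left nhdsWithin_le_nhds
  exact abs_nonpos_iff.1 (ge_of_tendsto h2 h1)

namespace RungeKutta

/-- The degrees of the components of the solution of the test equations
`y₀' = 1`, `y_{i+1}' = y₀ ^ (l i) * y_i`. -/
def testDeg (l : ℕ → ℕ) : ℕ → ℕ
  | 0 => 1
  | r + 1 => testDeg l r + l r + 1

/-- The coefficients of the components of the solution of the test equations. -/
def testCoeff (l : ℕ → ℕ) : ℕ → ℝ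
  | 0 => 1
  | r + 1 => testCoeff l r / testDeg l (r + 1)

variable {m : ℕ} (M : RungeKutta m)

/-- The coefficients of the internal stages of the method for the test equations. -/
def testStage (l : ℕ → ℕ) : ℕ → Fin m → ℝ
  | 0 => M.c
  | r + 1 => fun i => ∑ j, M.a i j * (M.c j ^ l r * testStage l r j)

theorem testDeg_pos (l : ℕ → ℕ) (r : ℕ) : 0 < testDeg l r := by
  cases r <;> simp [testDeg]

/-- The right-hand side of the test equations. -/
def testField (l : ℕ → ℕ) (r : ℕ) (y : EuclideanSpace ℝ (Fin (r + 2))) :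
    EuclideanSpace ℝ (Fin (r + 2)) :=
  WithLp.toLp 2 (Fin.cases 1 fun k : Fin (r + 1) => y 0 ^ l k * y k.castSucc)

theorem contDiff_testField (l : ℕ → ℕ) (r : ℕ) : ContDiff ℝ ∞ (testField l r) := by
  have hc : ∀ i : Fin (r + 2), ContDiff ℝ ∞ fun y : EuclideanSpace ℝ (Fin (r + 2)) => y i :=
    contDiff_euclidean.1 contDiff_id
  refine contDiff_euclidean.2 fun i => ?_
  refine Fin.cases ?_ (fun k => ?_) i
  · exact contDiff_const
  · exact ((hc 0).pow _).mul (hc _)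

/-- Started at zero, the test equations have monomial solutions. Their triangular form also makes
the stages explicit monomials in h, so the local error is known exactly in every component. -/
theorem isBigO_testField {p : ℕ} (h : M.HasClassicalOrder p) (l : ℕ → ℕ) (r : ℕ)
    (i : Fin (r + 2)) :
    (fun h : ℝ => h * ∑ j, M.b j * testField l r
      (WithLp.toLp 2 fun k : Fin (r + 2) => h ^ testDeg l k * M.testStage l k j) i -
        testCoeff l i * h ^ testDeg l i) =O[𝓝[>] 0] fun h : ℝ => h ^ (p + 1) := by
  set y : ℝ → EuclideanSpace ℝ (Fin (r + 2)) :=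
    fun t => WithLp.toLp 2 fun k : Fin (r + 2) => testCoeff l k * t ^ testDeg l k with hy
  set V : ℝ → Fin m → EuclideanSpace ℝ (Fin (r + 2)) :=
    fun h j => WithLp.toLp 2 fun k : Fin (r + 2) => h ^ testDeg l k * M.testStage l k j with hV
  have hy0 : y 0 = 0 := by
    ext k
    simp [hy, (testDeg_pos l k).ne']
  have hderiv : ∀ t, HasDerivAt y (testField l r (y t)) t := by
    intro t
    have h1 : HasDerivAt (fun t => fun k : Fin (r + 2) => testCoeff l k * t ^ testDeg l k)
        (WithLp.ofLp (testField l r (y t))) t := by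
      refine hasDerivAt_pi.2 fun k => ?_
      refine Fin.cases ?_ (fun k => ?_) k
      · have : HasDerivAt (fun t : ℝ => testCoeff l 0 * t ^ testDeg l 0) 1 t := by
          simp only [testCoeff, testDeg, one_mul, pow_one]
          exact hasDerivAt_id' t
        exact this
      · have := (hasDerivAt_pow (testDeg l (k + 1)) t).const_mul (testCoeff l (k + 1))
        refine HasDerivAt.congr_deriv this ?_
        have hne : (testDeg l (k + 1) : ℝ) ≠ 0 := by
          exact_mod_cast (testDeg_pos l _).ne'
        have e : testCoeff l (k + 1) * (testDeg l (k + 1) : ℝ) = testCoeff l k := by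
          rw [testCoeff]; field_simp
        rw [← mul_assoc, e]
        simp [testField, hy, testCoeff, testDeg, pow_add]
        ring
    exact ((PiLp.continuousLinearEquiv 2 ℝ fun _ : Fin (r + 2) => ℝ).symm.hasFDerivAt
      (x := fun k : Fin (r + 2) => testCoeff l k * t ^ testDeg l k)).comp_hasDerivAt t h1
  have key := h (r + 2) (testField l r) (contDiff_testField l r) y
    (Filter.Eventually.of_forall hderiv) V ?_ ?_
  · rw [hy0] at key
    refine (Asymptotics.IsBigO.of_bound 1 (Filter.Eventually.of_forall fun t => ?_)).trans key
    rw [one_mul]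
    refine le_trans (le_of_eq ?_) (PiLp.norm_apply_le _ i)
    simp [hV, hy, Finset.sum_apply]
  · intro j
    rw [hy0]
    have hcont : Continuous fun h => V h j :=
      (PiLp.continuous_toLp 2 _).comp (by fun_prop)
    have := hcont.tendsto 0
    have e : V 0 j = 0 := by
      ext k
      simp [hV, (testDeg_pos l k).ne']
    rw [e] at this
    exact this.mono_left nhdsWithin_le_nhds
  · refine Filter.Eventually.of_forall fun t j => ?_
    rw [hy0, zero_add]
    ext k
    refine Fin.cases ?_ (fun k => ?_) k
    · simp [hV, testDeg, testStage, testField, RungeKutta.c]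
    · simp only [hV, Fin.val_succ, testDeg, testStage, testField, PiLp.smul_apply, WithLp.ofLp_sum,
        Finset.sum_apply, WithLp.ofLp_smul, Pi.smul_apply, Fin.cases_succ, smul_eq_mul,
        Finset.mul_sum, Fin.val_castSucc, Fin.val_zero, pow_one]
      refine Finset.sum_congr rfl fun i _ => ?_
      ring

theorem sum_weights {p : ℕ} (h : M.HasClassicalOrder p) (hp : 1 ≤ p) : ∑ j, M.b j = 1 := by
  have key := M.isBigO_testField h (fun _ => 0) 0 0
  have : ∀ t : ℝ, t * ∑ j, M.b j * testField (fun _ => 0) 0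
      (WithLp.toLp 2 fun k : Fin 2 => t ^ testDeg (fun _ => 0) k * M.testStage (fun _ => 0) k j) 0 -
        testCoeff (fun _ => 0) (0 : Fin 2) * t ^ testDeg (fun _ => 0) (0 : Fin 2) =
      t ^ 1 * (∑ j, M.b j - 1) := by
    intro t
    simp [testField, testCoeff, testDeg]
    ring
  simp_rw [this] at key
  linarith [eq_zero_of_isBigO_pow hp key]

/-- The last component of the local error is a constant times h^d with d ≤ p. Being O(h^(p+1)), it
must vanish. -/
theorem test_order_condition {p : ℕ} (h : M.HasClassicalOrder p) (l : ℕ → ℕ) (r : ℕ)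
    (hr : testDeg l (r + 1) ≤ p) :
    ∑ j, M.b j * (M.c j ^ l r * M.testStage l r j) = testCoeff l (r + 1) := by
  have key := M.isBigO_testField h l r (Fin.last _)
  have : ∀ t : ℝ, t * ∑ j, M.b j * testField l r
      (WithLp.toLp 2 fun k : Fin (r + 2) => t ^ testDeg l k * M.testStage l k j) (Fin.last _) -
        testCoeff l (Fin.last (r + 1)) * t ^ testDeg l (Fin.last (r + 1)) =
      t ^ testDeg l (r + 1) *
        (∑ j, M.b j * (M.c j ^ l r * M.testStage l r j) - testCoeff l (r + 1)) := by
    intro t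
    have e : Fin.last (r + 1) = (Fin.last r).succ := rfl
    simp only [e, testField, Fin.cases_succ, Fin.val_succ, Fin.val_last, testDeg, testStage,
      Fin.val_zero, pow_one, Fin.val_castSucc, mul_sub, Finset.mul_sum]
    congr 1
    · refine Finset.sum_congr rfl fun i _ => ?_
      ring
    · ring
  simp_rw [this] at key
  linarith [eq_zero_of_isBigO_pow hr key]

/-- The row vectors `bᵀ Z₁ ⋯ Z_k` with `Z_i ∈ {diag c, a}`, of weight `k + 1`. -/
inductive Chain : ℕ → (Fin m → ℝ) → Prop
  | base : Chain 1 M.b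
  | node {k : ℕ} {w : Fin m → ℝ} : Chain k w → Chain (k + 1) fun j => w j * M.c j
  | coeff {k : ℕ} {w : Fin m → ℝ} : Chain k w → Chain (k + 1) fun j => ∑ i, w i * M.a i j

theorem testDeg_congr {l l' : ℕ → ℕ} {r : ℕ} (h : ∀ i < r, l i = l' i) :
    testDeg l r = testDeg l' r := by
  induction r with
  | zero => rfl
  | succ r ih =>
    rw [testDeg, testDeg, ih fun i hi => h i (by omega), h r (by omega)]

theorem testCoeff_congr {l l' : ℕ → ℕ} {r : ℕ} (h : ∀ i < r, l i = l' i) :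
    testCoeff l r = testCoeff l' r := by
  induction r with
  | zero => rfl
  | succ r ih =>
    rw [testCoeff, testCoeff, ih fun i hi => h i (by omega), testDeg_congr h]

theorem testStage_congr {l l' : ℕ → ℕ} {r : ℕ} (h : ∀ i < r, l i = l' i) :
    M.testStage l r = M.testStage l' r := by
  induction r with
  | zero => rfl
  | succ r ih =>
    rw [testStage, testStage, ih fun i hi => h i (by omega), h r (by omega)]

variable {M}

/-- A chain sees a test component only through its coefficient and degree, as if the stage were the
exact monomial at the nodes. A factor diag c raises e by one; a factor a appends an equation with
exponent e, whose integration accounts for the division by n + 1. -/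
theorem Chain.exists_value {p k : ℕ} {w : Fin m → ℝ} (hw : M.Chain k w)
    (h : M.HasClassicalOrder p) :
    ∃ κ : ℕ → ℝ, ∀ (l : ℕ → ℕ) (r e : ℕ), testDeg l r + e + k ≤ p →
      ∑ j, w j * (M.c j ^ e * M.testStage l r j) = testCoeff l r * κ (testDeg l r + e) := by
  induction hw with
  | base =>
    refine ⟨fun n => 1 / (n + 1 : ℕ), fun l r e hp => ?_⟩
    have hc : ∀ i < r, l i = Function.update l r e i := fun i hi => by
      rw [Function.update_of_ne hi.ne]
    have := M.test_order_condition h (Function.update l r e) r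
      (by rw [testDeg, ← testDeg_congr hc]; simpa using hp)
    rw [testCoeff, testDeg, ← M.testStage_congr hc, ← testDeg_congr hc, ← testCoeff_congr hc] at this
    simp only [Function.update_self] at this
    rw [this]
    ring
  | @node k w _ ih =>
    obtain ⟨κ, hκ⟩ := ih
    refine ⟨fun n => κ (n + 1), fun l r e hp => ?_⟩
    have := hκ l r (e + 1) (by omega)
    rw [← add_assoc] at this
    rw [← this]
    refine Finset.sum_congr rfl fun j _ => ?_
    ring
  | @coeff k w _ ih =>
    obtain ⟨κ, hκ⟩ := ih
    refine ⟨fun n => κ (n + 1) / (n + 1 : ℕ), fun l r e hp => ?_⟩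
    have hc : ∀ i < r, l i = Function.update l r e i := fun i hi => by
      rw [Function.update_of_ne hi.ne]
    have := hκ (Function.update l r e) (r + 1) 0
      (by rw [testDeg, ← testDeg_congr hc, Function.update_self]; omega)
    rw [testCoeff, testDeg, testStage, ← M.testStage_congr hc, ← testDeg_congr hc,
      ← testCoeff_congr hc, Function.update_self] at this
    simp only [pow_zero, one_mul, add_zero] at this
    calc ∑ j, (∑ i, w i * M.a i j) * (M.c j ^ e * M.testStage l r j)
        = ∑ i, w i * ∑ j, M.a i j * (M.c j ^ e * M.testStage l r j) := by
          simp_rw [Finset.sum_mul, Finset.mul_sum]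
          rw [Finset.sum_comm]
          refine Finset.sum_congr rfl fun i _ => Finset.sum_congr rfl fun j _ => ?_
          ring
      _ = _ := by
          rw [this]
          ring

/-- The order conditions for chains: `w (a c^(j-1) - c^j / j) = 0`. -/
theorem Chain.order_condition {p k : ℕ} {w : Fin m → ℝ} (hw : M.Chain k w)
    (h : M.HasClassicalOrder p) {j : ℕ} (hj : 2 ≤ j) (hjk : j + k ≤ p) :
    ∑ i, w i * (∑ i', M.a i i' * M.c i' ^ (j - 1) - M.c i ^ j / j) = 0 := by
  obtain ⟨κ, hκ⟩ := hw.exists_value h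
  -- Two test data of the same degree j: c^j with coefficient 1, and a c^(j-1) with coefficient 1/j.
  -- The common value κ j cancels.
  have h0 := hκ (fun _ => 0) 0 (j - 1) (by simp [testDeg]; omega)
  have h1 := hκ (fun _ => j - 2) 1 0 (by simp [testDeg]; omega)
  simp only [testStage, testCoeff, testDeg, pow_zero, one_mul] at h0 h1
  have e1 : ∀ i, M.c i ^ (j - 1) * M.c i = M.c i ^ j := fun i => by
    rw [← pow_succ]; congr 1; omega
  have e2 : ∀ i, M.c i ^ (j - 2) * M.c i = M.c i ^ (j - 1) := fun i => by
    rw [← pow_succ]; congr 1; omega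
  have e3 : 1 + (j - 1) = j := by omega
  have e4 : 1 + (j - 2) + 1 = j := by omega
  simp only [e1, e2, e3, e4, add_zero] at h0 h1
  simp_rw [mul_sub, Finset.sum_sub_distrib, mul_div_assoc', ← Finset.sum_div]
  rw [h0, h1]
  ring

/-- The quadrature conditions `bᵀ c^(k-1) = 1 / k`. -/
theorem quadrature_condition {p : ℕ} (h : M.HasClassicalOrder p) {k : ℕ} (hk : 1 ≤ k)
    (hkp : k ≤ p) : ∑ j, M.b j * M.c j ^ (k - 1) = 1 / k := by
  obtain rfl | ⟨e, rfl⟩ : k = 1 ∨ ∃ e, k = e + 2 := by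
    rcases Nat.lt_or_ge k 2 with h | h
    · left; omega
    · right; exact ⟨k - 2, by omega⟩
  · simpa using M.sum_weights h (by omega)
  · have := M.test_order_condition h (fun _ => e) 0 (by simp [testDeg]; omega)
    simp only [testStage, testCoeff, testDeg, ← pow_succ] at this
    rw [show e + 2 - 1 = e + 1 from rfl, this, show 1 + e + 1 = e + 2 by ring]

end RungeKutta
end Kato
end

/-! ### Weighted stage norms, coercivity and algebraic stability. -/

open scoped ContDiff Topology Matrix
noncomputable section
namespace Kato

section Weighted

variable {Z : Type*} [NormedAddCommGroup Z] {m : ℕ}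

/-- The weighted square norm of a vector of stages. -/
def wnorm (d : Fin m → ℝ) (V : Fin m → Z) : ℝ := ∑ i, d i * ‖V i‖ ^ 2

variable {d : Fin m → ℝ}

theorem wnorm_nonneg (hd : ∀ i, 0 < d i) (V : Fin m → Z) : 0 ≤ wnorm d V :=
  Finset.sum_nonneg fun i _ => mul_nonneg (hd i).le (sq_nonneg _)

theorem single_le_wnorm (hd : ∀ i, 0 < d i) (V : Fin m → Z) (i : Fin m) :
    d i * ‖V i‖ ^ 2 ≤ wnorm d V :=
  Finset.single_le_sum (f := fun i => d i * ‖V i‖ ^ 2)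
    (fun i _ => mul_nonneg (hd i).le (sq_nonneg _)) (Finset.mem_univ i)

theorem exists_pos_le (hd : ∀ i, 0 < d i) : ∃ δ, 0 < δ ∧ ∀ i, δ ≤ d i := by
  rcases isEmpty_or_nonempty (Fin m) with h | h
  · exact ⟨1, one_pos, fun i => h.elim i⟩
  · obtain ⟨i, hi⟩ := Finite.exists_min d
    exact ⟨d i, hd i, hi⟩

theorem sq_norm_add_le {s : ℝ} (hs : 0 < s) (x y : Z) :
    ‖x + y‖ ^ 2 ≤ (1 + s) * ‖x‖ ^ 2 + (1 + 1 / s) * ‖y‖ ^ 2 := by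
  have h1 := norm_add_le x y
  have h2 : ‖x + y‖ ^ 2 ≤ (‖x‖ + ‖y‖) ^ 2 := by gcongr
  have h3 : 2 * ‖x‖ * ‖y‖ ≤ s * ‖x‖ ^ 2 + 1 / s * ‖y‖ ^ 2 := by
    have : 0 ≤ (s * ‖x‖ - ‖y‖) ^ 2 / s := by positivity
    have e : (s * ‖x‖ - ‖y‖) ^ 2 / s = s * ‖x‖ ^ 2 + 1 / s * ‖y‖ ^ 2 - 2 * ‖x‖ * ‖y‖ := by
      field_simp; ring
    linarith
  linarith

variable [InnerProductSpace ℝ Z]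

/-- A Gram matrix is a sum of rank-one matrices v vᵀ, so the double sum is a sum of values of the
quadratic form of Q. Symmetry of Q is not needed, which lets this serve coercivity as well. -/
theorem sum_mul_inner_nonneg {Q : Matrix (Fin m) (Fin m) ℝ} (hQ : ∀ v, 0 ≤ v ⬝ᵥ (Q *ᵥ v))
    (V : Fin m → Z) : 0 ≤ ∑ i, ∑ j, Q i j * inner ℝ (V i) (V j) := by
  obtain ⟨n, v, hv⟩ := Matrix.posSemidef_iff_eq_sum_vecMulVec.1 (Matrix.posSemidef_gram ℝ V)
  have e : ∀ i j, inner ℝ (V i) (V j) = ∑ k, v k i * v k j := by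
    intro i j
    have := congrFun (congrFun hv i) j
    simpa [Matrix.gram_apply, Matrix.sum_apply, Matrix.vecMulVec_apply] using this
  have : ∑ i, ∑ j, Q i j * inner ℝ (V i) (V j) = ∑ k, v k ⬝ᵥ (Q *ᵥ v k) := by
    simp_rw [e, dotProduct, Matrix.mulVec, dotProduct, Finset.mul_sum]
    rw [Finset.sum_comm' (t' := Finset.univ) (s' := fun _ => Finset.univ) (by simp)]
    rw [Finset.sum_comm]
    simp_rw [Finset.sum_comm (s := Finset.univ (α := Fin m)) (t := Finset.univ (α := Fin n))]
    refine Finset.sum_congr rfl fun k _ => Finset.sum_congr rfl fun i _ =>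
      Finset.sum_congr rfl fun j _ => ?_
    ring
  rw [this]
  exact Finset.sum_nonneg fun k _ => hQ _

theorem sq_sum_mul_norm_le (k : Fin m → ℝ) (V : Fin m → Z) :
    ‖∑ j, k j • V j‖ ^ 2 ≤ (∑ j, k j ^ 2) * ∑ j, ‖V j‖ ^ 2 := by
  refine le_trans ?_ (Finset.sum_mul_sq_le_sq_mul_sq Finset.univ (fun j => |k j|)
    (fun j => ‖V j‖) |>.trans_eq (by simp))
  gcongr
  refine (norm_sum_le _ _).trans_eq ?_
  simp [norm_smul]

theorem wnorm_mul_le (hd : ∀ i, 0 < d i) {δ : ℝ} (hδ : 0 < δ) (hδd : ∀ i, δ ≤ d i)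
    (K : Matrix (Fin m) (Fin m) ℝ) (V : Fin m → Z) :
    wnorm d (fun i => ∑ j, K i j • V j) ≤ (∑ i, d i * ∑ j, K i j ^ 2) / δ * wnorm d V := by
  have h1 : ∑ j, ‖V j‖ ^ 2 ≤ wnorm d V / δ := by
    rw [le_div_iff₀ hδ, Finset.sum_mul]
    exact Finset.sum_le_sum fun i _ => by
      rw [mul_comm]; exact mul_le_mul_of_nonneg_right (hδd i) (sq_nonneg _)
  calc wnorm d (fun i => ∑ j, K i j • V j)
      ≤ ∑ i, d i * ((∑ j, K i j ^ 2) * (wnorm d V / δ)) := by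
        refine Finset.sum_le_sum fun i _ => mul_le_mul_of_nonneg_left ?_ (hd i).le
        exact (sq_sum_mul_norm_le _ _).trans
          (mul_le_mul_of_nonneg_left h1 (Finset.sum_nonneg fun j _ => sq_nonneg _))
    _ = _ := by
        rw [Finset.sum_div, Finset.sum_mul]
        refine Finset.sum_congr rfl fun i _ => ?_
        ring

/-- Coercivity of a matrix in a weighted inner product. -/
def CoerciveMatrix (K : Matrix (Fin m) (Fin m) ℝ) (d : Fin m → ℝ) (α : ℝ) : Prop :=
  ∀ v : Fin m → ℝ, α * (v ⬝ᵥ (Matrix.diagonal d *ᵥ v)) ≤ v ⬝ᵥ ((Matrix.diagonal d * K) *ᵥ v)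

variable {K : Matrix (Fin m) (Fin m) ℝ} {α : ℝ}

theorem CoerciveMatrix.wnorm_le (h : CoerciveMatrix K d α) (V : Fin m → Z) :
    α * wnorm d V ≤ ∑ i, d i * inner ℝ (V i) (∑ j, K i j • V j) := by
  have key := sum_mul_inner_nonneg (Q := Matrix.diagonal d * K - α • Matrix.diagonal d)
    (fun v => by
      rw [Matrix.sub_mulVec, dotProduct_sub, Matrix.smul_mulVec, dotProduct_smul, smul_eq_mul]
      linarith [h v]) V
  have e : ∀ i, ∑ j, (Matrix.diagonal d * K - α • Matrix.diagonal d) i j * inner ℝ (V i) (V j) =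
      d i * inner ℝ (V i) (∑ j, K i j • V j) - α * (d i * ‖V i‖ ^ 2) := by
    intro i
    simp only [Matrix.sub_apply, Matrix.diagonal_mul, Matrix.smul_apply, sub_mul,
      Finset.sum_sub_distrib, inner_sum, inner_smul_right, Finset.mul_sum, smul_eq_mul,
      Matrix.diagonal_apply, mul_ite, mul_zero, ite_mul, zero_mul, Finset.sum_ite_eq,
      Finset.mem_univ, if_true, real_inner_self_eq_norm_sq]
    simp only [mul_assoc]
  simp_rw [e, Finset.sum_sub_distrib] at key
  rw [wnorm, Finset.mul_sum]
  linarith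

/-- The relaxation `V ↦ f + (μ - K) V` is a contraction up to the factor `μ`. -/
theorem CoerciveMatrix.wnorm_relax_le (h : CoerciveMatrix K d α) (hd : ∀ i, 0 < d i) (hα : 0 < α)
    {μ k : ℝ} (hμ : 0 < μ) (hk : k ≤ μ * α) {V : Fin m → Z}
    (hK : wnorm d (fun i => ∑ j, K i j • V j) ≤ k * wnorm d V) (f : Fin m → Z) :
    wnorm d (fun i => f i + (μ • V i - ∑ j, K i j • V j)) ≤
      (μ ^ 2 - μ * α / 2) * wnorm d V + (1 + 2 * μ / α) * wnorm d f := by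
  -- Expanding the square gives the factor μ² - 2μα + k, and k ≤ μα. Half of the gain μα is then
  -- spent on f by Young's inequality with parameter α/(2μ).
  have h1 : wnorm d (fun i => μ • V i - ∑ j, K i j • V j) ≤ (μ ^ 2 - μ * α) * wnorm d V := by
    have e : wnorm d (fun i => μ • V i - ∑ j, K i j • V j) =
        μ ^ 2 * wnorm d V - 2 * μ * (∑ i, d i * inner ℝ (V i) (∑ j, K i j • V j)) +
          wnorm d (fun i => ∑ j, K i j • V j) := by
      simp only [wnorm, Finset.mul_sum, ← Finset.sum_sub_distrib, ← Finset.sum_add_distrib]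
      refine Finset.sum_congr rfl fun i _ => ?_
      rw [norm_sub_sq_real, norm_smul, real_inner_smul_left, mul_pow, Real.norm_eq_abs, sq_abs]
      ring
    have h2 := mul_le_mul_of_nonneg_left (h.wnorm_le V) hμ.le
    have h3 := mul_le_mul_of_nonneg_right hk (wnorm_nonneg hd V)
    rw [e]
    linarith
  have hs : 0 < α / (2 * μ) := by positivity
  have h2 : wnorm d (fun i => f i + (μ • V i - ∑ j, K i j • V j)) ≤
      (1 + α / (2 * μ)) * wnorm d (fun i => μ • V i - ∑ j, K i j • V j) +
        (1 + 1 / (α / (2 * μ))) * wnorm d f := by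
    simp only [wnorm, Finset.mul_sum, ← Finset.sum_add_distrib]
    refine Finset.sum_le_sum fun i _ => ?_
    have := mul_le_mul_of_nonneg_left (sq_norm_add_le hs (μ • V i - ∑ j, K i j • V j) (f i))
      (hd i).le
    rw [add_comm (f i)]
    linarith
  refine h2.trans ?_
  have h3 : (1 + α / (2 * μ)) * wnorm d (fun i => μ • V i - ∑ j, K i j • V j) ≤
      (1 + α / (2 * μ)) * ((μ ^ 2 - μ * α) * wnorm d V) :=
    mul_le_mul_of_nonneg_left h1 (by positivity)
  have h4 : (1 + α / (2 * μ)) * (μ ^ 2 - μ * α) = μ ^ 2 - μ * α / 2 - α ^ 2 / 2 := by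
    field_simp; ring
  have h5 : 1 + 1 / (α / (2 * μ)) = 1 + 2 * μ / α := by
    field_simp
  rw [h5]
  rw [← mul_assoc, h4] at h3
  have h6 : 0 ≤ α ^ 2 / 2 * wnorm d V := mul_nonneg (by positivity) (wnorm_nonneg hd V)
  linarith

end Weighted

namespace RungeKutta

variable {Z : Type*} [NormedAddCommGroup Z] [InnerProductSpace ℝ Z] {m : ℕ} {M : RungeKutta m}

/-- The right side minus the left side is τ² Σ_ij (b_i a_ij + b_j a_ji - b_i b_j) ⟨D_i, D_j⟩. -/
theorem AlgebraicallyStable.norm_sq_le (h : M.AlgebraicallyStable) {τ : ℝ} {e : Z}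
    {D E : Fin m → Z} (hE : ∀ i, E i = e + τ • ∑ j, M.a i j • D j) :
    ‖e + τ • ∑ i, M.b i • D i‖ ^ 2 ≤ ‖e‖ ^ 2 + 2 * τ * ∑ i, M.b i * inner ℝ (E i) (D i) := by
  have key := sum_mul_inner_nonneg (Q := Matrix.of fun i j =>
    M.b i * M.a i j + M.b j * M.a j i - M.b i * M.b j)
    (fun v => by simpa using h.2.dotProduct_mulVec_nonneg v) D
  have e1 : ∑ i, ∑ j, M.b j * M.a j i * inner ℝ (D i) (D j) =
      ∑ i, ∑ j, M.b i * M.a i j * inner ℝ (D i) (D j) := by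
    rw [Finset.sum_comm]
    refine Finset.sum_congr rfl fun i _ => Finset.sum_congr rfl fun j _ => ?_
    rw [real_inner_comm]
  have e2 : ‖∑ i, M.b i • D i‖ ^ 2 = ∑ i, ∑ j, M.b i * M.b j * inner ℝ (D i) (D j) := by
    rw [← real_inner_self_eq_norm_sq, sum_inner]
    refine Finset.sum_congr rfl fun i _ => ?_
    rw [inner_sum]
    refine Finset.sum_congr rfl fun j _ => ?_
    rw [real_inner_smul_left, real_inner_smul_right]
    ring
  have e3 : ∑ i, M.b i * inner ℝ (E i) (D i) = inner ℝ e (∑ i, M.b i • D i) +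
      τ * ∑ i, ∑ j, M.b i * M.a i j * inner ℝ (D i) (D j) := by
    rw [inner_sum, Finset.mul_sum, ← Finset.sum_add_distrib]
    refine Finset.sum_congr rfl fun i _ => ?_
    rw [hE, inner_add_left, real_inner_smul_left, sum_inner, real_inner_smul_right, mul_add,
      Finset.mul_sum, Finset.mul_sum, Finset.mul_sum]
    congr 1
    refine Finset.sum_congr rfl fun j _ => ?_
    rw [real_inner_smul_left, real_inner_comm]
    ring
  simp only [Matrix.of_apply, add_mul, sub_mul, Finset.sum_add_distrib, Finset.sum_sub_distrib,
    e1] at key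
  rw [← e2] at key
  rw [norm_add_sq_real, norm_smul, real_inner_smul_right, mul_pow, Real.norm_eq_abs, sq_abs, e3]
  have := mul_nonneg (sq_nonneg τ) key
  linarith

theorem Coercive.exists_data (h : M.Coercive) :
    ∃ (K : Matrix (Fin m) (Fin m) ℝ) (d : Fin m → ℝ) (α : ℝ), K * M.a = 1 ∧ M.a * K = 1 ∧
      (∀ i, 0 < d i) ∧ 0 < α ∧ CoerciveMatrix K d α := by
  obtain ⟨hu, d, α, hd, hα, hK⟩ := h
  have hu' := (Matrix.isUnit_iff_isUnit_det _).1 hu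
  exact ⟨M.a⁻¹, d, α, Matrix.nonsing_inv_mul _ hu', Matrix.mul_nonsing_inv _ hu', hd, hα, hK⟩

end RungeKutta

theorem sum_smul_sum_smul {Z : Type*} [AddCommGroup Z] [Module ℝ Z] {m : ℕ}
    {K L : Matrix (Fin m) (Fin m) ℝ} (h : K * L = 1) (V : Fin m → Z) (i : Fin m) :
    ∑ j, K i j • ∑ k, L j k • V k = V i := by
  simp_rw [Finset.smul_sum, smul_smul]
  rw [Finset.sum_comm]
  simp_rw [← Finset.sum_smul, ← Matrix.mul_apply, h, Matrix.one_apply, ite_smul, one_smul,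
    zero_smul]
  simp

end Kato
end

/-! ### Resolvent estimates and uniqueness of a step. -/

open scoped ContDiff Topology Matrix
noncomputable section
namespace Kato

variable {X Y : Type*}
  [NormedAddCommGroup X] [InnerProductSpace ℝ X]
  [NormedAddCommGroup Y] [InnerProductSpace ℝ Y]
  {ι : Y →L[ℝ] X} {S : Y ≃ₗᵢ[ℝ] X} {A : Y → (X →ₗ.[ℝ] X)} {B : Y → (X →L[ℝ] X)}
  {AY : Y → (Y →L[ℝ] X)}

theorem norm_le_of_mul_sq_le_inner {v g : X} {μ : ℝ}
    (h : μ * ‖v‖ ^ 2 ≤ inner ℝ v g) : μ * ‖v‖ ≤ ‖g‖ := by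
  rcases (norm_nonneg v).eq_or_lt with h0 | h0
  · rw [← h0]; simp
  · have h1 := h.trans (real_inner_le_norm v g)
    have : ‖v‖ * (μ * ‖v‖) ≤ ‖v‖ * ‖g‖ := by linarith
    exact le_of_mul_le_mul_left this h0

theorem MAccretive.norm_le (hA : MAccretive ι A) {y : Y} {v x : X} (h : (v, x) ∈ (A y).graph)
    {μ τ : ℝ} (hτ : 0 ≤ τ) : μ * ‖v‖ ≤ ‖μ • v + τ • x‖ := by
  refine norm_le_of_mul_sq_le_inner ?_
  rw [inner_add_right, real_inner_smul_right, real_inner_smul_right, real_inner_self_eq_norm_sq]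
  have := mul_nonneg hτ (hA.inner_nonneg h)
  linarith

/-- The resolvent of `A(w)` on `Y`. -/
theorem exists_resolvent_embedding [CompleteSpace X] (hι : IsDenseEmbedding ι)
    (hA : MAccretive ι A) (hB : Commutator ι S 1 A B) {w : Y} {b μ τ : ℝ} (hμ : 0 < μ)
    (hτ : 0 < τ) (hb : ∀ v, ‖B w v‖ ≤ b * ‖v‖) (hbτ : τ * b ≤ μ / 2) (g : Y) :
    ∃ (y : Y) (x : X), (ι y, x) ∈ (A w).graph ∧ μ • ι y + τ • x = ι g ∧
      (μ - τ * b) * ‖y‖ ≤ ‖g‖ := by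
  -- Solve with A(w) + B₁(w) for S g in `X`; pulling back with S⁻¹ gives the solution for A(w) in
  -- `Y`.
  obtain ⟨v, x, hv, hx⟩ := exists_resolvent_add hA hμ hτ hb hbτ (S g)
  refine ⟨S.symm v, ι (S.symm (x + B w v)), ?_, ?_, ?_⟩
  · have h := (hB.mem_graph_iff hι w v (x + B w v)).2 (by simpa using hv)
    simpa using h
  · have h : ι (S.symm (μ • v + τ • (x + B w v))) = ι g := by rw [hx, S.symm_apply_apply]
    rw [← h]
    simp only [map_add, map_smul]
  · rw [LinearIsometryEquiv.norm_map, ← S.norm_map g, ← hx]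
    refine norm_le_of_mul_sq_le_inner ?_
    rw [inner_add_right, real_inner_smul_right, real_inner_smul_right, inner_add_right,
      real_inner_self_eq_norm_sq]
    have h1 := mul_nonneg hτ.le (hA.inner_nonneg hv)
    have h2 : -(b * ‖v‖ ^ 2) ≤ inner ℝ v (B w v) := by
      have := (abs_le.1 (abs_real_inner_le_norm v (B w v))).1
      have := mul_le_mul_of_nonneg_left (hb v) (norm_nonneg v)
      linarith
    have := mul_le_mul_of_nonneg_left h2 hτ.le
    linarith

/-- Two solutions of the resolvent equation with different operators. -/
theorem MAccretive.norm_sub_le (hA : MAccretive ι A) (hAY : ∀ y w, (ι w, AY y w) ∈ (A y).graph)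
    {w y y' : Y} {x x' : X} (h : (ι y, x) ∈ (A w).graph) {μ τ : ℝ} (hτ : 0 ≤ τ) :
    μ * ‖ι y - ι y'‖ ≤
      ‖-(τ • (AY w y' - x')) + ((μ • ι y + τ • x) - (μ • ι y' + τ • x'))‖ := by
  refine (hA.norm_le (graph_sub h (hAY w y')) hτ).trans_eq ?_
  congr 1
  module

/-- One step of a Runge–Kutta method for `u' + A(u) u = 0`, with internal stages `U` whose
derivatives `D` are in `Y`. -/
structure RungeKutta.IsStep {m : ℕ} (M : RungeKutta m) (ι : Y →L[ℝ] X) (A : Y → (X →ₗ.[ℝ] X))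
    (τ : ℝ) (u₀ : Y) (U D : Fin m → Y) (u₁ : Y) : Prop where
  graph : ∀ i, (ι (U i), -(ι (D i))) ∈ (A (U i)).graph
  stage : ∀ i, U i = u₀ + τ • ∑ j, M.a i j • D j
  update : u₁ = u₀ + τ • ∑ i, M.b i • D i

variable {m : ℕ} {M : RungeKutta m}

theorem RungeKutta.IsStep.coeff_inv {K : Matrix (Fin m) (Fin m) ℝ} (hK : K * M.a = 1) {τ : ℝ}
    {u₀ u₁ : Y} {U D : Fin m → Y} (h : M.IsStep ι A τ u₀ U D u₁) (i : Fin m) :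
    ∑ j, K i j • (U j - u₀) = τ • D i := by
  have : ∀ j, U j - u₀ = ∑ k, M.a j k • (τ • D k) := fun j => by
    rw [h.stage j, add_sub_cancel_left, Finset.smul_sum]
    exact Finset.sum_congr rfl fun k _ => smul_comm _ _ _
  simp_rw [this]
  exact sum_smul_sum_smul hK (fun k => τ • D k) i

/-- Uniqueness of the step for small step sizes. -/
theorem RungeKutta.IsStep.unique (hι : IsDenseEmbedding ι) (hcoer : M.Coercive)
    (hA : MAccretive ι A) (hAY : ∀ y w, (ι w, AY y w) ∈ (A y).graph) (hlip : LocallyLip ι A B)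
    (ρ : ℝ) : ∃ τ₀ : ℝ, 0 < τ₀ ∧ ∀ τ : ℝ, 0 < τ → τ ≤ τ₀ →
      ∀ (u₀ u₁ u₁' : Y) (U D U' D' : Fin m → Y), M.IsStep ι A τ u₀ U D u₁ →
        M.IsStep ι A τ u₀ U' D' u₁' → (∀ i, ‖U i‖ ≤ ρ) → (∀ i, ‖U' i‖ ≤ ρ) →
        U = U' ∧ u₁ = u₁' := by
  obtain ⟨K, d, α, hK, -, hd, hα, hcK⟩ := hcoer.exists_data
  set ρ' := max ρ 1
  have hρ' : 0 < ρ' := lt_max_of_lt_right one_pos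
  obtain ⟨L₀, hL₀⟩ := hlip.lipA ρ' hρ'
  set L := max L₀ 0
  have hL : 0 ≤ L := le_max_right _ _
  have hlt : 0 < L * ρ' + 1 := by positivity
  refine ⟨α / (2 * (L * ρ' + 1)), by positivity, ?_⟩
  intro τ hτ hτ₀ u₀ u₁ u₁' U D U' D' h h' hU hU'
  have hKδ : ∀ i, ∑ j, K i j • (U j - U' j) = τ • (D i - D' i) := fun i => by
    rw [smul_sub, ← h.coeff_inv hK, ← h'.coeff_inv hK, ← Finset.sum_sub_distrib]
    refine Finset.sum_congr rfl fun j _ => ?_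
    module
  -- Insert A(U_i) U'_i: the part A(U_i)(U_i - U'_i) has the good sign, and the rest is controlled
  -- by the Lipschitz bound in `X` and ‖U'_i‖ ≤ ρ'.
  have hi : ∀ i, inner ℝ (ι (U i) - ι (U' i)) (ι (D i) - ι (D' i)) ≤
      L * ρ' * ‖ι (U i) - ι (U' i)‖ ^ 2 := by
    intro i
    have h1 := hA.inner_nonneg (graph_sub (h.graph i) (hAY (U i) (U' i)))
    have h2 := hL₀ (U i) (U' i) ((hU i).trans (le_max_left _ _)) ((hU' i).trans (le_max_left _ _))
      (U' i) _ _ (hAY (U i) (U' i)) (h'.graph i)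
    have h3 : ‖AY (U i) (U' i) - -(ι (D' i))‖ ≤ L * ρ' * ‖ι (U i) - ι (U' i)‖ := by
      refine h2.trans ?_
      have : L₀ * ‖ι (U i) - ι (U' i)‖ * ‖U' i‖ ≤ L * ‖ι (U i) - ι (U' i)‖ * ρ' := by
        gcongr
        · exact le_max_left _ _
        · exact (hU' i).trans (le_max_left _ _)
      linarith
    have h4 : ι (D i) - ι (D' i) = -(-(ι (D i)) - AY (U i) (U' i)) -
        (AY (U i) (U' i) - -(ι (D' i))) := by abel
    rw [h4, inner_sub_right, inner_neg_right]
    have h5 := (abs_le.1 (abs_real_inner_le_norm (ι (U i) - ι (U' i))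
      (AY (U i) (U' i) - -(ι (D' i))))).1
    have h6 := mul_le_mul_of_nonneg_left h3 (norm_nonneg (ι (U i) - ι (U' i)))
    linarith
  have hN := hcK.wnorm_le (fun i => ι (U i) - ι (U' i))
  have hle : ∑ i, d i * inner ℝ (ι (U i) - ι (U' i)) (∑ j, K i j • (ι (U j) - ι (U' j))) ≤
      τ * (L * ρ') * wnorm d (fun i => ι (U i) - ι (U' i)) := by
    rw [wnorm, Finset.mul_sum]
    refine Finset.sum_le_sum fun i _ => ?_
    have : ∑ j, K i j • (ι (U j) - ι (U' j)) = τ • (ι (D i) - ι (D' i)) := by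
      rw [← map_sub, ← map_smul, ← hKδ, map_sum]
      simp
    rw [this, real_inner_smul_right]
    have := mul_le_mul_of_nonneg_left (mul_le_mul_of_nonneg_left (hi i) hτ.le) (hd i).le
    linarith
  have hsmall : τ * (L * ρ') ≤ α / 2 := by
    have h1 : τ * (L * ρ') ≤ α / (2 * (L * ρ' + 1)) * (L * ρ' + 1) := by
      gcongr; linarith
    refine h1.trans_eq ?_
    field_simp
  have hn0 := wnorm_nonneg hd (fun i => ι (U i) - ι (U' i))
  have hzero : wnorm d (fun i => ι (U i) - ι (U' i)) = 0 := by
    have := mul_le_mul_of_nonneg_right hsmall hn0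
    nlinarith
  have hUU : U = U' := by
    funext i
    have h1 := single_le_wnorm hd (fun i => ι (U i) - ι (U' i)) i
    rw [hzero] at h1
    have h2 : ‖ι (U i) - ι (U' i)‖ ^ 2 ≤ 0 := by
      by_contra! hc
      have := mul_pos (hd i) hc
      linarith
    have h3 : ‖ι (U i) - ι (U' i)‖ = 0 := by
      have := sq_nonneg ‖ι (U i) - ι (U' i)‖
      exact pow_eq_zero_iff two_ne_zero |>.1 (le_antisymm h2 this)
    exact hι.injective (sub_eq_zero.1 (norm_eq_zero.1 h3))
  refine ⟨hUU, ?_⟩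
  have hDD : ∀ i, D i = D' i := fun i => by
    have := hKδ i
    simp only [hUU, sub_self, smul_zero, Finset.sum_const_zero] at this
    exact sub_eq_zero.1 ((smul_eq_zero.1 this.symm).resolve_left hτ.ne')
  rw [h.update, h'.update]
  simp_rw [hDD]

end Kato
end

/-! ### Existence of a step by a relaxed iteration. -/

open scoped ContDiff Topology Matrix
noncomputable section
namespace Kato

variable {X Y : Type*}
  [NormedAddCommGroup X] [InnerProductSpace ℝ X]
  [NormedAddCommGroup Y] [InnerProductSpace ℝ Y]
  {ι : Y →L[ℝ] X} {S : Y ≃ₗᵢ[ℝ] X} {A : Y → (X →ₗ.[ℝ] X)} {B : Y → (X →L[ℝ] X)}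
  {AY : Y → (Y →L[ℝ] X)} {m : ℕ} {M : RungeKutta m}

/-- A sequence of tuples in `Y` which is bounded in `Y` and whose increments decay geometrically
in the weighted norm of `X` converges componentwise in `X` to elements of `Y`. -/
theorem exists_limit_of_wnorm_le [CompleteSpace X] (hι : IsDenseEmbedding ι)
    (hS : IsSelfAdjoint (opOnX ι S)) {d : Fin m → ℝ} (hd : ∀ i, 0 < d i) {κ C ρ : ℝ}
    (hκ0 : 0 ≤ κ) (hκ1 : κ < 1) {w : ℕ → Fin m → Y} (hw : ∀ k i, ‖w k i‖ ≤ ρ)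
    (h : ∀ k, wnorm d (fun i => ι (w (k + 1) i) - ι (w k i)) ≤ κ ^ k * C) :
    ∃ v : Fin m → Y, (∀ i, ‖v i‖ ≤ ρ) ∧
      ∀ i, Filter.Tendsto (fun k => ι (w k i)) Filter.atTop (𝓝 (ι (v i))) := by
  have hC : 0 ≤ C := by
    have := (wnorm_nonneg hd _).trans (h 0)
    simpa using this
  have : ∀ i, ∃ v : Y, ‖v‖ ≤ ρ ∧
      Filter.Tendsto (fun k => ι (w k i)) Filter.atTop (𝓝 (ι v)) := by
    intro i
    have hc : CauchySeq fun k => ι (w k i) := by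
      refine cauchySeq_of_le_geometric (Real.sqrt κ) (Real.sqrt (C / d i)) ?_ fun k => ?_
      · rw [Real.sqrt_lt' one_pos]; simpa using hκ1
      · rw [dist_comm, dist_eq_norm]
        refine (pow_le_pow_iff_left₀ (norm_nonneg _) (by positivity) two_ne_zero).1 ?_
        rw [mul_pow, ← pow_mul, mul_comm k 2, pow_mul, Real.sq_sqrt hκ0,
          Real.sq_sqrt (div_nonneg hC (hd i).le), div_mul_eq_mul_div, le_div_iff₀ (hd i)]
        have := (single_le_wnorm hd (fun i => ι (w (k + 1) i) - ι (w k i)) i).trans (h k)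
        linarith
    obtain ⟨x, hx⟩ := cauchySeq_tendsto_of_complete hc
    obtain ⟨v, rfl, hv⟩ := exists_of_tendsto_embedding hι hS (fun k => hw k i) hx
    exact ⟨v, hv, hx⟩
  choose v hv1 hv2 using this
  exact ⟨v, hv1, hv2⟩

set_option maxHeartbeats 1000000 in
/-- Existence of the step for small step sizes, with bounded internal stages. -/
theorem exists_isStep [CompleteSpace X] (hι : IsDenseEmbedding ι)
    (hS : IsSelfAdjoint (opOnX ι S)) (hcoer : M.Coercive)
    (hA : MAccretive ι A) (hB : Commutator ι S 1 A B)
    (hAY : ∀ y w, (ι w, AY y w) ∈ (A y).graph) (hlip : LocallyLip ι A B) (K₀ : ℝ) :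
    ∃ ρ : ℝ, 0 < ρ ∧ ∃ τ₀ : ℝ, 0 < τ₀ ∧ ∀ τ : ℝ, 0 < τ → τ ≤ τ₀ → ∀ u₀ : Y, ‖u₀‖ ≤ K₀ →
      ∃ (U D : Fin m → Y) (u₁ : Y), M.IsStep ι A τ u₀ U D u₁ ∧ ∀ i, ‖U i‖ ≤ ρ := by
  obtain ⟨K, d, α, hK, hK', hd, hα, hcK⟩ := hcoer.exists_data
  obtain ⟨δ, hδ, hδd⟩ := exists_pos_le hd
  set k := (∑ i, d i * ∑ j, K i j ^ 2) / δ with hk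
  have hk0 : 0 ≤ k := div_nonneg (Finset.sum_nonneg fun i _ => mul_nonneg (hd i).le
      (Finset.sum_nonneg fun j _ => sq_nonneg _)) hδ.le
  -- This choice gives both μ ≥ α and k ≤ μα, as the relaxation estimate requires.
  set μ := k / α + α with hμdef
  have hμ : 0 < μ := by positivity
  have hμα : α ≤ μ := by rw [hμdef]; linarith [div_nonneg hk0 hα.le]
  have hkμ : k ≤ μ * α := by
    rw [hμdef, add_mul, div_mul_cancel₀ _ hα.ne']; nlinarith
  set Cs := 1 + 2 * μ / α
  have hCs : 0 < Cs := by positivity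
  set cf := ∑ i, d i * (∑ j, K i j) ^ 2
  have hcf : 0 ≤ cf := Finset.sum_nonneg fun i _ => mul_nonneg (hd i).le (sq_nonneg _)
  -- the radius of the ball
  set ρ := Real.sqrt (4 * Cs * cf * K₀ ^ 2 / (μ * α * δ)) + 1
  have hρ : 0 < ρ := by positivity
  have hρK : Cs * (cf * K₀ ^ 2) ≤ μ * α / 4 * (δ * ρ ^ 2) := by
    have h1 : 4 * Cs * cf * K₀ ^ 2 / (μ * α * δ) ≤ ρ ^ 2 := by
      rw [← Real.sqrt_le_left hρ.le]
      simp only [ρ]; linarith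
    rw [div_le_iff₀ (by positivity)] at h1
    linarith
  obtain ⟨b₀, hb₀⟩ := hB.bound ρ hρ
  set b := max b₀ 0
  have hb0 : 0 ≤ b := le_max_right _ _
  have hb : ∀ w : Y, ‖w‖ ≤ ρ → ∀ v, ‖B w v‖ ≤ b * ‖v‖ := fun w hw v =>
    (hb₀ w hw v).trans (mul_le_mul_of_nonneg_right (le_max_left _ _) (norm_nonneg _))
  obtain ⟨L₀, hL₀⟩ := hlip.lipA ρ hρ
  set L := max L₀ 0
  have hL : 0 ≤ L := le_max_right _ _
  set τ₁ := Real.sqrt (μ * α / (4 * Cs * (L ^ 2 * ρ ^ 2 + 1)))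
  have hτ₁ : 0 < τ₁ := Real.sqrt_pos.2 (by positivity)
  -- The relaxation gains μα/2. The first bound on τ lets the resolvent on `Y` lose at most μα/4 of
  -- it; the second does the same for the Lipschitz term of A in `X`.
  refine ⟨ρ, hρ, min (α / (8 * (b + 1))) τ₁, by positivity, fun τ hτ hτ₀ u₀ hu₀ => ?_⟩
  have hτb : τ * b ≤ α / 8 := by
    have h1 : τ * (b + 1) ≤ α / (8 * (b + 1)) * (b + 1) :=
      mul_le_mul_of_nonneg_right (hτ₀.trans (min_le_left _ _)) (by positivity)
    have h2 : α / (8 * (b + 1)) * (b + 1) = α / 8 := by field_simp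
    linarith
  have hτL : Cs * (τ ^ 2 * (L ^ 2 * ρ ^ 2)) ≤ μ * α / 4 := by
    have h1 : τ ^ 2 ≤ μ * α / (4 * Cs * (L ^ 2 * ρ ^ 2 + 1)) := by
      rw [← Real.le_sqrt hτ.le]
      · exact hτ₀.trans (min_le_right _ _)
      · positivity
    have h2 : τ ^ 2 * (L ^ 2 * ρ ^ 2) ≤
        μ * α / (4 * Cs * (L ^ 2 * ρ ^ 2 + 1)) * (L ^ 2 * ρ ^ 2 + 1) := by
      gcongr; linarith
    have h3 : Cs * (μ * α / (4 * Cs * (L ^ 2 * ρ ^ 2 + 1)) * (L ^ 2 * ρ ^ 2 + 1)) = μ * α / 4 := by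
      field_simp
    rw [← h3]
    exact mul_le_mul_of_nonneg_left h2 hCs.le
  -- the iteration
  let g : (Fin m → Y) → Fin m → Y := fun w i =>
    (∑ j, K i j) • u₀ + (μ • w i - ∑ j, K i j • w j)
  have hres : ∀ (w : Fin m → Y) (i : Fin m), ∃ (y : Y) (x : X), ‖w i‖ ≤ ρ →
      (ι y, x) ∈ (A (w i)).graph ∧ μ • ι y + τ • x = ι (g w i) ∧ (μ - τ * b) * ‖y‖ ≤ ‖g w i‖ := by
    intro w i
    by_cases hw : ‖w i‖ ≤ ρ
    · obtain ⟨y, x, h⟩ := exists_resolvent_embedding hι hA hB hμ hτ (hb _ hw)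
        (by linarith) (g w i)
      exact ⟨y, x, fun _ => h⟩
    -- Outside the ball there is no uniform bound on B₁, so the map takes an arbitrary value there.
    · exact ⟨0, 0, fun h => absurd h hw⟩
  choose Φ ξ hΦ using hres
  have hball : ∀ w : Fin m → Y, wnorm d w ≤ δ * ρ ^ 2 → ∀ i, ‖w i‖ ≤ ρ := by
    intro w hw i
    have h1 := (single_le_wnorm hd w i).trans hw
    have h2 := mul_le_mul_of_nonneg_right (hδd i) (sq_nonneg ‖w i‖)
    refine (pow_le_pow_iff_left₀ (norm_nonneg _) hρ.le two_ne_zero).1 ?_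
    exact le_of_mul_le_mul_left (h2.trans h1) hδ
  have hfac : μ ^ 2 - μ * α / 4 ≤ (μ - τ * b) ^ 2 := by
    have := mul_le_mul_of_nonneg_left hτb hμ.le
    nlinarith [sq_nonneg (τ * b)]
  have hfac0 : 0 < μ ^ 2 - μ * α / 4 := by nlinarith
  have hinv : ∀ w : Fin m → Y, wnorm d w ≤ δ * ρ ^ 2 → wnorm d (Φ w) ≤ δ * ρ ^ 2 := by
    intro w hw
    have h1 := hcK.wnorm_relax_le hd hα hμ hkμ (wnorm_mul_le hd hδ hδd K w)
      (fun i => (∑ j, K i j) • u₀)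
    have h2 : (μ ^ 2 - μ * α / 4) * wnorm d (Φ w) ≤ wnorm d (g w) := by
      rw [wnorm, wnorm, Finset.mul_sum]
      refine Finset.sum_le_sum fun i _ => ?_
      have h3 := (hΦ w i (hball w hw i)).2.2
      have h4 : ((μ - τ * b) * ‖Φ w i‖) ^ 2 ≤ ‖g w i‖ ^ 2 := by
        refine pow_le_pow_left₀ (mul_nonneg ?_ (norm_nonneg _)) h3 2
        linarith
      rw [mul_pow] at h4
      have h5 := mul_le_mul_of_nonneg_right hfac (sq_nonneg ‖Φ w i‖)
      have h6 := mul_le_mul_of_nonneg_left (h5.trans h4) (hd i).le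
      linarith
    have h3 : wnorm d (fun i => (∑ j, K i j) • u₀) ≤ cf * K₀ ^ 2 := by
      rw [wnorm, Finset.sum_mul]
      refine Finset.sum_le_sum fun i _ => ?_
      rw [norm_smul, mul_pow, Real.norm_eq_abs, sq_abs, mul_assoc]
      have := (hd i).le
      gcongr
    have h4 := mul_le_mul_of_nonneg_left h3 hCs.le
    have h5 : (μ ^ 2 - μ * α / 2) * wnorm d w ≤ (μ ^ 2 - μ * α / 2) * (δ * ρ ^ 2) :=
      mul_le_mul_of_nonneg_left hw (by nlinarith)
    have h6 : (μ ^ 2 - μ * α / 4) * wnorm d (Φ w) ≤ (μ ^ 2 - μ * α / 4) * (δ * ρ ^ 2) := by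
      have h7 := h2.trans h1
      linarith
    exact le_of_mul_le_mul_left h6 hfac0
  set κ := (μ ^ 2 - μ * α / 4) / μ ^ 2
  have hκ0 : 0 ≤ κ := by positivity
  have hκ1 : κ < 1 := by
    rw [div_lt_one (by positivity)]
    have : 0 < μ * α := by positivity
    linarith
  -- The difference of operators is applied to Φ w', so only this image needs a bound in `Y`. The
  -- asymmetry matters below, where Φ v is compared with the iterates before its size is known.
  have hcontr : ∀ w w' : Fin m → Y, (∀ i, ‖w i‖ ≤ ρ) → (∀ i, ‖w' i‖ ≤ ρ) →
      (∀ i, ‖Φ w' i‖ ≤ ρ) → wnorm d (fun i => ι (Φ w i) - ι (Φ w' i)) ≤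
        κ * wnorm d (fun i => ι (w i) - ι (w' i)) := by
    intro w w' hw hw' hΦw'
    set V : Fin m → X := fun i => ι (w i) - ι (w' i)
    set f : Fin m → X := fun i => -(τ • (AY (w i) (Φ w' i) - ξ w' i))
    have h1 := hcK.wnorm_relax_le hd hα hμ hkμ (wnorm_mul_le hd hδ hδd K V) f
    have h2 : wnorm d f ≤ τ ^ 2 * (L ^ 2 * ρ ^ 2) * wnorm d V := by
      rw [wnorm, wnorm, Finset.mul_sum]
      refine Finset.sum_le_sum fun i _ => ?_
      have h3 := hL₀ (w i) (w' i) (hw i) (hw' i) (Φ w' i) _ _ (hAY (w i) (Φ w' i))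
        (hΦ w' i (hw' i)).1
      have h4 : ‖f i‖ ≤ τ * (L * ‖V i‖ * ρ) := by
        simp only [f, norm_neg, norm_smul, Real.norm_of_nonneg hτ.le]
        refine mul_le_mul_of_nonneg_left (h3.trans ?_) hτ.le
        gcongr
        · exact le_max_left _ _
        · exact hΦw' i
      have h5 := pow_le_pow_left₀ (norm_nonneg _) h4 2
      have h6 := mul_le_mul_of_nonneg_left h5 (hd i).le
      refine h6.trans_eq ?_
      ring
    have h3 : μ ^ 2 * wnorm d (fun i => ι (Φ w i) - ι (Φ w' i)) ≤
        wnorm d (fun i => f i + (μ • V i - ∑ j, K i j • V j)) := by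
      rw [wnorm, wnorm, Finset.mul_sum]
      refine Finset.sum_le_sum fun i _ => ?_
      have h4 := hA.norm_sub_le hAY (y' := Φ w' i) (x' := ξ w' i) (hΦ w i (hw i)).1 (μ := μ) hτ.le
      rw [(hΦ w i (hw i)).2.1, (hΦ w' i (hw' i)).2.1] at h4
      have h5 : ι (g w i) - ι (g w' i) = μ • V i - ∑ j, K i j • V j := by
        simp only [g, V, ← map_sub, ← map_smul, ← map_sum]
        congr 1
        simp only [smul_sub, Finset.sum_sub_distrib]
        abel
      rw [h5] at h4
      have h6 := pow_le_pow_left₀ (by positivity) h4 2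
      have h7 := mul_le_mul_of_nonneg_left h6 (hd i).le
      refine le_trans (le_of_eq ?_) h7
      ring
    have h4 := mul_le_mul_of_nonneg_left h2 hCs.le
    have h5 := mul_le_mul_of_nonneg_right hτL (wnorm_nonneg hd V)
    rw [div_mul_eq_mul_div, le_div_iff₀ (by positivity)]
    have h6 := h3.trans h1
    linarith
  let w : ℕ → Fin m → Y := fun n => Φ^[n] 0
  have hw0 : ∀ n, w (n + 1) = Φ (w n) := fun n => Function.iterate_succ_apply' Φ n 0
  have hwN : ∀ n, wnorm d (w n) ≤ δ * ρ ^ 2 := by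
    intro n
    induction n with
    | zero =>
      simp only [w, Function.iterate_zero, id_eq, wnorm, Pi.zero_apply, norm_zero]
      simp only [ne_eq, OfNat.ofNat_ne_zero, not_false_eq_true, zero_pow, mul_zero,
        Finset.sum_const_zero]
      positivity
    | succ n ih =>
      rw [hw0]
      exact hinv _ ih
  have hwρ : ∀ n i, ‖w n i‖ ≤ ρ := fun n => hball _ (hwN n)
  have hgeom : ∀ n, wnorm d (fun i => ι (w (n + 1) i) - ι (w n i)) ≤
      κ ^ n * wnorm d (fun i => ι (w 1 i) - ι (w 0 i)) := by
    intro n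
    induction n with
    | zero => simp
    | succ n ih =>
      have h1 := hcontr (w (n + 1)) (w n) (hwρ _) (hwρ _) (by rw [← hw0]; exact hwρ _)
      rw [← hw0, ← hw0] at h1
      refine h1.trans ((mul_le_mul_of_nonneg_left ih hκ0).trans_eq ?_)
      ring
  obtain ⟨v, hvρ, hv⟩ := exists_limit_of_wnorm_le hι hS hd hκ0 hκ1 hwρ hgeom
  have hfix : ∀ i, Φ v i = v i := by
    intro i
    have h1 : ∀ n, d i * ‖ι (Φ v i) - ι (w (n + 1) i)‖ ^ 2 ≤
        κ * wnorm d (fun i => ι (v i) - ι (w n i)) := by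
      intro n
      have h2 := hcontr v (w n) hvρ (hwρ _) (by rw [← hw0]; exact hwρ _)
      rw [← hw0] at h2
      exact (single_le_wnorm hd (fun i => ι (Φ v i) - ι (w (n + 1) i)) i).trans h2
    have h2 : Filter.Tendsto (fun n => κ * wnorm d (fun i => ι (v i) - ι (w n i)))
        Filter.atTop (𝓝 0) := by
      have : Filter.Tendsto (fun n => κ * wnorm d (fun i => ι (v i) - ι (w n i)))
          Filter.atTop (𝓝 (κ * ∑ i, d i * ‖ι (v i) - ι (v i)‖ ^ 2)) := by
        refine Filter.Tendsto.const_mul _ (tendsto_finsetSum _ fun i _ => ?_)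
        exact (((tendsto_const_nhds.sub (hv i)).norm).pow 2).const_mul _
      simpa using this
    have h3 : Filter.Tendsto (fun n => d i * ‖ι (Φ v i) - ι (w (n + 1) i)‖ ^ 2)
        Filter.atTop (𝓝 (d i * ‖ι (Φ v i) - ι (v i)‖ ^ 2)) :=
      ((((tendsto_const_nhds.sub ((hv i).comp (Filter.tendsto_add_atTop_nat 1))).norm).pow
        2).const_mul _)
    have h4 : d i * ‖ι (Φ v i) - ι (v i)‖ ^ 2 ≤ 0 := le_of_tendsto_of_tendsto' h3 h2 h1
    have h5 : ‖ι (Φ v i) - ι (v i)‖ = 0 := by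
      by_contra hne
      have : 0 < d i * ‖ι (Φ v i) - ι (v i)‖ ^ 2 := mul_pos (hd i) (by positivity)
      linarith
    exact hι.injective (sub_eq_zero.1 (norm_eq_zero.1 h5))
  refine ⟨v, fun i => τ⁻¹ • ∑ j, K i j • (v j - u₀), _, ⟨fun i => ?_, fun i => ?_, rfl⟩, hvρ⟩
  · obtain ⟨h1, h2, -⟩ := hΦ v i (hvρ i)
    rw [hfix] at h1 h2
    have h3 : ξ v i = -(ι (τ⁻¹ • ∑ j, K i j • (v j - u₀))) := by
      have h4 : τ • ξ v i = -(ι (∑ j, K i j • (v j - u₀))) := by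
        -- At the fixed point the relaxation terms μ v_i cancel, which leaves the stage equation
        -- multiplied by K.
        have h5 : g v i = μ • v i - ∑ j, K i j • (v j - u₀) := by
          simp only [g, smul_sub, Finset.sum_sub_distrib, Finset.sum_smul]
          abel
        rw [h5, map_sub, map_smul] at h2
        rw [← sub_eq_zero] at h2 ⊢
        rw [← h2]
        abel
      rw [map_smul, ← smul_neg, ← h4, inv_smul_smul₀ hτ.ne']
    rwa [h3] at h1
  · have h1 := sum_smul_sum_smul hK' (fun j => v j - u₀) i
    have h2 : τ • ∑ j, M.a i j • τ⁻¹ • ∑ k, K j k • (v k - u₀) =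
        ∑ j, M.a i j • ∑ k, K j k • (v k - u₀) := by
      rw [Finset.smul_sum]
      refine Finset.sum_congr rfl fun j _ => ?_
      rw [smul_comm τ, smul_inv_smul₀ hτ.ne']
    rw [h2, h1]
    abel

end Kato
end

/-! ### Stability of a step in `Y`. -/

open scoped ContDiff Topology Matrix
noncomputable section
namespace Kato

variable {X Y : Type*}
  [NormedAddCommGroup X] [InnerProductSpace ℝ X]
  [NormedAddCommGroup Y] [InnerProductSpace ℝ Y]
  {ι : Y →L[ℝ] X} {S : Y ≃ₗᵢ[ℝ] X} {A : Y → (X →ₗ.[ℝ] X)} {B : Y → (X →L[ℝ] X)}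
  {AY : Y → (Y →L[ℝ] X)} {m : ℕ} {M : RungeKutta m}

/-- The one-sided Lipschitz condition in `Y` for the difference of `U ∈ Y` and `S⁻¹ v`. -/
theorem inner_sub_le (hι : IsDenseEmbedding ι) (hA : MAccretive ι A) (hB : Commutator ι S 1 A B)
    (hAY : ∀ y w, (ι w, AY y w) ∈ (A y).graph) (hlip : LocallyLip ι A B) (ρ : ℝ) :
    ∃ C : ℝ, 0 ≤ C ∧ ∀ U D v F : Y, (ι U, -(ι D)) ∈ (A U).graph →
      ι F = -(AY (invOnY ι S v) (invOnY ι S v)) → ‖U‖ ≤ ρ → ‖v‖ ≤ ρ →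
      inner ℝ (U - invOnY ι S v) (D - F) ≤ C * ‖U - invOnY ι S v‖ ^ 2 := by
  set ρ' := max ρ 1
  have hρ' : 0 < ρ' := lt_max_of_lt_right one_pos
  obtain ⟨LA, hLA⟩ := hlip.lipA ρ' hρ'
  obtain ⟨LB, hLB⟩ := hlip.lipB ρ' hρ'
  obtain ⟨b, hb⟩ := hB.bound ρ' hρ'
  refine ⟨|b| + |LB| * ρ' + |LA| * ρ', by positivity, ?_⟩
  intro U D v F hU hF hUρ hvρ
  set R := invOnY ι S v with hR
  have hSR : S R = ι v := by simp [hR]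
  have hUρ' := hUρ.trans (le_max_left ρ 1)
  have hvρ' := hvρ.trans (le_max_left ρ 1)
  have hRρ' := (norm_invOnY_le (S := S) hι v).trans hvρ'
  have hSF : S F = -(AY R v + B R (ι v)) := by
    have h1 := hB.apply_invOnY_pow hι hAY R v
    rw [pow_one, pow_one] at h1
    apply invOnX_injective (S := S) hι
    rw [map_neg, ← h1, ← hF]
    simp
  have hg := hA.inner_nonneg (graph_sub (hB.graph_of_mem hι (by simpa using hU) :
    (S U, S (-D) - B U (S U)) ∈ (A U).graph) (hAY U v))
  rw [← hSR, ← map_sub] at hg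
  set E := U - R
  -- The first bracket is A(U) applied to S E, which has the good sign against S E. The difference
  -- A(U) - A(R) acts only on v ∈ `Y`, which is why the comparison stage is taken as S⁻¹ v; no bound
  -- on S U in `Y` is needed.
  have hdec : S (D - F) = -(S (-D) - B U (S U) - AY U v) -
      (B U (S E) + (B U (ι v) - B R (ι v)) + (AY U v - AY R v)) := by
    rw [map_sub, hSF, map_neg]
    have : S E = S U - ι v := by rw [map_sub, hSR]
    rw [this, map_sub]
    abel
  have hin : inner ℝ E (D - F) = inner ℝ (S E) (S (D - F)) := (S.inner_map_map _ _).symm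
  have hnE : ‖ι U - ι R‖ ≤ ‖E‖ := by rw [← map_sub]; exact hι.norm_le _
  have hιv : ‖ι v‖ ≤ ρ' := (hι.norm_le v).trans hvρ'
  have h1 : ‖B U (S E)‖ ≤ |b| * ‖E‖ := by
    refine (hb U hUρ' _).trans ?_
    rw [S.norm_map]
    exact mul_le_mul_of_nonneg_right (le_abs_self _) (norm_nonneg _)
  have h2 : ‖B U (ι v) - B R (ι v)‖ ≤ |LB| * ‖E‖ * ρ' := by
    refine (hLB U R hUρ' hRρ' _).trans ?_
    gcongr
    exact le_abs_self _
  have h3 : ‖AY U v - AY R v‖ ≤ |LA| * ‖E‖ * ρ' := by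
    refine (hLA U R hUρ' hRρ' v _ _ (hAY _ _) (hAY _ _)).trans ?_
    gcongr
    exact le_abs_self _
  have h4 : ‖B U (S E) + (B U (ι v) - B R (ι v)) + (AY U v - AY R v)‖ ≤
      (|b| + |LB| * ρ' + |LA| * ρ') * ‖E‖ := by
    refine (norm_add₃_le).trans ?_
    linarith
  have h5 := (abs_le.1 (abs_real_inner_le_norm (S E)
    (B U (S E) + (B U (ι v) - B R (ι v)) + (AY U v - AY R v)))).1
  rw [S.norm_map] at h5
  have h6 := mul_le_mul_of_nonneg_left h4 (norm_nonneg E)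
  rw [hin, hdec, inner_sub_right, inner_neg_right]
  linarith

/-- Stability of one step in `Y`, with respect to perturbations of size `τ η` in the internal
stages and in the update. -/
theorem RungeKutta.IsStep.stability (hι : IsDenseEmbedding ι) (hstab : M.AlgebraicallyStable)
    (hcoer : M.Coercive) (hA : MAccretive ι A) (hB : Commutator ι S 1 A B)
    (hAY : ∀ y w, (ι w, AY y w) ∈ (A y).graph) (hlip : LocallyLip ι A B) (ρ : ℝ) :
    ∃ C : ℝ, 0 ≤ C ∧ ∃ τ₀ : ℝ, 0 < τ₀ ∧ ∀ τ η : ℝ, 0 < τ → τ ≤ τ₀ → 0 ≤ η →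
      ∀ (u₀ u₁ y₀ y₁ : Y) (U D v F : Fin m → Y), M.IsStep ι A τ u₀ U D u₁ →
        (∀ i, ι (F i) = -(AY (invOnY ι S (v i)) (invOnY ι S (v i)))) →
        (∀ i, ‖U i‖ ≤ ρ) → (∀ i, ‖v i‖ ≤ ρ) →
        (∀ i, ‖invOnY ι S (v i) - (y₀ + τ • ∑ j, M.a i j • F j)‖ ≤ τ * η) →
        ‖y₁ - (y₀ + τ • ∑ i, M.b i • F i)‖ ≤ τ * η →
        ‖u₁ - y₁‖ ^ 2 ≤ (1 + C * τ) * ‖u₀ - y₀‖ ^ 2 + C * τ * η ^ 2 := by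
  obtain ⟨K, d, α, hK, hK', hd, hα, hcK⟩ := hcoer.exists_data
  obtain ⟨C₁, hC₁, hin⟩ := inner_sub_le hι hA hB hAY hlip ρ
  set k := ∑ i, ∑ j, |K i j|
  have hk0 : 0 ≤ k := Finset.sum_nonneg fun i _ => Finset.sum_nonneg fun j _ => abs_nonneg _
  set C₂ := C₁ + 1 + k ^ 2
  have hC₂ : 0 ≤ C₂ := by positivity
  set ds := ∑ i, d i
  have hds : 0 ≤ ds := Finset.sum_nonneg fun i _ => (hd i).le
  set cf := ∑ i, d i * (∑ j, K i j) ^ 2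
  have hcf : 0 ≤ cf := Finset.sum_nonneg fun i _ => mul_nonneg (hd i).le (sq_nonneg _)
  set C₃ := 2 / α * (C₂ * ds + cf / α)
  have hC₃ : 0 ≤ C₃ := by positivity
  set bs := ∑ i, M.b i
  have hbs : 0 ≤ bs := Finset.sum_nonneg fun i _ => (hstab.1 i).le
  set bd := ∑ i, M.b i / d i
  have hbd0 : ∀ i, 0 ≤ M.b i / d i := fun i => div_nonneg (hstab.1 i).le (hd i).le
  have hbd : 0 ≤ bd := Finset.sum_nonneg fun i _ => hbd0 i
  set C₄ := 2 * C₂ * (bd * C₃ + bs)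
  have hC₄ : 0 ≤ C₄ := by positivity
  set C₅ := bs * k + 1
  have hC₅ : 0 ≤ C₅ := by positivity
  refine ⟨1 + 2 * C₄ + 2 * C₅ ^ 2, by positivity, min 1 (α / (4 * (C₂ + 1))),
    lt_min one_pos (by positivity), ?_⟩
  intro τ η hτ hτ₀ hη u₀ u₁ y₀ y₁ U D v F hstep hF hU hv hΔ hΔ₁
  have hτ1 : τ ≤ 1 := hτ₀.trans (min_le_left _ _)
  have hτC : τ * C₂ ≤ α / 4 := by
    have h1 : τ * (C₂ + 1) ≤ α / (4 * (C₂ + 1)) * (C₂ + 1) :=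
      mul_le_mul_of_nonneg_right (hτ₀.trans (min_le_right _ _)) (by positivity)
    have h2 : α / (4 * (C₂ + 1)) * (C₂ + 1) = α / 4 := by field_simp
    linarith
  set Δ : Fin m → Y := fun i => invOnY ι S (v i) - (y₀ + τ • ∑ j, M.a i j • F j) with hΔdef
  -- Since τ a G = Δ, stage defects become perturbations of the derivatives. The stage errors then
  -- have the exact form e + τ a P to which algebraic stability applies.
  set G : Fin m → Y := fun i => τ⁻¹ • ∑ j, K i j • Δ j with hGdef
  set E : Fin m → Y := fun i => U i - invOnY ι S (v i) with hEdef
  set P : Fin m → Y := fun i => D i - F i - G i with hPdef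
  set e := u₀ - y₀ with hedef
  have hτG : ∀ i, τ • G i = ∑ j, K i j • Δ j := fun i => by
    simp only [hGdef]; rw [smul_inv_smul₀ hτ.ne']
  have hG : ∀ i, ‖G i‖ ≤ k * η := by
    intro i
    have h1 : ‖∑ j, K i j • Δ j‖ ≤ k * (τ * η) := by
      refine (norm_sum_le _ _).trans ?_
      calc ∑ j, ‖K i j • Δ j‖ ≤ ∑ j, |K i j| * (τ * η) := by
            refine Finset.sum_le_sum fun j _ => ?_
            rw [norm_smul, Real.norm_eq_abs]
            exact mul_le_mul_of_nonneg_left (hΔ j) (abs_nonneg _)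
        _ = (∑ j, |K i j|) * (τ * η) := by rw [Finset.sum_mul]
        _ ≤ k * (τ * η) := by
            refine mul_le_mul_of_nonneg_right ?_ (by positivity)
            exact Finset.single_le_sum (f := fun i => ∑ j, |K i j|)
              (fun i _ => Finset.sum_nonneg fun j _ => abs_nonneg _) (Finset.mem_univ i)
    rw [← hτG, norm_smul, Real.norm_of_nonneg hτ.le] at h1
    have : τ * ‖G i‖ ≤ τ * (k * η) := by linarith
    exact le_of_mul_le_mul_left this hτ
  have hE : ∀ i, E i = e + τ • ∑ j, M.a i j • P j := by
    intro i
    have h1 : τ • ∑ j, M.a i j • G j = Δ i := by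
      rw [← sum_smul_sum_smul hK' Δ i, Finset.smul_sum]
      refine Finset.sum_congr rfl fun j _ => ?_
      rw [smul_comm, hτG]
    simp only [hPdef, smul_sub, Finset.sum_sub_distrib]
    rw [h1]
    simp only [hEdef, hedef, hΔdef]
    rw [hstep.stage i]
    abel
  have hEP : ∀ i, inner ℝ (E i) (P i) ≤ C₂ * (‖E i‖ ^ 2 + η ^ 2) := by
    intro i
    have h1 := hin (U i) (D i) (v i) (F i) (hstep.graph i) (hF i) (hU i) (hv i)
    have h2 := (abs_le.1 (abs_real_inner_le_norm (E i) (G i))).1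
    have h3 := mul_le_mul_of_nonneg_left (hG i) (norm_nonneg (E i))
    have h4 : inner ℝ (E i) (P i) = inner ℝ (E i) (D i - F i) - inner ℝ (E i) (G i) := by
      rw [← inner_sub_right]
    have h5 : ‖E i‖ * (k * η) ≤ ‖E i‖ ^ 2 + k ^ 2 * η ^ 2 := by
      nlinarith [sq_nonneg (‖E i‖ - k * η), sq_nonneg (‖E i‖), sq_nonneg (k * η)]
    have h6 : 0 ≤ k ^ 2 * ‖E i‖ ^ 2 := by positivity
    have h7 : 0 ≤ (C₁ + 1) * η ^ 2 := by positivity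
    have h8 : C₂ * (‖E i‖ ^ 2 + η ^ 2) = C₁ * ‖E i‖ ^ 2 + (‖E i‖ ^ 2 + k ^ 2 * η ^ 2) +
      k ^ 2 * ‖E i‖ ^ 2 + (C₁ + 1) * η ^ 2 := by ring
    rw [h4, h8]
    linarith
  -- Test K E = K (e, …, e) + τ P against E: coercivity bounds the left side below, and the small
  -- factor τ C₂ lets the E-terms on the right be absorbed.
  have hN : wnorm d E ≤ C₃ * (‖e‖ ^ 2 + η ^ 2) := by
    have h1 := hcK.wnorm_le E
    have h2 : ∑ i, d i * inner ℝ (E i) (∑ j, K i j • E j) ≤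
        τ * C₂ * wnorm d E + τ * C₂ * ds * η ^ 2 + (α / 4 * wnorm d E + cf / α * ‖e‖ ^ 2) := by
      simp only [wnorm, cf, ds, Finset.mul_sum, Finset.sum_div, Finset.sum_mul,
        ← Finset.sum_add_distrib]
      refine Finset.sum_le_sum fun i _ => ?_
      have h3 : ∑ j, K i j • E j = (∑ j, K i j) • e + τ • P i := by
        have h4 : ∑ j, K i j • ∑ l, M.a j l • (τ • P l) = τ • P i :=
          sum_smul_sum_smul hK (fun l => τ • P l) i
        rw [← h4, Finset.sum_smul, ← Finset.sum_add_distrib]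
        refine Finset.sum_congr rfl fun j _ => ?_
        rw [← smul_add, hE j, Finset.smul_sum]
        congr 2
        exact Finset.sum_congr rfl fun l _ => smul_comm _ _ _
      rw [h3, inner_add_right, real_inner_smul_right, real_inner_smul_right]
      have h5 := mul_le_mul_of_nonneg_left (hEP i) hτ.le
      have h6 := real_inner_le_norm (E i) ((∑ j, K i j) • e)
      rw [norm_smul, real_inner_smul_right, Real.norm_eq_abs] at h6
      have h7 : ‖E i‖ * (|∑ j, K i j| * ‖e‖) ≤
          α / 4 * ‖E i‖ ^ 2 + (∑ j, K i j) ^ 2 / α * ‖e‖ ^ 2 := by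
        have h8 : 0 ≤ (α * ‖E i‖ - 2 * (|∑ j, K i j| * ‖e‖)) ^ 2 / (4 * α) := by positivity
        have h9 : (α * ‖E i‖ - 2 * (|∑ j, K i j| * ‖e‖)) ^ 2 / (4 * α) =
            α / 4 * ‖E i‖ ^ 2 + |∑ j, K i j| ^ 2 / α * ‖e‖ ^ 2 -
              ‖E i‖ * (|∑ j, K i j| * ‖e‖) := by
          field_simp; ring
        rw [sq_abs] at h9
        linarith
      have h10 := mul_le_mul_of_nonneg_left
        (add_le_add (h6.trans h7) h5) (hd i).le
      refine h10.trans_eq ?_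
      ring
    have h3 : 0 ≤ wnorm d E := wnorm_nonneg hd E
    have h4 := mul_le_mul_of_nonneg_right hτC h3
    have h5 : τ * C₂ * ds * η ^ 2 ≤ C₂ * ds * η ^ 2 := by
      have : 0 ≤ C₂ * ds * η ^ 2 := by positivity
      have := mul_le_mul_of_nonneg_right hτ1 this
      linarith
    have h6 : α / 2 * wnorm d E ≤ C₂ * ds * η ^ 2 + cf / α * ‖e‖ ^ 2 := by linarith
    have h7 : wnorm d E ≤ 2 / α * (C₂ * ds * η ^ 2 + cf / α * ‖e‖ ^ 2) := by
      have := mul_le_mul_of_nonneg_left h6 (show 0 ≤ 2 / α by positivity)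
      refine le_trans (le_of_eq ?_) this
      field_simp
    refine h7.trans ?_
    have h8 : 0 ≤ C₂ * ds * ‖e‖ ^ 2 := by positivity
    have h9 : 0 ≤ cf / α * η ^ 2 := by positivity
    have h10 : C₃ * (‖e‖ ^ 2 + η ^ 2) = 2 / α * ((C₂ * ds + cf / α) * (‖e‖ ^ 2 + η ^ 2)) := by
      ring
    rw [h10]
    refine mul_le_mul_of_nonneg_left ?_ (by positivity)
    linarith
  have hmain : ‖e + τ • ∑ i, M.b i • P i‖ ^ 2 ≤ ‖e‖ ^ 2 + τ * C₄ * (‖e‖ ^ 2 + η ^ 2) := by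
    refine (hstab.norm_sq_le hE).trans ?_
    have h1 : ∑ i, M.b i * inner ℝ (E i) (P i) ≤ C₂ * (bd * wnorm d E + bs * η ^ 2) := by
      simp only [bd, bs, Finset.sum_mul, Finset.mul_sum, ← Finset.sum_add_distrib]
      refine Finset.sum_le_sum fun i _ => ?_
      have h2 := mul_le_mul_of_nonneg_left (hEP i) (hstab.1 i).le
      have h3 := mul_le_mul_of_nonneg_left (single_le_wnorm hd E i) (hbd0 i)
      have h4 : M.b i / d i * (d i * ‖E i‖ ^ 2) = M.b i * ‖E i‖ ^ 2 := by
        have := (hd i).ne'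
        field_simp
      rw [h4] at h3
      have h5 := mul_le_mul_of_nonneg_left h3 hC₂
      linarith
    have h2 := mul_le_mul_of_nonneg_left hN hbd
    have h3 : bd * wnorm d E + bs * η ^ 2 ≤ (bd * C₃ + bs) * (‖e‖ ^ 2 + η ^ 2) := by
      have : 0 ≤ bs * ‖e‖ ^ 2 := by positivity
      linarith
    have h4 := mul_le_mul_of_nonneg_left (h1.trans (mul_le_mul_of_nonneg_left h3 hC₂))
      (show 0 ≤ 2 * τ by positivity)
    have h5 : τ * C₄ * (‖e‖ ^ 2 + η ^ 2) =
        2 * τ * (C₂ * ((bd * C₃ + bs) * (‖e‖ ^ 2 + η ^ 2))) := by ring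
    linarith
  set ε : Y := τ • ∑ i, M.b i • G i - (y₁ - (y₀ + τ • ∑ i, M.b i • F i))
  have hε : ‖ε‖ ≤ τ * (C₅ * η) := by
    have h1 : ‖τ • ∑ i, M.b i • G i‖ ≤ τ * (bs * (k * η)) := by
      rw [norm_smul, Real.norm_of_nonneg hτ.le]
      refine mul_le_mul_of_nonneg_left ((norm_sum_le _ _).trans ?_) hτ.le
      rw [Finset.sum_mul]
      refine Finset.sum_le_sum fun i _ => ?_
      rw [norm_smul, Real.norm_of_nonneg (hstab.1 i).le]
      exact mul_le_mul_of_nonneg_left (hG i) (hstab.1 i).le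
    refine (norm_sub_le _ _).trans ((add_le_add h1 hΔ₁).trans_eq ?_)
    ring
  have hdec : u₁ - y₁ = (e + τ • ∑ i, M.b i • P i) + ε := by
    rw [hstep.update]
    simp only [hPdef, smul_sub, Finset.sum_sub_distrib, ε, hedef]
    abel
  rw [hdec]
  -- Young's inequality with parameter τ: since ‖ε‖ = O(τη), the weight 1 + 1/τ on ‖ε‖² still leaves
  -- O(τη²).
  refine (sq_norm_add_le hτ _ _).trans ?_
  have h1 : ‖ε‖ ^ 2 ≤ (τ * (C₅ * η)) ^ 2 := pow_le_pow_left₀ (norm_nonneg _) hε 2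
  have h2 : (1 + 1 / τ) * ‖ε‖ ^ 2 ≤ (1 + 1 / τ) * (τ * (C₅ * η)) ^ 2 :=
    mul_le_mul_of_nonneg_left h1 (by positivity)
  have h3 : (1 + 1 / τ) * (τ * (C₅ * η)) ^ 2 = (1 + τ) * (τ * (C₅ ^ 2 * η ^ 2)) := by
    field_simp; ring
  have h4 : (1 + τ) * (τ * (C₅ ^ 2 * η ^ 2)) ≤ 2 * (τ * (C₅ ^ 2 * η ^ 2)) :=
    mul_le_mul_of_nonneg_right (by linarith) (by positivity)
  have h5 := mul_le_mul_of_nonneg_left hmain (show 0 ≤ 1 + τ by positivity)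
  have h6 : (1 + τ) * (τ * C₄ * (‖e‖ ^ 2 + η ^ 2)) ≤ 2 * (τ * C₄ * (‖e‖ ^ 2 + η ^ 2)) :=
    mul_le_mul_of_nonneg_right (by linarith) (by positivity)
  have h7 : 0 ≤ τ * η ^ 2 := by positivity
  have h8 : 0 ≤ τ * (C₅ ^ 2 * ‖e‖ ^ 2) := by positivity
  linarith

end Kato
end

/-! ### Taylor expansions and smooth maps bounded on bounded sets. -/

open scoped ContDiff Topology Matrix
noncomputable section
namespace Kato

section Taylor

variable {E : Type*} [NormedAddCommGroup E] [NormedSpace ℝ E]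

/-- Taylor's formula on an interval, in both directions. -/
theorem norm_sub_taylor_le {a b : ℝ} (hab : a < b) {n : ℕ} {φ : ℝ → E}
    (hφ : ContDiffOn ℝ n φ (Set.Icc a b)) {C : ℝ}
    (hC : ∀ t ∈ Set.Icc a b, ‖iteratedDerivWithin n φ (Set.Icc a b) t‖ ≤ C) {s t : ℝ}
    (hs : s ∈ Set.Icc a b) (ht : t ∈ Set.Icc a b) :
    ‖φ s - ∑ k ∈ Finset.range n,
      ((s - t) ^ k / (k.factorial : ℝ)) • iteratedDerivWithin k φ (Set.Icc a b) t‖ ≤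
        C * |s - t| ^ n := by
  induction n generalizing φ s with
  | zero => simpa using hC s hs
  | succ n ih =>
    have hud := uniqueDiffOn_Icc hab
    have hd : DifferentiableOn ℝ φ (Set.Icc a b) := hφ.differentiableOn (by simp)
    have hφ' : ContDiffOn ℝ n (derivWithin φ (Set.Icc a b)) (Set.Icc a b) :=
      hφ.derivWithin hud (by simp)
    have hsub : Set.uIcc t s ⊆ Set.Icc a b := Set.uIcc_subset_Icc ht hs
    have hC0 : 0 ≤ C := (norm_nonneg _).trans (hC s hs)
    have hderiv : ∀ x ∈ Set.uIcc t s, HasDerivWithinAt (fun x => φ x - ∑ k ∈ Finset.range (n + 1),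
        ((x - t) ^ k / (k.factorial : ℝ)) • iteratedDerivWithin k φ (Set.Icc a b) t)
        (derivWithin φ (Set.Icc a b) x - ∑ k ∈ Finset.range n,
          ((x - t) ^ k / (k.factorial : ℝ)) •
            iteratedDerivWithin k (derivWithin φ (Set.Icc a b)) (Set.Icc a b) t)
        (Set.uIcc t s) x := by
      intro x hx
      refine HasDerivWithinAt.sub ((hd x (hsub hx)).hasDerivWithinAt.mono hsub) ?_
      simp_rw [Finset.sum_range_succ', ← iteratedDerivWithin_succ']
      simp only [pow_zero, Nat.factorial_zero, Nat.cast_one, div_one, one_smul]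
      refine HasDerivWithinAt.add_const _ (HasDerivWithinAt.fun_sum fun k _ => ?_)
      refine HasDerivWithinAt.smul_const ?_ _
      have h1 : HasDerivAt (fun x : ℝ => (x - t) ^ (k + 1) / ((k + 1).factorial : ℝ))
          ((x - t) ^ k / (k.factorial : ℝ)) x := by
        refine HasDerivAt.congr_deriv
          ((((hasDerivAt_id' x).sub_const t).fun_pow (k + 1)).div_const _) ?_
        rw [Nat.factorial_succ]
        push_cast
        have : (k.factorial : ℝ) ≠ 0 := by positivity
        have : (k + 1 : ℝ) ≠ 0 := by positivity
        field_simp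
      exact h1.hasDerivWithinAt
    have hbound : ∀ x ∈ Set.uIcc t s, ‖derivWithin φ (Set.Icc a b) x - ∑ k ∈ Finset.range n,
          ((x - t) ^ k / (k.factorial : ℝ)) •
            iteratedDerivWithin k (derivWithin φ (Set.Icc a b)) (Set.Icc a b) t‖ ≤
          C * |s - t| ^ n := by
      intro x hx
      refine (ih hφ' (fun y hy => ?_) (hsub hx)).trans ?_
      · rw [← iteratedDerivWithin_succ']; exact hC y hy
      · have : |x - t| ≤ |s - t| := Set.abs_sub_left_of_mem_uIcc hx
        gcongr
    have key := Convex.norm_image_sub_le_of_norm_hasDerivWithin_le hderiv hbound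
      (convex_uIcc t s) Set.left_mem_uIcc Set.right_mem_uIcc
    have hzero : φ t - ∑ k ∈ Finset.range (n + 1),
        ((t - t) ^ k / (k.factorial : ℝ)) • iteratedDerivWithin k φ (Set.Icc a b) t = 0 := by
      rw [Finset.sum_range_succ']
      simp
    rw [hzero, sub_zero, Real.norm_eq_abs] at key
    rw [pow_succ, ← mul_assoc]
    exact key

/-- The Taylor polynomial with given derivatives. -/
def taylorPoly (v : ℕ → E) (n : ℕ) (s : ℝ) : E :=
  ∑ k ∈ Finset.range (n + 1), (s ^ k / (k.factorial : ℝ)) • v k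

theorem taylorPoly_succ (v : ℕ → E) (n : ℕ) (s : ℝ) :
    taylorPoly v (n + 1) s =
      taylorPoly v n s + (s ^ (n + 1) / ((n + 1).factorial : ℝ)) • v (n + 1) := by
  rw [taylorPoly, Finset.sum_range_succ, taylorPoly]

theorem hasDerivAt_taylorPoly_zero (v : ℕ → E) (s : ℝ) : HasDerivAt (taylorPoly v 0) 0 s := by
  have : taylorPoly v 0 = fun _ => v 0 := by funext s; simp [taylorPoly]
  rw [this]
  exact hasDerivAt_const _ _

theorem hasDerivAt_taylorPoly (v : ℕ → E) (n : ℕ) (s : ℝ) :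
    HasDerivAt (taylorPoly v (n + 1)) (taylorPoly (fun k => v (k + 1)) n s) s := by
  have : taylorPoly v (n + 1) = fun s => ∑ k ∈ Finset.range (n + 1),
      (s ^ (k + 1) / ((k + 1).factorial : ℝ)) • v (k + 1) + v 0 := by
    funext s; simp [taylorPoly, Finset.sum_range_succ' _ (n + 1)]
  rw [this]
  refine HasDerivAt.add_const _ (HasDerivAt.fun_sum fun k _ => ?_)
  refine HasDerivAt.smul_const ?_ _
  refine HasDerivAt.congr_deriv ((hasDerivAt_pow (k + 1) s).div_const _) ?_
  rw [Nat.factorial_succ]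
  push_cast
  have : (k.factorial : ℝ) ≠ 0 := by positivity
  have : (k + 1 : ℝ) ≠ 0 := by positivity
  field_simp

theorem contDiff_taylorPoly (v : ℕ → E) (n : ℕ) : ContDiff ℝ ∞ (taylorPoly v n) := by
  unfold taylorPoly
  fun_prop

theorem norm_taylorPoly_le {v : ℕ → E} {K : ℝ} (hv : ∀ k, ‖v k‖ ≤ K) (n : ℕ) {s : ℝ}
    (hs : |s| ≤ 1) : ‖taylorPoly v n s‖ ≤ (n + 1 : ℕ) * K := by
  have hK : 0 ≤ K := (norm_nonneg _).trans (hv 0)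
  refine (norm_sum_le _ _).trans ?_
  refine (Finset.sum_le_card_nsmul _ _ K fun k _ => ?_).trans_eq (by simp)
  rw [norm_smul, norm_div, norm_pow, Real.norm_eq_abs, Real.norm_natCast]
  have h1 : |s| ^ k ≤ 1 := pow_le_one₀ (abs_nonneg _) hs
  have h2 : (1 : ℝ) ≤ k.factorial := by exact_mod_cast Nat.factorial_pos k
  have h3 : |s| ^ k / (k.factorial : ℝ) ≤ 1 := by
    rw [div_le_one (by positivity)]; linarith
  calc _ ≤ 1 * K := mul_le_mul h3 (hv k) (norm_nonneg _) zero_le_one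
    _ = K := one_mul K

theorem norm_iteratedDeriv_taylorPoly_le {v : ℕ → E} {K : ℝ} (hv : ∀ k, ‖v k‖ ≤ K) (n i : ℕ)
    {s : ℝ} (hs : |s| ≤ 1) : ‖iteratedDeriv i (taylorPoly v n) s‖ ≤ (n + 1 : ℕ) * K := by
  have hK : 0 ≤ K := (norm_nonneg _).trans (hv 0)
  induction i generalizing n v with
  | zero => simpa using norm_taylorPoly_le hv n hs
  | succ i ih =>
    rw [iteratedDeriv_succ']
    cases n with
    | zero =>
      have : deriv (taylorPoly v 0) = fun _ => (0 : E) :=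
        funext fun s => (hasDerivAt_taylorPoly_zero v s).deriv
      rw [this, iteratedDeriv_const]
      simpa using hK
    | succ n =>
      have : deriv (taylorPoly v (n + 1)) = taylorPoly (fun k => v (k + 1)) n :=
        funext fun s => (hasDerivAt_taylorPoly v n s).deriv
      rw [this]
      refine (ih (fun k => hv _) n).trans ?_
      gcongr
      omega

/-- Letting s tend to zero kills the constant coefficient; dividing by s gives the induction. A
general filter allows one-sided approach at an endpoint of the time interval. -/
theorem eq_zero_of_norm_sum_le {F : Filter ℝ} [F.NeBot] (hF : F ≤ 𝓝 0) (hF0 : ∀ᶠ s in F, s ≠ 0)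
    {p : ℕ} {a : ℕ → E} {C : ℝ}
    (h : ∀ᶠ s in F, ‖∑ l ∈ Finset.range p, s ^ l • a l‖ ≤ C * |s| ^ p) :
    ∀ l < p, a l = 0 := by
  induction p generalizing a with
  | zero => intro l hl; omega
  | succ p ih =>
    have e : ∀ s : ℝ, ∑ l ∈ Finset.range (p + 1), s ^ l • a l =
        a 0 + s • ∑ l ∈ Finset.range p, s ^ l • a (l + 1) := by
      intro s
      rw [Finset.sum_range_succ', Finset.smul_sum, add_comm]
      simp [pow_succ', smul_smul]
    simp_rw [e] at h
    have ha0 : a 0 = 0 := by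
      have h1 : Filter.Tendsto (fun s : ℝ => ‖a 0 + s • ∑ l ∈ Finset.range p, s ^ l • a (l + 1)‖) F
          (𝓝 ‖a 0 + (0 : ℝ) • ∑ l ∈ Finset.range p, (0 : ℝ) ^ l • a (l + 1)‖) :=
        ((by fun_prop : Continuous fun s : ℝ =>
          ‖a 0 + s • ∑ l ∈ Finset.range p, s ^ l • a (l + 1)‖).tendsto 0).mono_left hF
      have h2 : Filter.Tendsto (fun s : ℝ => C * |s| ^ (p + 1)) F (𝓝 (C * |0| ^ (p + 1))) :=
        ((by fun_prop : Continuous fun s : ℝ => C * |s| ^ (p + 1)).tendsto 0).mono_left hF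
      have h3 := le_of_tendsto_of_tendsto h1 h2 h
      simpa using h3
    intro l hl
    cases l with
    | zero => exact ha0
    | succ l =>
      refine ih (a := fun l => a (l + 1)) ?_ l (by omega)
      filter_upwards [h, hF0] with s hs hs0
      rw [ha0, zero_add, norm_smul, Real.norm_eq_abs, pow_succ'] at hs
      have : |s| * ‖∑ l ∈ Finset.range p, s ^ l • a (l + 1)‖ ≤ |s| * (C * |s| ^ p) := by linarith
      exact le_of_mul_le_mul_left this (abs_pos.2 hs0)

end Taylor

section Smooth

variable {Y : Type*} [NormedAddCommGroup Y] [InnerProductSpace ℝ Y]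
  {E G : Type*} [NormedAddCommGroup E] [NormedSpace ℝ E] [NormedAddCommGroup G] [NormedSpace ℝ G]

theorem SmoothLocallyBounded.exists_bound {F : Y → E} (hF : SmoothLocallyBounded F) (n : ℕ)
    (R : ℝ) : ∃ C : ℝ, 0 ≤ C ∧ ∀ j ≤ n, ∀ y : Y, ‖y‖ ≤ R → ‖iteratedFDeriv ℝ j F y‖ ≤ C := by
  choose C hC using fun j => hF.2 j (max R 1) (lt_max_of_lt_right one_pos)
  refine ⟨∑ j ∈ Finset.range (n + 1), |C j|, Finset.sum_nonneg fun _ _ => abs_nonneg _,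
    fun j hj y hy => ((hC j y (hy.trans (le_max_left _ _))).trans (le_abs_self _)).trans ?_⟩
  exact Finset.single_le_sum (f := fun j => |C j|) (fun _ _ => abs_nonneg _)
    (Finset.mem_range.2 (by omega))

theorem SmoothLocallyBounded.precomp {F : Y → E} (hF : SmoothLocallyBounded F) (L : Y →L[ℝ] Y) :
    SmoothLocallyBounded fun y => F (L y) := by
  refine ⟨hF.1.comp L.contDiff, fun j R hR => ?_⟩
  obtain ⟨C, hC0, hC⟩ := hF.exists_bound j (‖L‖ * R)
  refine ⟨C * ∏ _i : Fin j, ‖L‖, fun y hy => ?_⟩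
  have := L.iteratedFDeriv_comp_right hF.1 y (i := j) (by exact_mod_cast le_top)
  rw [Function.comp_def] at this
  rw [this]
  refine (ContinuousMultilinearMap.norm_compContinuousLinearMap_le _ _).trans ?_
  gcongr
  exact hC j le_rfl _ ((L.le_opNorm y).trans (by gcongr))

theorem SmoothLocallyBounded.postcomp {F : Y → E} (hF : SmoothLocallyBounded F) (L : E →L[ℝ] G) :
    SmoothLocallyBounded fun y => L (F y) := by
  refine ⟨L.contDiff.comp hF.1, fun j R hR => ?_⟩
  obtain ⟨C, hC⟩ := hF.2 j R hR
  refine ⟨‖L‖ * C, fun y hy => ?_⟩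
  refine (L.norm_iteratedFDeriv_comp_left hF.1.contDiffAt (n := j)
    (by exact_mod_cast le_top)).trans ?_
  gcongr
  exact hC y hy

theorem SmoothLocallyBounded.add {F F' : Y → E} (hF : SmoothLocallyBounded F)
    (hF' : SmoothLocallyBounded F') : SmoothLocallyBounded (F + F') := by
  refine ⟨hF.1.add hF'.1, fun j R hR => ?_⟩
  obtain ⟨C, hC⟩ := hF.2 j R hR
  obtain ⟨C', hC'⟩ := hF'.2 j R hR
  refine ⟨C + C', fun y hy => ?_⟩
  rw [iteratedFDeriv_add_apply (hF.1.contDiffAt.of_le (by exact_mod_cast le_top))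
    (hF'.1.contDiffAt.of_le (by exact_mod_cast le_top))]
  exact (norm_add_le _ _).trans (add_le_add (hC y hy) (hC' y hy))

theorem SmoothLocallyBounded.id : SmoothLocallyBounded fun y : Y => y := by
  refine ⟨contDiff_id, fun j R hR => ?_⟩
  cases j with
  | zero => exact ⟨R, fun y hy => by simpa using hy⟩
  | succ j =>
    have h : ∀ y, ‖iteratedFDeriv ℝ (j + 1) (fun y : Y => y) y‖ =
        ‖iteratedFDeriv ℝ j (fun _ : Y => ContinuousLinearMap.id ℝ Y) y‖ := by
      intro y
      rw [← norm_iteratedFDeriv_fderiv]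
      congr 3
      exact funext fun _ => fderiv_fun_id
    cases j with
    | zero => exact ⟨‖ContinuousLinearMap.id ℝ Y‖, fun y hy => by rw [h]; simp⟩
    | succ j =>
      refine ⟨0, fun y hy => ?_⟩
      rw [h, iteratedFDeriv_succ_const]
      simp

theorem SmoothLocallyBounded.apply_self {F : Y → (Y →L[ℝ] E)} (hF : SmoothLocallyBounded F) :
    SmoothLocallyBounded fun y => F y y := by
  refine ⟨hF.1.clm_apply contDiff_id, fun j R hR => ?_⟩
  obtain ⟨C, hC0, hC⟩ := hF.exists_bound j R
  obtain ⟨C', hC0', hC'⟩ := SmoothLocallyBounded.id (Y := Y).exists_bound j R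
  refine ⟨∑ i ∈ Finset.range (j + 1), (j.choose i : ℝ) * C * C', fun y hy => ?_⟩
  refine (norm_iteratedFDeriv_clm_apply hF.1 contDiff_id y (by exact_mod_cast le_top)).trans ?_
  refine Finset.sum_le_sum fun i hi => ?_
  have hi := Finset.mem_range.1 hi
  gcongr
  · exact hC i (by omega) y hy
  · exact hC' (j - i) (by omega) y hy

theorem SmoothLocallyBounded.fderiv {F : Y → E} (hF : SmoothLocallyBounded F) :
    SmoothLocallyBounded (fderiv ℝ F) := by
  refine ⟨hF.1.fderiv_right (by simp), fun j R hR => ?_⟩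
  obtain ⟨C, hC⟩ := hF.2 (j + 1) R hR
  exact ⟨C, fun y hy => by rw [norm_iteratedFDeriv_fderiv]; exact hC y hy⟩

theorem SmoothLocallyBounded.exists_lipschitz {F : Y → E} (hF : SmoothLocallyBounded F) (R : ℝ) :
    ∃ C : ℝ, 0 ≤ C ∧ ∀ x y : Y, ‖x‖ ≤ R → ‖y‖ ≤ R → ‖F x - F y‖ ≤ C * ‖x - y‖ := by
  obtain ⟨C, hC0, hC⟩ := hF.exists_bound 1 R
  refine ⟨C, hC0, fun x y hx hy => ?_⟩
  refine Convex.norm_image_sub_le_of_norm_fderiv_le (𝕜 := ℝ) (s := Metric.closedBall 0 R)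
    (fun z _ => hF.1.differentiable (by simp) z) (fun z hz => ?_) (convex_closedBall _ _)
    (by simpa using hy) (by simpa using hx)
  have := hC 1 le_rfl z (by simpa using hz)
  rwa [← zero_add 1, ← norm_iteratedFDeriv_fderiv, norm_iteratedFDeriv_zero] at this

theorem SmoothLocallyBounded.exists_quadratic {F : Y → E} (hF : SmoothLocallyBounded F) (R : ℝ) :
    ∃ C : ℝ, 0 ≤ C ∧ ∀ x y : Y, ‖x‖ ≤ R → ‖y‖ ≤ R →
      ‖F x - F y - _root_.fderiv ℝ F y (x - y)‖ ≤ C * ‖x - y‖ ^ 2 := by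
  obtain ⟨C, hC0, hC⟩ := hF.fderiv.exists_lipschitz R
  refine ⟨C, hC0, fun x y hx hy => ?_⟩
  rw [sq, ← mul_assoc]
  refine Convex.norm_image_sub_le_of_norm_hasFDerivWithin_le' (𝕜 := ℝ) (s := segment ℝ y x)
    (f' := _root_.fderiv ℝ F)
    (fun z _ => (hF.1.differentiable (by simp) z).hasFDerivAt.hasFDerivWithinAt) (fun z hz => ?_)
    (convex_segment _ _) (left_mem_segment _ _ _) (right_mem_segment _ _ _)
  have hz' : ‖z‖ ≤ R := by
    have := (convex_closedBall (0 : Y) R).segment_subset (by simpa using hy) (by simpa using hx) hz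
    simpa using this
  refine (hC z y hz' hy).trans ?_
  gcongr
  obtain ⟨θ, hθ, rfl⟩ := (segment_eq_image' ℝ y x ▸ hz : z ∈ _)
  simp only [add_sub_cancel_left, norm_smul, Real.norm_of_nonneg hθ.1]
  exact mul_le_of_le_one_left (norm_nonneg _) hθ.2

/-- Uniform Taylor expansions along polynomial paths with bounded coefficients. -/
theorem SmoothLocallyBounded.exists_expansion {F : Y → E} (hF : SmoothLocallyBounded F)
    (n L : ℕ) (K : ℝ) : ∃ C : ℝ, 0 ≤ C ∧ ∀ v : ℕ → Y, (∀ k, ‖v k‖ ≤ K) → ∃ a : ℕ → E,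
      (∀ l ≤ L, ‖a l‖ ≤ C) ∧ ∀ s : ℝ, |s| ≤ 1 →
        ‖F (taylorPoly v n s) - ∑ l ∈ Finset.range L, s ^ l • a l‖ ≤ C * |s| ^ L := by
  set K' := (n + 1 : ℕ) * K
  obtain ⟨C, hC0, hC⟩ := hF.exists_bound L K'
  set D := max 1 K'
  have hD1 : 1 ≤ D := le_max_left _ _
  set C' := (L.factorial : ℝ) * C * D ^ L
  refine ⟨C', by positivity, fun v hv => ?_⟩
  have hcd : ContDiff ℝ ∞ fun s => F (taylorPoly v n s) := hF.1.comp (contDiff_taylorPoly v n)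
  have hbound : ∀ l ≤ L, ∀ s : ℝ, |s| ≤ 1 →
      ‖iteratedDeriv l (fun s => F (taylorPoly v n s)) s‖ ≤ C' := by
    intro l hl s hs
    -- The Faà di Bruno bound depends only on K, n and L, so the constants are uniform over all
    -- polynomial paths considered.
    have := norm_iteratedFDeriv_comp_le hF.1 (contDiff_taylorPoly v n) (n := l)
      (by exact_mod_cast le_top) s (C := C) (D := D)
      (fun i hi => hC i (hi.trans hl) _ (norm_taylorPoly_le hv n hs))
      (fun i hi _ => by
        rw [norm_iteratedFDeriv_eq_norm_iteratedDeriv]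
        exact (norm_iteratedDeriv_taylorPoly_le hv n i hs).trans
          ((le_max_right _ _).trans (le_self_pow₀ hD1 (by omega))))
    rw [norm_iteratedFDeriv_eq_norm_iteratedDeriv] at this
    refine this.trans ?_
    simp only [C']
    gcongr
  refine ⟨fun l => (1 / (l.factorial : ℝ)) • iteratedDeriv l (fun s => F (taylorPoly v n s)) 0,
    fun l hl => ?_, fun s hs => ?_⟩
  · have h1 : ‖(1 / (l.factorial : ℝ))‖ ≤ 1 := by
      rw [norm_div, norm_one, Real.norm_natCast, div_le_one (by positivity)]
      exact_mod_cast Nat.factorial_pos l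
    rw [norm_smul]
    exact (mul_le_of_le_one_left (norm_nonneg _) h1).trans (hbound l hl 0 (by simp))
  · have heq : ∀ l : ℕ, ∀ s ∈ Set.Icc (-1 : ℝ) 1,
        iteratedDerivWithin l (fun s => F (taylorPoly v n s)) (Set.Icc (-1) 1) s =
          iteratedDeriv l (fun s => F (taylorPoly v n s)) s := fun l s hs =>
      iteratedDerivWithin_eq_iteratedDeriv (uniqueDiffOn_Icc (by norm_num))
        (hcd.contDiffAt.of_le (by exact_mod_cast le_top)) hs
    have key := norm_sub_taylor_le (a := -1) (b := 1) (by norm_num) (n := L)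
      (φ := fun s => F (taylorPoly v n s))
      (hcd.of_le (by exact_mod_cast le_top)).contDiffOn (C := C')
      (fun t ht => by rw [heq L t ht]; exact hbound L le_rfl t (abs_le.2 ht))
      (abs_le.1 hs) (t := 0) (by norm_num)
    simp_rw [heq _ 0 (by norm_num : (0 : ℝ) ∈ Set.Icc (-1 : ℝ) 1), sub_zero] at key
    refine le_trans (le_of_eq ?_) key
    congr 2
    refine Finset.sum_congr rfl fun l _ => ?_
    rw [smul_smul, mul_one_div]

end Smooth
end Kato
end

/-! ### The conjugated vector fields and the derivatives of S^j u. -/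

open scoped ContDiff Topology Matrix
noncomputable section
namespace Kato

variable {X Y : Type*}
  [NormedAddCommGroup X] [InnerProductSpace ℝ X]
  [NormedAddCommGroup Y] [InnerProductSpace ℝ Y]

/-- The nonlinearity `-A(w) w` at `w = S⁻ʲ v`, conjugated with `S ^ j`, as an element of `Y` for
`v` in the domain of `S`. -/
def conjField (ι : Y →L[ℝ] X) (S : Y ≃ₗᵢ[ℝ] X) (AY : Y → (Y →L[ℝ] X)) (B : ℕ → Y → (X →L[ℝ] X))
    (j : ℕ) (v : Y) : Y :=
  -(S.symm (AY ((invOnY ι S ^ j) v) v + B j ((invOnY ι S ^ j) v) (ι v)))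

variable {ι : Y →L[ℝ] X} {S : Y ≃ₗᵢ[ℝ] X} {A : Y → (X →ₗ.[ℝ] X)} {B : ℕ → Y → (X →L[ℝ] X)}
  {AY : Y → (Y →L[ℝ] X)}

theorem smoothLocallyBounded_conjField (hAY : SmoothLocallyBounded AY) {j : ℕ}
    (hB : SmoothLocallyBounded (B j)) : SmoothLocallyBounded (conjField ι S AY B j) := by
  have h1 := ((hAY.precomp (invOnY ι S ^ j)).add ((hB.precomp (invOnY ι S ^ j)).postcomp
    ((ContinuousLinearMap.compL ℝ Y X X).flip ι))).apply_self
  exact h1.postcomp (-(S.symm.toContinuousLinearEquiv : X →L[ℝ] Y))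

theorem invOnX_pow_conjField (hι : IsDenseEmbedding ι) {j : ℕ} (hB : Commutator ι S j A (B j))
    (hAY : ∀ y w, (ι w, AY y w) ∈ (A y).graph) (v : Y) :
    (invOnX ι S ^ j) (S (conjField ι S AY B j v)) =
      -(AY ((invOnY ι S ^ j) v) ((invOnY ι S ^ j) v)) := by
  rw [conjField, map_neg, S.apply_symm_apply, map_neg, hB.apply_invOnY_pow hι hAY]

theorem embedding_conjField_one (hι : IsDenseEmbedding ι) (hB : Commutator ι S 1 A (B 1))
    (hAY : ∀ y w, (ι w, AY y w) ∈ (A y).graph) (v : Y) :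
    ι (conjField ι S AY B 1 v) = -(AY (invOnY ι S v) (invOnY ι S v)) := by
  have := invOnX_pow_conjField hι hB hAY v
  simpa [-invOnY_apply] using this

/-- The conjugated nonlinearities are intertwined by powers of `S⁻¹`. -/
theorem invOnY_pow_conjField (hι : IsDenseEmbedding ι) {j : ℕ}
    (hB : Commutator ι S (j + 1) A (B (j + 1))) (hB₁ : Commutator ι S 1 A (B 1))
    (hAY : ∀ y w, (ι w, AY y w) ∈ (A y).graph) (v : Y) :
    (invOnY ι S ^ j) (conjField ι S AY B (j + 1) v) =
      conjField ι S AY B 1 ((invOnY ι S ^ j) v) := by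
  apply hι.injective
  rw [embedding_conjField_one hι hB₁ hAY, ← mul_apply_eq_comp, ← pow_succ',
    ← invOnX_pow_conjField hι hB hAY, invOnX_pow_succ_apply, S.symm_apply_apply]

/-- Differentiate the intertwining relation. This lets a correction computed at a higher power of S
be lowered afterwards to the linearization of the first conjugated field. -/
theorem invOnY_pow_fderiv_conjField (hι : IsDenseEmbedding ι) {j : ℕ}
    (hB : Commutator ι S (j + 1) A (B (j + 1))) (hB₁ : Commutator ι S 1 A (B 1))
    (hAY : ∀ y w, (ι w, AY y w) ∈ (A y).graph)
    (hj : Differentiable ℝ (conjField ι S AY B (j + 1)))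
    (h1 : Differentiable ℝ (conjField ι S AY B 1)) (v e : Y) :
    (invOnY ι S ^ j) (fderiv ℝ (conjField ι S AY B (j + 1)) v e) =
      fderiv ℝ (conjField ι S AY B 1) ((invOnY ι S ^ j) v) ((invOnY ι S ^ j) e) := by
  have e1 : HasFDerivAt (fun v => (invOnY ι S ^ j) (conjField ι S AY B (j + 1) v))
      ((invOnY ι S ^ j) ∘L fderiv ℝ (conjField ι S AY B (j + 1)) v) v :=
    (invOnY ι S ^ j).hasFDerivAt.comp v (hj v).hasFDerivAt
  have e2 : HasFDerivAt (fun v => conjField ι S AY B 1 ((invOnY ι S ^ j) v))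
      (fderiv ℝ (conjField ι S AY B 1) ((invOnY ι S ^ j) v) ∘L (invOnY ι S ^ j)) v :=
    (h1 _).hasFDerivAt.comp v (invOnY ι S ^ j).hasFDerivAt
  simp_rw [invOnY_pow_conjField hι hB hB₁ hAY] at e1
  exact congrArg (fun L : Y →L[ℝ] Y => L e) (e1.unique e2)

theorem iteratedDerivWithin_clm_comp {E F : Type*} [NormedAddCommGroup E] [NormedSpace ℝ E]
    [NormedAddCommGroup F] [NormedSpace ℝ F] (L : E →L[ℝ] F) {φ : ℝ → E} {s : Set ℝ} {n : ℕ}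
    (hφ : ContDiffOn ℝ n φ s) (hs : UniqueDiffOn ℝ s) {t : ℝ} (ht : t ∈ s) :
    iteratedDerivWithin n (fun x => L (φ x)) s t = L (iteratedDerivWithin n φ s t) := by
  have := L.iteratedFDerivWithin_comp_left (hφ t ht) hs ht le_rfl
  rw [Function.comp_def] at this
  rw [iteratedDerivWithin, this, iteratedDerivWithin]
  rfl

theorem PowRegular.exists_eq (hι : IsDenseEmbedding ι) {T : ℝ} {u : ℝ → Y} {k r : ℕ}
    (h : PowRegular ι S T u k r) : ∃ v : ℝ → Y, ContDiffOn ℝ r v (Set.Icc 0 T) ∧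
      ∀ t ∈ Set.Icc 0 T, (invOnY ι S ^ k) (v t) = u t := by
  obtain ⟨v, hv, h⟩ := h
  refine ⟨v, hv, fun t ht => hι.injective ?_⟩
  rw [← invOnX_pow_embedding, ← (mem_graph_ppow_opOnX hι k _ _).1 (h t ht)]

theorem IsSolution.derivWithin_eq (hι : IsDenseEmbedding ι) (hB : Commutator ι S 1 A (B 1))
    (hAY : ∀ y w, (ι w, AY y w) ∈ (A y).graph) {T : ℝ} (hT : 0 < T) {u v : ℝ → Y}
    (hu : IsSolution ι A T u) (hd : DifferentiableOn ℝ u (Set.Icc 0 T))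
    (hv : ∀ t ∈ Set.Icc 0 T, invOnY ι S (v t) = u t) {t : ℝ} (ht : t ∈ Set.Icc 0 T) :
    derivWithin u (Set.Icc 0 T) t = conjField ι S AY B 1 (v t) := by
  obtain ⟨u', h1, h2⟩ := hu t ht
  have h3 : HasDerivWithinAt (fun s => ι (u s)) (ι (derivWithin u (Set.Icc 0 T) t))
      (Set.Icc 0 T) t :=
    ι.hasFDerivAt.comp_hasDerivWithinAt t (hd t ht).hasDerivWithinAt
  have h4 := (uniqueDiffOn_Icc hT t ht).eq_deriv _ h1 h3
  apply hι.injective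
  rw [embedding_conjField_one hι hB hAY, hv t ht, ← h4, graph_unique _ (hAY (u t) (u t)) h2,
    neg_neg]

theorem exists_neBot_filter_Icc {T : ℝ} (hT : 0 < T) {t : ℝ} (ht : t ∈ Set.Icc 0 T) :
    ∃ F : Filter ℝ, F.NeBot ∧ F ≤ 𝓝 0 ∧ (∀ᶠ s in F, s ≠ 0) ∧ ∀ᶠ s in F, t + s ∈ Set.Icc 0 T := by
  rcases ht.2.lt_or_eq with h | h
  · refine ⟨𝓝[>] 0, inferInstance, nhdsWithin_le_nhds, ?_, ?_⟩
    · filter_upwards [self_mem_nhdsWithin] with s hs using ne_of_gt hs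
    · filter_upwards [Ioo_mem_nhdsGT (sub_pos.2 h)] with s hs
      exact ⟨by linarith [ht.1, hs.1], by linarith [hs.2]⟩
  · refine ⟨𝓝[<] 0, inferInstance, nhdsWithin_le_nhds, ?_, ?_⟩
    · filter_upwards [self_mem_nhdsWithin] with s hs using ne_of_lt hs
    · filter_upwards [Ioo_mem_nhdsLT (neg_lt_zero.2 hT)] with s hs
      exact ⟨by linarith [hs.1], by linarith [hs.2]⟩

/-- The derivatives of `S ^ j u`, with their properties that are needed for consistency. -/
structure IsJet (ι : Y →L[ℝ] X) (S : Y ≃ₗᵢ[ℝ] X) (h : Y → Y) (p r : ℕ) (T : ℝ) (u : ℝ → Y)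
    (D : ℕ → ℕ → ℝ → Y) (K : ℝ) : Prop where
  bound : ∀ j k, ∀ t ∈ Set.Icc 0 T, ‖D j k t‖ ≤ K
  zero : ∀ t ∈ Set.Icc 0 T, D 0 0 t = u t
  pow : ∀ j k, j ≤ r → k ≤ p → k + j ≤ p + 1 → ∀ t ∈ Set.Icc 0 T,
    (invOnY ι S ^ j) (D j k t) = D 0 k t
  taylor : ∀ t ∈ Set.Icc 0 T, ∀ s ∈ Set.Icc 0 T,
    ‖u s - taylorPoly (fun k => D 0 k t) p (s - t)‖ ≤ K * |s - t| ^ (p + 1)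
  field : ∀ t ∈ Set.Icc 0 T, ∀ s : ℝ, |s| ≤ 1 → ‖h (taylorPoly (fun k => D 1 k t) p s) -
    taylorPoly (fun k => D 0 (k + 1) t) (p - 1) s‖ ≤ K * |s| ^ p

/-- The differential equation is recast as a property of Taylor polynomials, valid for all |s| ≤ 1.
This is needed because t + c_l τ may leave [0, T]: the nodes are not assumed to lie in [0, 1]. -/
theorem exists_isJet (hι : IsDenseEmbedding ι) {p r : ℕ} (hp : 1 ≤ p) (hr : 1 ≤ r)
    (hB : Commutator ι S 1 A (B 1)) (hAY : ∀ y w, (ι w, AY y w) ∈ (A y).graph)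
    (hF : SmoothLocallyBounded (conjField ι S AY B 1)) {T : ℝ} (hT : 0 < T) {u : ℝ → Y}
    (hu : IsSolution ι A T u) (hreg : ContDiffOn ℝ (p + 1 : ℕ) u (Set.Icc 0 T))
    (hregS : ∀ k : ℕ, 1 ≤ k → k ≤ r → PowRegular ι S T u k (p + 1 - k)) :
    ∃ (D : ℕ → ℕ → ℝ → Y) (K : ℝ), IsJet ι S (conjField ι S AY B 1) p r T u D K := by
  have hud := uniqueDiffOn_Icc hT
  have hv : ∀ j, ∃ v : ℝ → Y, (j = 0 → v = u) ∧ (j ≤ r →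
      ContDiffOn ℝ (p + 1 - j : ℕ) v (Set.Icc 0 T) ∧
        ∀ t ∈ Set.Icc 0 T, (invOnY ι S ^ j) (v t) = u t) := by
    intro j
    rcases Nat.eq_zero_or_pos j with rfl | h0
    · exact ⟨u, fun _ => rfl, fun _ => ⟨hreg, fun t _ => by simp⟩⟩
    by_cases hj : j ≤ r
    · obtain ⟨v, h⟩ := (hregS j h0 hj).exists_eq hι
      exact ⟨v, fun h => by omega, fun _ => h⟩
    · exact ⟨0, fun h => by omega, fun h => absurd h hj⟩
  choose v hv0 hv using hv
  have hv0 : v 0 = u := hv0 0 rfl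
  -- Derivatives beyond the available regularity are set to zero, so that one constant bounds all
  -- indices.
  set D : ℕ → ℕ → ℝ → Y := fun j k t =>
    if j ≤ r ∧ k ≤ p + 1 - j then iteratedDerivWithin k (v j) (Set.Icc 0 T) t else 0 with hD
  have hbd : ∀ j k, ∃ C, 0 ≤ C ∧ ∀ t ∈ Set.Icc 0 T, ‖D j k t‖ ≤ C := by
    intro j k
    by_cases h : j ≤ r ∧ k ≤ p + 1 - j
    · have hc : ContinuousOn (D j k) (Set.Icc 0 T) := by
        have := (hv j h.1).1.continuousOn_iteratedDerivWithin (m := k)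
          (by exact_mod_cast h.2) hud
        simpa only [hD, h, if_true, true_and, and_self] using this
      obtain ⟨C, hC⟩ := isCompact_Icc.exists_bound_of_continuousOn hc
      exact ⟨max C 0, le_max_right _ _, fun t ht => (hC t ht).trans (le_max_left _ _)⟩
    · refine ⟨0, le_rfl, fun t _ => ?_⟩
      simp only [hD]
      rw [if_neg h, norm_zero]
  choose C hC0 hC using hbd
  set K₀ := ∑ j ∈ Finset.range (r + 1), ∑ k ∈ Finset.range (p + 2), C j k
  have hK₀ : 0 ≤ K₀ := Finset.sum_nonneg fun j _ => Finset.sum_nonneg fun k _ => hC0 j k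
  have hK : ∀ j k, ∀ t ∈ Set.Icc 0 T, ‖D j k t‖ ≤ K₀ := by
    intro j k t ht
    by_cases h : j ≤ r ∧ k ≤ p + 1 - j
    · refine (hC j k t ht).trans ?_
      refine le_trans (Finset.single_le_sum (f := fun k => C j k) (fun k _ => hC0 j k)
        (Finset.mem_range.2 (by omega : k < p + 2))) ?_
      exact Finset.single_le_sum (f := fun j => ∑ k ∈ Finset.range (p + 2), C j k)
        (fun j _ => Finset.sum_nonneg fun k _ => hC0 j k) (Finset.mem_range.2 (by omega))
    · simp only [hD]
      rw [if_neg h, norm_zero]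
      exact hK₀
  have hD0 : ∀ k ≤ p + 1, ∀ t, D 0 k t = iteratedDerivWithin k u (Set.Icc 0 T) t := by
    intro k hk t
    simp only [hD]
    rw [if_pos ⟨by omega, by omega⟩, hv0]
  have hD1 : ∀ k ≤ p, ∀ t, D 1 k t = iteratedDerivWithin k (v 1) (Set.Icc 0 T) t := by
    intro k hk t
    simp only [hD]
    rw [if_pos ⟨hr, by omega⟩]
  have htaylor : ∀ t ∈ Set.Icc 0 T, ∀ s ∈ Set.Icc 0 T,
      ‖u s - taylorPoly (fun k => D 0 k t) p (s - t)‖ ≤ K₀ * |s - t| ^ (p + 1) := by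
    intro t ht s hs
    refine le_trans (le_of_eq ?_) (norm_sub_taylor_le hT hreg (C := K₀)
      (fun x hx => by rw [← hD0 _ le_rfl]; exact hK _ _ _ hx) hs ht)
    congr 2
    refine Finset.sum_congr rfl fun k hk => ?_
    rw [← hD0 k (by have := Finset.mem_range.1 hk; omega)]
  have htaylor1 : ∀ t ∈ Set.Icc 0 T, ∀ s ∈ Set.Icc 0 T,
      ‖v 1 s - taylorPoly (fun k => D 1 k t) p (s - t)‖ ≤ 2 * K₀ * |s - t| ^ p := by
    intro t ht s hs
    have h1 := norm_sub_taylor_le hT (n := p) ((hv 1 hr).1.of_le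
      (by rw [Nat.add_sub_cancel])) (C := K₀)
      (fun x hx => by rw [← hD1 _ le_rfl]; exact hK _ _ _ hx) hs ht
    have h2 : ‖((s - t) ^ p / (p.factorial : ℝ)) • D 1 p t‖ ≤ K₀ * |s - t| ^ p := by
      rw [norm_smul, norm_div, norm_pow, Real.norm_eq_abs, Real.norm_natCast, mul_comm]
      refine mul_le_mul (hK _ _ _ ht) (div_le_self (by positivity) ?_) (by positivity) hK₀
      exact_mod_cast Nat.factorial_pos p
    have h3 : v 1 s - taylorPoly (fun k => D 1 k t) p (s - t) =
        (v 1 s - ∑ k ∈ Finset.range p, ((s - t) ^ k / (k.factorial : ℝ)) •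
          iteratedDerivWithin k (v 1) (Set.Icc 0 T) t) -
          ((s - t) ^ p / (p.factorial : ℝ)) • D 1 p t := by
      rw [taylorPoly, Finset.sum_range_succ, ← sub_sub]
      congr 2
      refine Finset.sum_congr rfl fun k hk => ?_
      rw [← hD1 k (Finset.mem_range.1 hk).le]
    rw [h3]
    refine (norm_sub_le _ _).trans ?_
    linarith
  have hp1 : p - 1 + 1 = p := by omega
  have htaylor' : ∀ t ∈ Set.Icc 0 T, ∀ s ∈ Set.Icc 0 T,
      ‖derivWithin u (Set.Icc 0 T) s - taylorPoly (fun k => D 0 (k + 1) t) (p - 1) (s - t)‖ ≤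
        K₀ * |s - t| ^ p := by
    intro t ht s hs
    have h0 : ContDiffOn ℝ p (derivWithin u (Set.Icc 0 T)) (Set.Icc 0 T) :=
      hreg.derivWithin hud (by simp)
    refine le_trans (le_of_eq ?_) (norm_sub_taylor_le hT h0 (C := K₀)
      (fun x hx => by rw [← iteratedDerivWithin_succ', ← hD0 _ le_rfl]; exact hK _ _ _ hx) hs ht)
    congr 2
    rw [taylorPoly, hp1]
    refine Finset.sum_congr rfl fun k hk => ?_
    rw [hD0 (k + 1) (by have := Finset.mem_range.1 hk; omega), iteratedDerivWithin_succ']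
  obtain ⟨Ce, hCe0, hCe⟩ := hF.exists_expansion p p K₀
  have hfield : ∀ t ∈ Set.Icc 0 T, ∀ s : ℝ, |s| ≤ 1 →
      ‖conjField ι S AY B 1 (taylorPoly (fun k => D 1 k t) p s) -
        taylorPoly (fun k => D 0 (k + 1) t) (p - 1) s‖ ≤ Ce * |s| ^ p := by
    intro t ht
    obtain ⟨a, -, ha⟩ := hCe (fun k => D 1 k t) fun k => hK 1 k t ht
    have hpoly : ∀ s : ℝ, taylorPoly (fun k => D 0 (k + 1) t) (p - 1) s =
        ∑ l ∈ Finset.range p, s ^ l • ((1 / (l.factorial : ℝ)) • D 0 (l + 1) t) := by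
      intro s
      rw [taylorPoly, hp1]
      refine Finset.sum_congr rfl fun l _ => ?_
      rw [smul_smul, mul_one_div]
    -- Only the coefficients need to be identified, and for this the equation along u at times t + s
    -- inside [0, T] suffices. The uniform expansion then extends the conclusion to every |s| ≤ 1.
    have hzero : ∀ l < p, a l - (1 / (l.factorial : ℝ)) • D 0 (l + 1) t = 0 := by
      obtain ⟨F, hFne, hF0, hFs, hFt⟩ := exists_neBot_filter_Icc hT ht
      set R := (p + 1 : ℕ) * K₀ + K₀
      obtain ⟨CL, hCL0, hCL⟩ := hF.exists_lipschitz R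
      have hv1 : ∀ s ∈ Set.Icc 0 T, ‖v 1 s‖ ≤ K₀ := by
        intro s hs
        have := hK 1 0 s hs
        rwa [hD1 0 (by omega), iteratedDerivWithin_zero] at this
      refine eq_zero_of_norm_sum_le hF0 hFs (C := Ce + CL * (2 * K₀) + K₀) ?_
      have hF1 : ∀ᶠ s in F, |s| ≤ 1 := by
        refine hF0 ?_
        filter_upwards [Metric.closedBall_mem_nhds (0 : ℝ) one_pos] with s hs
        simpa using hs
      filter_upwards [hFt, hF1] with s hs hs1
      have e1 : ∑ l ∈ Finset.range p, s ^ l • (a l - (1 / (l.factorial : ℝ)) • D 0 (l + 1) t) =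
          -(conjField ι S AY B 1 (taylorPoly (fun k => D 1 k t) p s) -
            ∑ l ∈ Finset.range p, s ^ l • a l) +
          (conjField ι S AY B 1 (taylorPoly (fun k => D 1 k t) p s) -
            conjField ι S AY B 1 (v 1 (t + s))) +
          (derivWithin u (Set.Icc 0 T) (t + s) -
            taylorPoly (fun k => D 0 (k + 1) t) (p - 1) s) := by
        rw [hpoly, hu.derivWithin_eq hι hB hAY hT (hreg.differentiableOn (by simp))
          (fun x hx => by simpa [-invOnY_apply] using (hv 1 hr).2 x hx) hs]
        simp only [smul_sub, Finset.sum_sub_distrib]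
        abel
      rw [e1]
      refine norm_add₃_le.trans ?_
      rw [norm_neg]
      have n1 := ha s hs1
      have n2 := hCL (taylorPoly (fun k => D 1 k t) p s) (v 1 (t + s))
        ((norm_taylorPoly_le (fun k => hK 1 k t ht) p hs1).trans (by simp only [R]; linarith))
        ((hv1 _ hs).trans (by
          have : 0 ≤ ((p + 1 : ℕ) : ℝ) * K₀ := by positivity
          simp only [R]; linarith))
      have n3 := htaylor1 t ht (t + s) hs
      have n4 := htaylor' t ht (t + s) hs
      rw [add_sub_cancel_left] at n3 n4
      rw [norm_sub_rev] at n3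
      have n5 := mul_le_mul_of_nonneg_left n3 hCL0
      linarith
    intro s hs
    have e1 : taylorPoly (fun k => D 0 (k + 1) t) (p - 1) s =
        ∑ l ∈ Finset.range p, s ^ l • a l := by
      rw [hpoly]
      refine Finset.sum_congr rfl fun l hl => ?_
      rw [sub_eq_zero.1 (hzero l (Finset.mem_range.1 hl))]
    rw [e1]
    exact ha s hs
  refine ⟨D, K₀ + Ce, ⟨fun j k t ht => ?_, fun t ht => ?_, fun j k hj hk hjk t ht => ?_,
    fun t ht s hs => ?_, fun t ht s hs => ?_⟩⟩
  · exact (hK j k t ht).trans (by linarith)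
  · rw [hD0 0 (by omega), iteratedDerivWithin_zero]
  · rw [hD0 k (by omega)]
    have e1 : D j k t = iteratedDerivWithin k (v j) (Set.Icc 0 T) t := by
      simp only [hD]
      rw [if_pos ⟨hj, by omega⟩]
    rw [e1, ← iteratedDerivWithin_clm_comp _ ((hv j hj).1.of_le
      (by exact_mod_cast (by omega : k ≤ p + 1 - j))) hud ht]
    exact iteratedDerivWithin_congr (fun x hx => (hv j hj).2 x hx) ht
  · refine (htaylor t ht s hs).trans ?_
    gcongr
    linarith
  · refine (hfield t ht s hs).trans ?_
    gcongr
    linarith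

end Kato
end

/-! ### Size of the stage corrections, uniformly in the parameters. -/

open scoped ContDiff Topology Matrix
noncomputable section
namespace Kato

open Asymptotics

theorem RungeKutta.Chain.one_le {m : ℕ} {M : RungeKutta m} {k : ℕ} {w : Fin m → ℝ}
    (hw : M.Chain k w) : 1 ≤ k := by
  cases hw <;> omega

section Uniform

variable {Y : Type*} [NormedAddCommGroup Y] [NormedSpace ℝ Y] {Θ : Type*} {τ : Θ → ℝ}

theorem isBigO_pow_of_le (hτ : ∀ θ, 0 < τ θ) (hτ1 : ∀ θ, τ θ ≤ 1) {a b : ℕ} (h : b ≤ a) :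
    (fun θ => τ θ ^ a) =O[⊤] fun θ => τ θ ^ b := by
  refine IsBigO.of_bound 1 (Filter.Eventually.of_forall fun θ => ?_)
  have h0 := (hτ θ).le
  rw [one_mul, norm_pow, norm_pow, Real.norm_of_nonneg h0]
  exact pow_le_pow_of_le_one h0 (hτ1 θ) h

theorem isBigO_clm_apply {Z : Type*} [NormedAddCommGroup Z] [NormedSpace ℝ Z]
    {G : Θ → (Y →L[ℝ] Z)} {x : Θ → Y} {f g : Θ → ℝ} (hG : G =O[⊤] f) (hx : x =O[⊤] g) :
    (fun θ => G θ (x θ)) =O[⊤] fun θ => f θ * g θ := by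
  refine IsBigO.trans (IsBigO.of_bound 1 (Filter.Eventually.of_forall fun θ => ?_))
    (hG.norm_left.mul hx.norm_left)
  rw [one_mul, norm_mul, norm_norm, norm_norm]
  exact (G θ).le_opNorm _

end Uniform

namespace RungeKutta

variable {Y : Type*} [NormedAddCommGroup Y] [NormedSpace ℝ Y] {m : ℕ} (M : RungeKutta m)

/-- Corrections of the internal stages, generated from `δ` by `τ a G`. -/
def stageCorr (τ : ℝ) (G : ℕ → Fin m → (Y →L[ℝ] Y)) (δ : ℕ → Fin m → Y) : ℕ → Fin m → Y
  | 0 => 0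
  | i + 1 => fun n => δ i n + τ • ∑ l, M.a n l • G i l (stageCorr τ G δ i l)

/-- The defects of the internal stages in the quadrature conditions. -/
def stageDefect (k : ℕ) (i : Fin m) : ℝ := ∑ j, M.a i j * M.c j ^ (k - 1) - M.c i ^ k / k

variable {M} {Θ : Type*} {τ : Θ → ℝ}

/-- A family of operators has a Taylor expansion at the nodes, with coefficients that do not
depend on the stage. -/
def HasNodeExpansion (M : RungeKutta m) (τ : Θ → ℝ) (p : ℕ) (G : Θ → Fin m → (Y →L[ℝ] Y)) :
    Prop :=
  ∃ g : ℕ → Θ → (Y →L[ℝ] Y), (∀ e < p, g e =O[⊤] fun _ => (1 : ℝ)) ∧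
    ∀ l, (fun θ => G θ l - ∑ e ∈ Finset.range p, (M.c l * τ θ) ^ e • g e θ) =O[⊤]
      fun θ => τ θ ^ p

theorem HasNodeExpansion.isBigO (hτ : ∀ θ, 0 < τ θ) (hτ1 : ∀ θ, τ θ ≤ 1) {p : ℕ}
    {G : Θ → Fin m → (Y →L[ℝ] Y)} (hG : HasNodeExpansion M τ p G) (l : Fin m) :
    (fun θ => G θ l) =O[⊤] fun _ => (1 : ℝ) := by
  obtain ⟨g, hg, hrem⟩ := hG
  have h1 : (fun θ => ∑ e ∈ Finset.range p, (M.c l * τ θ) ^ e • g e θ) =O[⊤]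
      fun _ => (1 : ℝ) := by
    refine IsBigO.fun_sum fun e he => ?_
    have h2 : (fun θ => (M.c l * τ θ) ^ e) =O[⊤] fun _ => (1 : ℝ) := by
      simp_rw [mul_pow]
      refine IsBigO.const_mul_left ?_ _
      simpa using isBigO_pow_of_le hτ hτ1 (Nat.zero_le e)
    simpa using h2.smul (hg e (Finset.mem_range.1 he))
  have h3 := (hrem l).trans (isBigO_pow_of_le hτ hτ1 (Nat.zero_le p))
  simp only [pow_zero] at h3
  simpa using h3.add h1

/-- Multiplication by operators with node expansions respects the weak smallness conditions. -/
theorem HasNodeExpansion.isBigO_chain (hτ : ∀ θ, 0 < τ θ) (hτ1 : ∀ θ, τ θ ≤ 1) {p : ℕ}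
    {G : Θ → Fin m → (Y →L[ℝ] Y)} (hG : HasNodeExpansion M τ p G) {V : Θ → Fin m → Y}
    (hV : ∀ l, (fun θ => V θ l) =O[⊤] fun _ => (1 : ℝ))
    (hVw : ∀ (k : ℕ) (w : Fin m → ℝ), M.Chain k w →
      (fun θ => ∑ l, w l • V θ l) =O[⊤] fun θ => τ θ ^ (p + 1 - k))
    {k : ℕ} {w : Fin m → ℝ} (hw : M.Chain k w) :
    (fun θ => ∑ l, w l • G θ l (V θ l)) =O[⊤] fun θ => τ θ ^ (p + 1 - k) := by
  obtain ⟨g, hg, hrem⟩ := hG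
  have hpow : ∀ e, M.Chain (k + e) fun l => w l * M.c l ^ e := by
    intro e
    induction e with
    | zero => simpa using hw
    | succ e ih =>
      have := ih.node
      simp only [mul_assoc, ← pow_succ] at this
      exact this
  -- The expansion coefficients of G do not depend on the stage, so they leave the sum over l. The
  -- powers of c_l that remain turn w into a chain of weight k + e, compensated by the factor τ^e.
  have e1 : ∀ θ, ∑ l, w l • G θ l (V θ l) =
      ∑ l, w l • (G θ l - ∑ e ∈ Finset.range p, (M.c l * τ θ) ^ e • g e θ) (V θ l) +
        ∑ e ∈ Finset.range p, τ θ ^ e • g e θ (∑ l, (w l * M.c l ^ e) • V θ l) := by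
    intro θ
    have e2 : ∑ e ∈ Finset.range p, τ θ ^ e • g e θ (∑ l, (w l * M.c l ^ e) • V θ l) =
        ∑ l, w l • (∑ e ∈ Finset.range p, (M.c l * τ θ) ^ e • g e θ) (V θ l) := by
      simp_rw [map_sum, map_smul, Finset.smul_sum, sum_apply, smul_apply]
      rw [Finset.sum_comm]
      refine Finset.sum_congr rfl fun l _ => ?_
      rw [Finset.smul_sum]
      refine Finset.sum_congr rfl fun e _ => ?_
      rw [smul_smul, smul_smul]
      congr 1
      ring
    rw [e2, ← Finset.sum_add_distrib]
    refine Finset.sum_congr rfl fun l _ => ?_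
    rw [← smul_add, ← add_apply, sub_add_cancel]
  simp_rw [e1]
  refine IsBigO.add ?_ ?_
  · refine IsBigO.fun_sum fun l _ => IsBigO.const_smul_left ?_ _
    have h1 := isBigO_clm_apply (hrem l) (hV l)
    simp only [mul_one] at h1
    exact h1.trans (isBigO_pow_of_le hτ hτ1 (by have := hw.one_le; omega))
  · refine IsBigO.fun_sum fun e he => ?_
    have h1 := isBigO_clm_apply (hg e (Finset.mem_range.1 he)) (hVw _ _ (hpow e))
    simp only [one_mul] at h1
    have h2 := (isBigO_refl (fun θ => τ θ ^ e) ⊤).smul h1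
    simp only [smul_eq_mul, ← pow_add] at h2
    exact h2.trans (isBigO_pow_of_le hτ hτ1 (by omega))

/-- Size of the stage corrections, and of their sums against chains. -/
theorem isBigO_stageCorr (hτ : ∀ θ, 0 < τ θ) (hτ1 : ∀ θ, τ θ ≤ 1) {p q r : ℕ} (hq : 1 ≤ q)
    (horder : M.HasClassicalOrder p) {G : Θ → ℕ → Fin m → (Y →L[ℝ] Y)}
    (hG : ∀ i, 1 ≤ i → i ≤ r → HasNodeExpansion M τ p fun θ => G θ i)
    {δ : Θ → ℕ → Fin m → Y} {x : ℕ → Θ → Y} (hx : ∀ i < r, x i =O[⊤] fun _ => (1 : ℝ))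
    (hδ : ∀ θ, ∀ i < r, ∀ n, δ θ i n = (τ θ ^ (q + 1 + i) / ((q + i).factorial : ℝ) *
      M.stageDefect (q + 1 + i) n) • x i θ) (i : ℕ) (hi : i ≤ r) :
    (∀ n, (fun θ => M.stageCorr (τ θ) (G θ) (δ θ) i n) =O[⊤] fun θ => τ θ ^ (q + i)) ∧
      ∀ (k : ℕ) (w : Fin m → ℝ), M.Chain k w →
        (fun θ => ∑ n, w n • M.stageCorr (τ θ) (G θ) (δ θ) i n) =O[⊤]
          fun θ => τ θ ^ (p + 1 - k) := by
  induction i with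
  | zero =>
    simp only [stageCorr, Pi.zero_apply, smul_zero, Finset.sum_const_zero]
    exact ⟨fun _ => isBigO_zero _ _, fun _ _ _ => isBigO_zero _ _⟩
  | succ i ih =>
    obtain ⟨ih1, ih2⟩ := ih (by omega)
    have hGi : ∀ l, (fun θ => G θ i l (M.stageCorr (τ θ) (G θ) (δ θ) i l)) =O[⊤]
        fun θ => τ θ ^ (q + i) := by
      intro l
      rcases Nat.eq_zero_or_pos i with rfl | h0
      · simp only [stageCorr, Pi.zero_apply, map_zero]
        exact isBigO_zero _ _
      · simpa using isBigO_clm_apply ((hG i h0 (by omega)).isBigO hτ hτ1 l) (ih1 l)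
    have hGw : ∀ (k : ℕ) (w : Fin m → ℝ), M.Chain k w →
        (fun θ => ∑ l, w l • G θ i l (M.stageCorr (τ θ) (G θ) (δ θ) i l)) =O[⊤]
          fun θ => τ θ ^ (p + 1 - k) := by
      intro k w hw
      rcases Nat.eq_zero_or_pos i with rfl | h0
      · simp only [stageCorr, Pi.zero_apply, map_zero, smul_zero, Finset.sum_const_zero]
        exact isBigO_zero _ _
      · refine (hG i h0 (by omega)).isBigO_chain hτ hτ1 (fun l => ?_) ih2 hw
        simpa using (ih1 l).trans (isBigO_pow_of_le hτ hτ1 (Nat.zero_le _))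
    have hτs : ∀ {Z : Θ → Y} {a : ℕ}, Z =O[⊤] (fun θ => τ θ ^ a) →
        (fun θ => τ θ • Z θ) =O[⊤] fun θ => τ θ ^ (a + 1) := by
      intro Z a hZ
      have := (isBigO_refl τ ⊤).smul hZ
      simpa only [smul_eq_mul, ← pow_succ'] using this
    have hcoef : ∀ κ : ℝ, (fun θ => (τ θ ^ (q + 1 + i) / ((q + i).factorial : ℝ) * κ) • x i θ)
        =O[⊤] fun θ => τ θ ^ (q + 1 + i) := by
      intro κ
      have h1 : (fun θ => τ θ ^ (q + 1 + i) / ((q + i).factorial : ℝ) * κ) =O[⊤]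
          fun θ => τ θ ^ (q + 1 + i) := by
        have : ∀ θ, τ θ ^ (q + 1 + i) / ((q + i).factorial : ℝ) * κ =
            (κ / ((q + i).factorial : ℝ)) * τ θ ^ (q + 1 + i) := fun θ => by ring
        simp_rw [this]
        exact (isBigO_refl _ _).const_mul_left _
      simpa using h1.smul (hx i (by omega))
    refine ⟨fun n => ?_, fun k w hw => ?_⟩
    · simp only [stageCorr]
      simp_rw [hδ _ i (by omega : i < r)]
      rw [show q + (i + 1) = q + i + 1 by ring]
      refine IsBigO.add ?_ (hτs (IsBigO.fun_sum fun l _ => (hGi l).const_smul_left _))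
      rw [show q + i + 1 = q + 1 + i by ring]
      exact hcoef _
    · have e1 : ∀ θ, ∑ n, w n • M.stageCorr (τ θ) (G θ) (δ θ) (i + 1) n =
          (τ θ ^ (q + 1 + i) / ((q + i).factorial : ℝ) *
            ∑ n, w n * M.stageDefect (q + 1 + i) n) • x i θ +
          τ θ • ∑ l, (∑ n, w n * M.a n l) • G θ i l (M.stageCorr (τ θ) (G θ) (δ θ) i l) := by
        intro θ
        simp only [stageCorr, smul_add, Finset.sum_add_distrib]
        congr 1
        · rw [Finset.mul_sum, Finset.sum_smul]
          refine Finset.sum_congr rfl fun n _ => ?_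
          rw [hδ _ i (by omega : i < r), smul_smul]
          congr 1
          ring
        · simp_rw [Finset.smul_sum, Finset.sum_smul, Finset.smul_sum]
          rw [Finset.sum_comm]
          refine Finset.sum_congr rfl fun l _ => Finset.sum_congr rfl fun n _ => ?_
          rw [smul_smul, smul_smul, smul_smul]
          congr 1
          ring
      simp_rw [e1]
      refine IsBigO.add ?_ ?_
      -- In this range the order condition makes the sum of defects vanish; otherwise τ^(q+1+i) is
      -- already small enough.
      · by_cases hk : q + 1 + i + k ≤ p
        · have := hw.order_condition horder (j := q + 1 + i) (by omega) hk
          simp only [stageDefect, this, mul_zero, zero_smul]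
          exact isBigO_zero _ _
        · exact (hcoef _).trans (isBigO_pow_of_le hτ hτ1 (by omega))
      · have h1 := hτs (hGw _ _ hw.coeff)
        exact h1.trans (isBigO_pow_of_le hτ hτ1 (by omega))

end RungeKutta
end Kato
end

/-! ### Consistency: corrected stages with defects of order p + 1 in `Y`. -/

open scoped ContDiff Topology Matrix
noncomputable section
namespace Kato

open Asymptotics

section Polynomials

variable {E : Type*} [NormedAddCommGroup E] [NormedSpace ℝ E]

theorem norm_taylorPoly_sub_le {v : ℕ → E} {K : ℝ} (hv : ∀ k, ‖v k‖ ≤ K) (q r : ℕ) {s : ℝ}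
    (hs : |s| ≤ 1) : ‖taylorPoly v (q + r) s - taylorPoly v q s‖ ≤ r * K * |s| ^ (q + 1) := by
  have hK : 0 ≤ K := (norm_nonneg _).trans (hv 0)
  induction r with
  | zero => simp
  | succ r ih =>
    rw [← add_assoc, taylorPoly_succ, add_sub_right_comm]
    refine (norm_add_le _ _).trans ?_
    have h1 : ‖(s ^ (q + r + 1) / ((q + r + 1).factorial : ℝ)) • v (q + r + 1)‖ ≤
        K * |s| ^ (q + 1) := by
      rw [norm_smul, norm_div, norm_pow, Real.norm_eq_abs, Real.norm_natCast, mul_comm]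
      refine mul_le_mul (hv _) ?_ (by positivity) hK
      refine (div_le_self (by positivity) ?_).trans
        (pow_le_pow_of_le_one (abs_nonneg _) hs (by omega))
      exact_mod_cast Nat.factorial_pos _
    push_cast
    linarith

theorem taylorPoly_map {F : Type*} [NormedAddCommGroup F] [NormedSpace ℝ F] (L : E →L[ℝ] F)
    {v : ℕ → E} {w : ℕ → F} {n : ℕ} (h : ∀ k ≤ n, L (v k) = w k) (s : ℝ) :
    L (taylorPoly v n s) = taylorPoly w n s := by
  rw [taylorPoly, taylorPoly, map_sum]
  refine Finset.sum_congr rfl fun k hk => ?_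
  rw [map_smul, h k (by have := Finset.mem_range.1 hk; omega)]

variable {m : ℕ} {M : RungeKutta m}

theorem RungeKutta.weighted_taylorPoly {p : ℕ} (hp : 1 ≤ p) (w : Fin m → ℝ) (d : ℕ → E) (τ : ℝ) :
    τ • ∑ l, w l • taylorPoly (fun k => d (k + 1)) (p - 1) (M.c l * τ) =
      ∑ k ∈ Finset.range p, (τ ^ (k + 1) / (k.factorial : ℝ) * ∑ l, w l * M.c l ^ k) •
        d (k + 1) := by
  have hp1 : p - 1 + 1 = p := by omega
  simp_rw [taylorPoly, hp1, Finset.smul_sum]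
  rw [Finset.sum_comm]
  refine Finset.sum_congr rfl fun k _ => ?_
  rw [Finset.mul_sum, Finset.sum_smul]
  refine Finset.sum_congr rfl fun l _ => ?_
  rw [smul_smul, smul_smul]
  congr 1
  ring

theorem taylorPoly_eq_add (d : ℕ → E) (p : ℕ) (s : ℝ) : taylorPoly d p s =
    d 0 + ∑ k ∈ Finset.range p, (s ^ (k + 1) / ((k + 1).factorial : ℝ)) • d (k + 1) := by
  rw [taylorPoly, Finset.sum_range_succ', add_comm]
  simp

/-- Compare coefficients of powers of τ: stage order q removes the quadrature defects of degree at
most q, so exactly r of them remain. -/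
theorem RungeKutta.taylorPoly_stage {p q r : ℕ} (hpqr : q + r = p) (hp : 1 ≤ p)
    (hstage : M.HasStageOrder q) (d : ℕ → E) (τ : ℝ) (n : Fin m) :
    taylorPoly d p (M.c n * τ) + ∑ i ∈ Finset.range r,
      (τ ^ (q + 1 + i) / ((q + i).factorial : ℝ) * M.stageDefect (q + 1 + i) n) •
        d (q + 1 + i) =
      d 0 + τ • ∑ l, M.a n l • taylorPoly (fun k => d (k + 1)) (p - 1) (M.c l * τ) := by
  have hsd : ∀ k, k < q → M.stageDefect (k + 1) n = 0 := fun k hk => by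
    rw [stageDefect, hstage (k + 1) (by omega) (by omega) n, sub_self]
  have e1 : ∑ i ∈ Finset.range r,
      (τ ^ (q + 1 + i) / ((q + i).factorial : ℝ) * M.stageDefect (q + 1 + i) n) •
        d (q + 1 + i) = ∑ k ∈ Finset.range p,
      (τ ^ (k + 1) / (k.factorial : ℝ) * M.stageDefect (k + 1) n) • d (k + 1) := by
    have h0 : ∑ k ∈ Finset.range q,
        (τ ^ (k + 1) / (k.factorial : ℝ) * M.stageDefect (k + 1) n) • d (k + 1) = 0 :=
      Finset.sum_eq_zero fun k hk => by rw [hsd k (Finset.mem_range.1 hk), mul_zero, zero_smul]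
    rw [← hpqr, Finset.sum_range_add, h0, zero_add]
    refine Finset.sum_congr rfl fun i _ => ?_
    rw [show q + 1 + i = q + i + 1 by ring]
  rw [e1, RungeKutta.weighted_taylorPoly hp, taylorPoly_eq_add, add_assoc,
    ← Finset.sum_add_distrib]
  congr 1
  refine Finset.sum_congr rfl fun k _ => ?_
  rw [← add_smul, stageDefect, Nat.factorial_succ, Nat.add_sub_cancel]
  congr 1
  have : (k.factorial : ℝ) ≠ 0 := by positivity
  have : (k + 1 : ℝ) ≠ 0 := by positivity
  push_cast
  field_simp
  ring

theorem RungeKutta.taylorPoly_update {p : ℕ} (hp : 1 ≤ p) (horder : M.HasClassicalOrder p)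
    (d : ℕ → E) (τ : ℝ) : taylorPoly d p τ =
      d 0 + τ • ∑ l, M.b l • taylorPoly (fun k => d (k + 1)) (p - 1) (M.c l * τ) := by
  rw [RungeKutta.weighted_taylorPoly hp, taylorPoly_eq_add]
  congr 1
  refine Finset.sum_congr rfl fun k hk => ?_
  have := RungeKutta.quadrature_condition horder (k := k + 1) (by omega)
    (by have := Finset.mem_range.1 hk; omega)
  rw [Nat.add_sub_cancel] at this
  rw [this, Nat.factorial_succ]
  congr 1
  have : (k.factorial : ℝ) ≠ 0 := by positivity
  have : (k + 1 : ℝ) ≠ 0 := by positivity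
  push_cast
  field_simp

end Polynomials

variable {X Y : Type*}
  [NormedAddCommGroup X] [InnerProductSpace ℝ X]
  [NormedAddCommGroup Y] [InnerProductSpace ℝ Y]
  {ι : Y →L[ℝ] X} {S : Y ≃ₗᵢ[ℝ] X} {A : Y → (X →ₗ.[ℝ] X)} {B : ℕ → Y → (X →L[ℝ] X)}
  {AY : Y → (Y →L[ℝ] X)} {m : ℕ} {M : RungeKutta m}

/-- Both sides have the same image under the injective S⁻¹, namely the derivative of u itself. -/
theorem IsJet.pow_succ_eq (hι : IsDenseEmbedding ι) {h : Y → Y} {p r : ℕ} {T : ℝ} {u : ℝ → Y}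
    {D : ℕ → ℕ → ℝ → Y} {K : ℝ} (hD : IsJet ι S h p r T u D K) {j k : ℕ} (hj : j + 1 ≤ r)
    (hk : k ≤ p) (hjk : k + (j + 1) ≤ p + 1) {t : ℝ} (ht : t ∈ Set.Icc 0 T) :
    (invOnY ι S ^ j) (D (j + 1) k t) = D 1 k t := by
  have h1 := hD.pow (j + 1) k hj hk hjk t ht
  have h2 := hD.pow 1 k (by omega) hk (by omega) t ht
  rw [← h2, pow_succ', pow_one, mul_apply_eq_comp] at h1
  exact S.symm.injective.comp hι.injective |>.eq_iff.1 (by simpa using h1)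

/-- Uniform node expansions of the linearizations along the Taylor polynomials. -/
theorem hasNodeExpansion_fderiv {Θ : Type*} {τ : Θ → ℝ} {h : Y → Y}
    (hh : SmoothLocallyBounded h) (p q : ℕ) {K : ℝ} {v : Θ → ℕ → Y} (hv : ∀ θ k, ‖v θ k‖ ≤ K)
    (hc : ∀ θ l, |M.c l * τ θ| ≤ 1) :
    M.HasNodeExpansion τ p fun θ l => fderiv ℝ h (taylorPoly (v θ) q (M.c l * τ θ)) := by
  obtain ⟨C, hC0, hC⟩ := hh.fderiv.exists_expansion q p K
  choose a ha1 ha2 using fun θ => hC (v θ) (hv θ)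
  refine ⟨fun e θ => a θ e, fun e he => isBigO_top.2 ⟨C, fun θ => ?_⟩, fun l =>
    isBigO_top.2 ⟨C * |M.c l| ^ p, fun θ => ?_⟩⟩
  · simpa using ha1 θ e he.le
  · refine (ha2 θ _ (hc θ l)).trans_eq ?_
    rw [abs_mul, mul_pow, norm_pow, Real.norm_eq_abs, mul_assoc]

/-- Consistency: stages near the exact solution that satisfy the equations of the method up to
defects of order `p + 1` in `Y`. -/
theorem exists_consistent_stages (hι : IsDenseEmbedding ι) {p q : ℕ} (hqp : q < p)
    (hpq : p ≤ 2 * q) (hstage : M.HasStageOrder q) (horder : M.HasClassicalOrder p)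
    (hB : ∀ k : ℕ, 1 ≤ k → k ≤ p - q → Commutator ι S k A (B k))
    (hAY : ∀ y w, (ι w, AY y w) ∈ (A y).graph) (hAYs : SmoothLocallyBounded AY)
    (hBs : ∀ k : ℕ, 1 ≤ k → k ≤ p - q → SmoothLocallyBounded (B k)) {T : ℝ} (hT : 0 < T)
    {u : ℝ → Y} (hu : IsSolution ι A T u) (hreg : ContDiffOn ℝ (p + 1 : ℕ) u (Set.Icc 0 T))
    (hregS : ∀ k : ℕ, 1 ≤ k → k ≤ p - q → PowRegular ι S T u k (p + 1 - k)) :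
    ∃ C τ₀ : ℝ, 0 ≤ C ∧ 0 < τ₀ ∧ ∀ t τ : ℝ, 0 ≤ t → 0 < τ → τ ≤ τ₀ → t + τ ≤ T →
      ∃ v F : Fin m → Y, (∀ i, ι (F i) = -(AY (invOnY ι S (v i)) (invOnY ι S (v i)))) ∧
        (∀ i, ‖v i‖ ≤ C) ∧
        (∀ i, ‖invOnY ι S (v i) - (u t + τ • ∑ j, M.a i j • F j)‖ ≤ C * τ ^ (p + 1)) ∧
        ‖u (t + τ) - (u t + τ • ∑ i, M.b i • F i)‖ ≤ C * τ ^ (p + 1) := by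
  set r := p - q with hr
  have hpqr : q + r = p := by omega
  have hr1 : 1 ≤ r := by omega
  have hp1 : 1 ≤ p := by omega
  have hB₁ := hB 1 le_rfl hr1
  have hH : ∀ j, 1 ≤ j → j ≤ r → SmoothLocallyBounded (conjField ι S AY B j) :=
    fun j h1 h2 => smoothLocallyBounded_conjField hAYs (hBs j h1 h2)
  set h₁ := conjField ι S AY B 1 with hh₁
  have hH₁ : SmoothLocallyBounded h₁ := hH 1 le_rfl hr1
  obtain ⟨D, K, hD⟩ := exists_isJet hι hp1 hr1 hB₁ hAY hH₁ hT hu hreg hregS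
  have hK : 0 ≤ K := (norm_nonneg _).trans (hD.bound 0 0 0 ⟨le_rfl, hT.le⟩)
  set τ₁ := 1 / (1 + ∑ l, |M.c l|) with hτ₁
  have hcs : 0 ≤ ∑ l, |M.c l| := Finset.sum_nonneg fun _ _ => abs_nonneg _
  have hτ₁0 : 0 < τ₁ := by positivity
  have hτ₁1 : τ₁ ≤ 1 := by
    rw [hτ₁, div_le_one (by positivity)]; linarith
  -- Estimates `=O[⊤]` over this type are bounds uniform in all admissible pairs (t, τ). The bound
  -- τ₁ ensures τ ≤ 1 and |c_l τ| ≤ 1.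
  let Θ := {x : ℝ × ℝ // x.1 ∈ Set.Icc 0 T ∧ 0 < x.2 ∧ x.2 ≤ τ₁ ∧ x.1 + x.2 ≤ T}
  let t : Θ → ℝ := fun θ => θ.1.1
  let τ : Θ → ℝ := fun θ => θ.1.2
  have ht : ∀ θ, t θ ∈ Set.Icc 0 T := fun θ => θ.2.1
  have hτ : ∀ θ, 0 < τ θ := fun θ => θ.2.2.1
  have hτ1 : ∀ θ, τ θ ≤ 1 := fun θ => θ.2.2.2.1.trans hτ₁1
  have hc : ∀ θ l, |M.c l * τ θ| ≤ 1 := by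
    intro θ l
    rw [abs_mul, abs_of_pos (hτ θ)]
    calc |M.c l| * τ θ ≤ (1 + ∑ l, |M.c l|) * τ₁ := by
          refine mul_le_mul ?_ θ.2.2.2.1 (hτ θ).le (by positivity)
          have := Finset.single_le_sum (f := fun l => |M.c l|) (fun _ _ => abs_nonneg _)
            (Finset.mem_univ l)
          linarith
      _ = 1 := by rw [hτ₁]; field_simp
  let R : Y →L[ℝ] Y := invOnY ι S
  -- At level i the field conjugated with S^(r+1-i) is linearized. The base polynomial has degree q
  -- only, since at this level the derivatives of higher order may be unavailable; for δ below, the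
  -- derivative order and the power of S add up to exactly p + 1.
  let G : Θ → ℕ → Fin m → (Y →L[ℝ] Y) := fun θ i l =>
    fderiv ℝ (conjField ι S AY B (r + 1 - i))
      (taylorPoly (fun k => D (r + 1 - i) k (t θ)) q (M.c l * τ θ))
  let δ : Θ → ℕ → Fin m → Y := fun θ i n =>
    (τ θ ^ (q + 1 + i) / ((q + i).factorial : ℝ) * M.stageDefect (q + 1 + i) n) •
      D (r - i) (q + 1 + i) (t θ)
  let V : Θ → ℕ → Fin m → Y := fun θ => M.stageCorr (τ θ) (G θ) (δ θ)
  let W : Θ → ℕ → Fin m → Y := fun θ i l => G θ i l (V θ i l)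
  have hG : ∀ i, 1 ≤ i → i ≤ r → M.HasNodeExpansion τ p fun θ => G θ i := fun i h1 h2 =>
    hasNodeExpansion_fderiv (hH _ (by omega) (by omega)) p q
      (fun θ k => hD.bound _ _ _ (ht θ)) hc
  have hDO : ∀ j k, (fun θ => D j k (t θ)) =O[⊤] fun _ => (1 : ℝ) := fun j k =>
    isBigO_top.2 ⟨K, fun θ => by simpa using hD.bound j k _ (ht θ)⟩
  have hV : ∀ i ≤ r, (∀ n, (fun θ => V θ i n) =O[⊤] fun θ => τ θ ^ (q + i)) ∧
      ∀ (k : ℕ) (w : Fin m → ℝ), M.Chain k w →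
        (fun θ => ∑ n, w n • V θ i n) =O[⊤] fun θ => τ θ ^ (p + 1 - k) := fun i hi =>
    RungeKutta.isBigO_stageCorr hτ hτ1 (by omega) horder hG
      (x := fun i θ => D (r - i) (q + 1 + i) (t θ)) (fun i _ => hDO _ _)
      (fun θ i _ n => rfl) i hi
  have hW : ∀ i, 1 ≤ i → i ≤ r → ∀ l, (fun θ => W θ i l) =O[⊤] fun θ => τ θ ^ (q + i) := by
    intro i h1 h2 l
    simpa using isBigO_clm_apply ((hG i h1 h2).isBigO hτ hτ1 l) ((hV i h2).1 l)
  have hWb : ∀ i, 1 ≤ i → i ≤ r → (fun θ => ∑ l, M.b l • W θ i l) =O[⊤] fun θ => τ θ ^ p := by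
    intro i h1 h2
    have := (hG i h1 h2).isBigO_chain hτ hτ1
      (fun l => by simpa using ((hV i h2).1 l).trans (isBigO_pow_of_le hτ hτ1 (Nat.zero_le _)))
      (hV i h2).2 RungeKutta.Chain.base
    simpa using this
  -- the sum of the corrections, multiplied by `S`
  let e : Θ → Fin m → Y := fun θ n => ∑ i ∈ Finset.range r, (R ^ (r - (i + 1))) (V θ (i + 1) n)
  have he : ∀ n, (fun θ => e θ n) =O[⊤] fun θ => τ θ ^ (q + 1) := by
    intro n
    refine IsBigO.fun_sum fun i hi => ?_
    have hi := Finset.mem_range.1 hi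
    exact ((R ^ (r - (i + 1))).isBigO_comp _ _).trans
      (((hV (i + 1) (by omega)).1 n).trans (isBigO_pow_of_le hτ hτ1 (by omega)))
  let P : Θ → Fin m → Y := fun θ n => taylorPoly (fun k => D 1 k (t θ)) p (M.c n * τ θ)
  let Pq : Θ → Fin m → Y := fun θ n => taylorPoly (fun k => D 1 k (t θ)) q (M.c n * τ θ)
  let P' : Θ → Fin m → Y := fun θ n =>
    taylorPoly (fun k => D 0 (k + 1) (t θ)) (p - 1) (M.c n * τ θ)
  let v : Θ → Fin m → Y := fun θ n => P θ n + e θ n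
  have hPb : ∀ θ n, ‖P θ n‖ ≤ (p + 1 : ℕ) * K := fun θ n =>
    norm_taylorPoly_le (fun k => hD.bound 1 k _ (ht θ)) p (hc θ n)
  have hPqb : ∀ θ n, ‖Pq θ n‖ ≤ (p + 1 : ℕ) * K := fun θ n => by
    refine (norm_taylorPoly_le (fun k => hD.bound 1 k _ (ht θ)) q (hc θ n)).trans ?_
    gcongr
  obtain ⟨Ce, hCe0, hCe⟩ : ∃ Ce : ℝ, 0 ≤ Ce ∧ ∀ θ n, ‖e θ n‖ ≤ Ce * τ θ ^ (q + 1) := by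
    choose Ce hCe using fun n => isBigO_top.1 (he n)
    refine ⟨∑ n, |Ce n|, Finset.sum_nonneg fun _ _ => abs_nonneg _, fun θ n => ?_⟩
    refine (hCe n θ).trans ?_
    rw [norm_pow, Real.norm_of_nonneg (hτ θ).le]
    refine mul_le_mul_of_nonneg_right ?_ (pow_nonneg (hτ θ).le _)
    exact (le_abs_self _).trans (Finset.single_le_sum (f := fun n => |Ce n|)
      (fun _ _ => abs_nonneg _) (Finset.mem_univ n))
  have hepow : ∀ θ, τ θ ^ (q + 1) ≤ 1 := fun θ => pow_le_one₀ (hτ θ).le (hτ1 θ)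
  set ρ := (p + 1 : ℕ) * K + Ce
  have hvb : ∀ θ n, ‖v θ n‖ ≤ ρ := fun θ n =>
    (norm_add_le _ _).trans (add_le_add (hPb θ n)
      ((hCe θ n).trans (mul_le_of_le_one_right hCe0 (hepow θ))))
  have hPρ : ∀ θ n, ‖P θ n‖ ≤ ρ := fun θ n => (hPb θ n).trans (by simp only [ρ]; linarith)
  have hPqρ : ∀ θ n, ‖Pq θ n‖ ≤ ρ := fun θ n => (hPqb θ n).trans (by simp only [ρ]; linarith)
  -- Lowered by the intertwining relation, the linearizations at all levels become the same
  -- operator, so their sum is one derivative applied to the total correction.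
  have hlin : ∀ θ n, ∑ i ∈ Finset.range r, (R ^ (r - (i + 1))) (W θ (i + 1) n) =
      fderiv ℝ h₁ (Pq θ n) (e θ n) := by
    intro θ n
    rw [map_sum]
    refine Finset.sum_congr rfl fun i hi => ?_
    have hi := Finset.mem_range.1 hi
    have hj : r + 1 - (i + 1) = r - (i + 1) + 1 := by omega
    simp only [W, G]
    rw [hj, invOnY_pow_fderiv_conjField hι (hB _ (by omega) (by omega)) hB₁ hAY
      ((hH _ (by omega) (by omega)).1.differentiable (by simp))
      (hH₁.1.differentiable (by simp)), taylorPoly_map (invOnY ι S ^ (r - (i + 1)))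
      (w := fun k => D 1 k (t θ))]
    intro k hk
    exact hD.pow_succ_eq hι (by omega) (by omega) (by omega) (ht θ)
  -- the remainder of the linearization
  let rem : Θ → Fin m → Y := fun θ n =>
    h₁ (v θ n) - P' θ n - ∑ i ∈ Finset.range r, (R ^ (r - (i + 1))) (W θ (i + 1) n)
  obtain ⟨CQ, hCQ0, hCQ⟩ := hH₁.exists_quadratic ρ
  obtain ⟨CL, hCL0, hCL⟩ := hH₁.fderiv.exists_lipschitz ρ
  have hrem : ∀ n, (fun θ => rem θ n) =O[⊤] fun θ => τ θ ^ p := by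
    intro n
    have e1 : ∀ θ, rem θ n = (h₁ (v θ n) - h₁ (P θ n) - fderiv ℝ h₁ (P θ n) (v θ n - P θ n)) +
        (h₁ (P θ n) - P' θ n) + (fderiv ℝ h₁ (P θ n) - fderiv ℝ h₁ (Pq θ n)) (e θ n) := by
      intro θ
      simp only [rem, hlin, v, add_sub_cancel_left, sub_apply]
      abel
    simp_rw [e1]
    -- The three errors are the quadratic remainder in e, the residual of the Taylor polynomial, and
    -- the shift of the linearization point from degree p to degree q. The first and third are
    -- O(τ^(2q+2)), and p ≤ 2q.
    refine (IsBigO.add ?_ ?_).add ?_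
    · refine IsBigO.trans (g := fun θ => τ θ ^ (2 * (q + 1))) (isBigO_top.2
        ⟨CQ * Ce ^ 2, fun θ => ?_⟩) (isBigO_pow_of_le hτ hτ1 (by omega))
      refine (hCQ _ _ (hvb θ n) (hPρ θ n)).trans ?_
      simp only [v, add_sub_cancel_left]
      rw [norm_pow, Real.norm_of_nonneg (hτ θ).le, mul_comm 2, pow_mul, mul_assoc, ← mul_pow]
      gcongr
      exact hCe θ n
    · refine isBigO_top.2 ⟨K * |M.c n| ^ p, fun θ => ?_⟩
      refine (hD.field (t θ) (ht θ) _ (hc θ n)).trans_eq ?_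
      rw [abs_mul, mul_pow, norm_pow, Real.norm_eq_abs, mul_assoc]
    · refine IsBigO.trans (g := fun θ => τ θ ^ (q + 1) * τ θ ^ (q + 1))
        (isBigO_clm_apply ?_ (he n)) ?_
      · refine isBigO_top.2 ⟨CL * (r * K * |M.c n| ^ (q + 1)), fun θ => ?_⟩
        refine (hCL _ _ (hPρ θ n) (hPqρ θ n)).trans ?_
        rw [mul_assoc]
        refine mul_le_mul_of_nonneg_left ?_ hCL0
        have := norm_taylorPoly_sub_le (fun k => hD.bound 1 k _ (ht θ)) q r (hc θ n)
        rw [hpqr] at this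
        refine this.trans_eq ?_
        rw [abs_mul, mul_pow, norm_pow, Real.norm_eq_abs]
        ring
      · simp_rw [← pow_add]
        exact isBigO_pow_of_le hτ hτ1 (by omega)
  have hF : ∀ θ n, h₁ (v θ n) = P' θ n +
      ∑ i ∈ Finset.range r, (R ^ (r - (i + 1))) (W θ (i + 1) n) + rem θ n := by
    intro θ n
    simp only [rem]
    abel
  have hzero : ∀ θ, D 0 0 (t θ) = u (t θ) := fun θ => hD.zero _ (ht θ)
  -- the defects of the stages and of the update
  have hdef : ∀ θ n, R (v θ n) - (u (t θ) + τ θ • ∑ l, M.a n l • h₁ (v θ l)) =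
      -(τ θ • ∑ l, M.a n l • (W θ r l + rem θ l)) := by
    intro θ n
    have e1 : R (P θ n) = taylorPoly (fun k => D 0 k (t θ)) p (M.c n * τ θ) := by
      refine taylorPoly_map R (fun k hk => ?_) _
      have := hD.pow 1 k hr1 hk (by omega) _ (ht θ)
      rwa [pow_one] at this
    have e2 : R (e θ n) = ∑ i ∈ Finset.range r,
        (τ θ ^ (q + 1 + i) / ((q + i).factorial : ℝ) * M.stageDefect (q + 1 + i) n) •
          D 0 (q + 1 + i) (t θ) +
        τ θ • ∑ l, M.a n l • ∑ i ∈ Finset.range r, (R ^ (r - i)) (W θ i l) := by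
      have e3 : ∀ i ∈ Finset.range r, R ((R ^ (r - (i + 1))) (V θ (i + 1) n)) =
          (τ θ ^ (q + 1 + i) / ((q + i).factorial : ℝ) * M.stageDefect (q + 1 + i) n) •
            D 0 (q + 1 + i) (t θ) + τ θ • ∑ l, M.a n l • (R ^ (r - i)) (W θ i l) := by
        intro i hi
        have hi := Finset.mem_range.1 hi
        rw [← mul_apply_eq_comp, ← pow_succ', show r - (i + 1) + 1 = r - i by omega]
        have e4 : V θ (i + 1) n = δ θ i n + τ θ • ∑ l, M.a n l • W θ i l := rfl
        rw [e4, map_add]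
        simp only [δ, map_smul, map_sum]
        congr 2
        exact hD.pow _ _ (by omega) (by omega) (by omega) _ (ht θ)
      simp only [e, map_sum]
      rw [Finset.sum_congr rfl e3, Finset.sum_add_distrib, ← Finset.smul_sum, Finset.sum_comm]
      simp_rw [Finset.smul_sum]
    have e5 := RungeKutta.taylorPoly_stage hpqr hp1 hstage (fun k => D 0 k (t θ)) (τ θ) n
    -- The sum produced by the recursion is the linearization shifted by one index. Since W at index
    -- 0 vanishes, only the last term is left over, and it has size τ^(q+r) = τ^p.
    have e6 : ∀ l, ∑ i ∈ Finset.range r, (R ^ (r - i)) (W θ i l) =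
        ∑ i ∈ Finset.range r, (R ^ (r - (i + 1))) (W θ (i + 1) l) - W θ r l := by
      intro l
      have h1 := Finset.sum_range_sub' (fun i => (R ^ (r - i)) (W θ i l)) r
      rw [Finset.sum_sub_distrib] at h1
      have h0 : W θ 0 l = 0 := by simp [W, V, RungeKutta.stageCorr]
      simp only [h0, map_zero, Nat.sub_self, pow_zero, one_apply_eq_self, zero_sub] at h1
      rw [sub_eq_iff_eq_add] at h1
      rw [h1]
      abel
    have e7 : R (v θ n) = taylorPoly (fun k => D 0 k (t θ)) p (M.c n * τ θ) + R (e θ n) := by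
      simp only [v, map_add, e1]
    rw [e7, e2, ← add_assoc, e5, hzero]
    simp_rw [hF, e6, smul_add, smul_sub, Finset.sum_add_distrib, Finset.sum_sub_distrib, smul_add,
      smul_sub]
    simp only [P']
    abel
  have hupd : ∀ θ, u (t θ + τ θ) - (u (t θ) + τ θ • ∑ l, M.b l • h₁ (v θ l)) =
      (u (t θ + τ θ) - taylorPoly (fun k => D 0 k (t θ)) p (τ θ)) -
        τ θ • (∑ i ∈ Finset.range r, (R ^ (r - (i + 1))) (∑ l, M.b l • W θ (i + 1) l) +
          ∑ l, M.b l • rem θ l) := by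
    intro θ
    rw [RungeKutta.taylorPoly_update hp1 horder (fun k => D 0 k (t θ)) (τ θ), hzero]
    have e1 : ∑ i ∈ Finset.range r, (R ^ (r - (i + 1))) (∑ l, M.b l • W θ (i + 1) l) =
        ∑ l, M.b l • ∑ i ∈ Finset.range r, (R ^ (r - (i + 1))) (W θ (i + 1) l) := by
      simp_rw [map_sum, map_smul, Finset.smul_sum]
      exact Finset.sum_comm
    rw [e1]
    simp_rw [hF, smul_add, Finset.sum_add_distrib, smul_add]
    simp only [P']
    abel
  have hτs : ∀ {Z : Θ → Y}, Z =O[⊤] (fun θ => τ θ ^ p) →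
      (fun θ => τ θ • Z θ) =O[⊤] fun θ => τ θ ^ (p + 1) := by
    intro Z hZ
    have := (isBigO_refl τ ⊤).smul hZ
    simpa only [smul_eq_mul, ← pow_succ'] using this
  have hdefO : ∀ n, (fun θ => R (v θ n) - (u (t θ) + τ θ • ∑ l, M.a n l • h₁ (v θ l))) =O[⊤]
      fun θ => τ θ ^ (p + 1) := by
    intro n
    simp_rw [hdef]
    refine IsBigO.neg_left (hτs (IsBigO.fun_sum fun l _ => IsBigO.const_smul_left ?_ _))
    have := hW r hr1 le_rfl l
    rw [hpqr] at this
    exact this.add (hrem l)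
  have hupdO : (fun θ => u (t θ + τ θ) - (u (t θ) + τ θ • ∑ l, M.b l • h₁ (v θ l))) =O[⊤]
      fun θ => τ θ ^ (p + 1) := by
    simp_rw [hupd]
    refine IsBigO.sub (isBigO_top.2 ⟨K, fun θ => ?_⟩) (hτs (IsBigO.add
      (IsBigO.fun_sum fun i hi => ?_) (IsBigO.fun_sum fun l _ => (hrem l).const_smul_left _)))
    · have := hD.taylor (t θ) (ht θ) (t θ + τ θ)
        ⟨add_nonneg (ht θ).1 (hτ θ).le, θ.2.2.2.2⟩
      rw [add_sub_cancel_left] at this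
      rwa [norm_pow, Real.norm_eq_abs]
    · have hi := Finset.mem_range.1 hi
      exact ((R ^ (r - (i + 1))).isBigO_comp _ _).trans (hWb _ (by omega) (by omega))
  choose Cd hCd using fun n => isBigO_top.1 (hdefO n)
  obtain ⟨Cu, hCu⟩ := isBigO_top.1 hupdO
  have hCd0 : 0 ≤ ∑ n, |Cd n| := Finset.sum_nonneg fun _ _ => abs_nonneg _
  have hρ0 : 0 ≤ ρ := by positivity
  refine ⟨ρ + ∑ n, |Cd n| + |Cu|, τ₁, by positivity, hτ₁0, fun t' τ' ht' hτ' hτ₁' hT' => ?_⟩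
  let θ : Θ := ⟨(t', τ'), ⟨ht', by linarith⟩, hτ', hτ₁', hT'⟩
  refine ⟨v θ, fun n => h₁ (v θ n), fun n => embedding_conjField_one hι hB₁ hAY _, fun n => ?_,
    fun n => ?_, ?_⟩
  · have := abs_nonneg Cu
    exact (hvb θ n).trans (by linarith)
  · refine (hCd n θ).trans ?_
    rw [norm_pow, Real.norm_of_nonneg (hτ θ).le]
    refine mul_le_mul_of_nonneg_right ?_ (pow_nonneg hτ'.le _)
    have h1 := Finset.single_le_sum (f := fun n => |Cd n|) (fun _ _ => abs_nonneg _)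
      (Finset.mem_univ n)
    have h2 := le_abs_self (Cd n)
    have := abs_nonneg Cu
    linarith
  · refine (hCu θ).trans ?_
    rw [norm_pow, Real.norm_of_nonneg (hτ θ).le]
    refine mul_le_mul_of_nonneg_right ?_ (pow_nonneg hτ'.le _)
    have h2 := le_abs_self Cu
    linarith

end Kato
end

/-! ### From one step to the whole time interval. -/

open scoped ContDiff Topology Matrix
noncomputable section
namespace Kato

variable {X Y : Type*}
  [NormedAddCommGroup X] [InnerProductSpace ℝ X]
  [NormedAddCommGroup Y] [InnerProductSpace ℝ Y]
  {ι : Y →L[ℝ] X} {S : Y ≃ₗᵢ[ℝ] X} {A : Y → (X →ₗ.[ℝ] X)} {B : Y → (X →L[ℝ] X)}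
  {m : ℕ} {M : RungeKutta m}

theorem RungeKutta.isNumericalSolution_of_isStep {u₀ : Y} {τ : ℝ} {N : ℕ}
    {u : Fin (N + 1) → Y} {U D : Fin N → Fin m → Y} (h0 : u 0 = u₀)
    (h : ∀ n : Fin N, M.IsStep ι A τ (u n.castSucc) (U n) (D n) (u n.succ)) :
    M.IsNumericalSolution ι A u₀ τ N u U := by
  refine ⟨h0, fun n i => ι (D n i), fun n i => (h n).graph i, fun n i => ?_, fun n => ?_⟩
  · rw [(h n).stage i]
    simp only [map_add, map_smul, map_sum]
  · rw [(h n).update]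
    simp only [map_add, map_smul, map_sum]

/-- Because a is invertible, the stage derivatives are combinations of U_j - u_n divided by τ. They
therefore lie in `Y`, although the equations place them only in `X`. -/
theorem RungeKutta.IsNumericalSolution.exists_isStep (hι : Function.Injective ι)
    (hcoer : M.Coercive) {u₀ : Y} {τ : ℝ} (hτ : τ ≠ 0) {N : ℕ}
    {u : Fin (N + 1) → Y} {U : Fin N → Fin m → Y} (h : M.IsNumericalSolution ι A u₀ τ N u U)
    (n : Fin N) : ∃ D, M.IsStep ι A τ (u n.castSucc) (U n) D (u n.succ) := by
  obtain ⟨-, dU, hg, hs, hu⟩ := h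
  obtain ⟨K, -, -, hK, -⟩ := hcoer.exists_data
  have hD : ∀ i, ι (τ⁻¹ • ∑ j, K i j • (U n j - u n.castSucc)) = dU n i := fun i => by
    have h1 : ∀ j, ι (U n j - u n.castSucc) = τ • ∑ k, M.a j k • dU n k := fun j => by
      rw [map_sub, hs n j, add_sub_cancel_left]
    simp only [map_smul, map_sum, h1]
    simp_rw [smul_comm _ τ]
    rw [← Finset.smul_sum, inv_smul_smul₀ hτ, sum_smul_sum_smul hK]
  refine ⟨fun i => τ⁻¹ • ∑ j, K i j • (U n j - u n.castSucc), fun i => ?_, fun i => hι ?_, hι ?_⟩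
  · rw [hD]
    exact hg n i
  · simp only [map_add, map_smul _ τ, map_sum, map_smul _ (M.a _ _), hD]
    exact hs n i
  · simp only [map_add, map_smul _ τ, map_sum, map_smul _ (M.b _), hD]
    exact hu n

/-- A discrete Gronwall inequality. The recursion is needed only as long as the bound holds. -/
theorem discrete_gronwall {e : ℕ → ℝ} {C τ δ : ℝ} (hC : 0 ≤ C) (hτ : 0 ≤ τ) (hδ : 0 ≤ δ)
    {T : ℝ} (h0 : e 0 ≤ 0)
    (h : ∀ n : ℕ, (n + 1 : ℕ) * τ ≤ T → e n ≤ Real.exp (C * T) * δ →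
      e (n + 1) ≤ (1 + C * τ) * e n + C * τ * δ) (n : ℕ) (hn : n * τ ≤ T) :
    e n ≤ Real.exp (C * T) * δ := by
  have hpow : ∀ k : ℕ, k * τ ≤ T → ((1 + C * τ) ^ k - 1) * δ ≤ Real.exp (C * T) * δ :=
    fun k hk => by
      refine mul_le_mul_of_nonneg_right ?_ hδ
      have h1 : (1 + C * τ) ^ k ≤ Real.exp (C * τ) ^ k :=
        pow_le_pow_left₀ (by positivity) (by linarith [Real.add_one_le_exp (C * τ)]) k
      have h2 : Real.exp (C * τ) ^ k ≤ Real.exp (C * T) := by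
        rw [← Real.exp_nat_mul, Real.exp_le_exp]
        calc (k : ℝ) * (C * τ) = C * (k * τ) := by ring
          _ ≤ C * T := by gcongr
      linarith
  -- This sharper bound reproduces itself exactly under the recursion.
  suffices e n ≤ ((1 + C * τ) ^ n - 1) * δ from this.trans (hpow n hn)
  induction n with
  | zero => simpa using h0
  | succ n ih =>
    have hn' : n * τ ≤ T := le_trans (by push_cast; linarith) hn
    have ih := ih hn'
    refine (h n hn (ih.trans (hpow n hn'))).trans ?_
    have : (1 + C * τ) * e n ≤ (1 + C * τ) * (((1 + C * τ) ^ n - 1) * δ) := by gcongr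
    refine (add_le_add_left this _).trans_eq ?_
    ring

theorem RungeKutta.IsNumericalSolution.unique {τ ρ : ℝ} (hι : Function.Injective ι)
    (hcoer : M.Coercive) (hτ : τ ≠ 0)
    (hstep : ∀ (u₀ u₁ u₁' : Y) (U D U' D' : Fin m → Y), M.IsStep ι A τ u₀ U D u₁ →
      M.IsStep ι A τ u₀ U' D' u₁' → (∀ i, ‖U i‖ ≤ ρ) → (∀ i, ‖U' i‖ ≤ ρ) → U = U' ∧ u₁ = u₁')
    {u₀ : Y} {N : ℕ} {u u' : Fin (N + 1) → Y} {U U' : Fin N → Fin m → Y}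
    (h : M.IsNumericalSolution ι A u₀ τ N u U) (h' : M.IsNumericalSolution ι A u₀ τ N u' U')
    (hU : ∀ n i, ‖U n i‖ ≤ ρ) (hU' : ∀ n i, ‖U' n i‖ ≤ ρ) : u = u' ∧ U = U' := by
  have key : ∀ n : Fin N, u n.castSucc = u' n.castSucc → U n = U' n ∧ u n.succ = u' n.succ :=
    fun n hn => by
      obtain ⟨D, hD⟩ := h.exists_isStep hι hcoer hτ n
      obtain ⟨D', hD'⟩ := h'.exists_isStep hι hcoer hτ n
      rw [hn] at hD
      exact hstep _ _ _ _ _ _ _ hD hD' (hU n) (hU' n)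
  have hu : ∀ n, u n = u' n := fun n => by
    induction n using Fin.induction with
    | zero => rw [h.1, h'.1]
    | succ n ih => exact (key n ih).2
  exact ⟨funext hu, funext fun n => (key n (hu _)).1⟩

end Kato
end

theorem mainTheorem3
    {X Y : Type*}
    [NormedAddCommGroup X] [InnerProductSpace ℝ X] [CompleteSpace X]
    [NormedAddCommGroup Y] [InnerProductSpace ℝ Y] [CompleteSpace Y]
    (ι : Y →L[ℝ] X) (hι : Kato.IsDenseEmbedding ι)
    (S : Y ≃ₗᵢ[ℝ] X) (hS : IsSelfAdjoint (Kato.opOnX ι S))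
    {m : ℕ} (M : Kato.RungeKutta m)
    (p q : ℕ) (hqp : q < p) (hpq : p ≤ 2 * q)
    (hstab : M.AlgebraicallyStable) (hcoer : M.Coercive)
    (hstage : M.HasStageOrder q) (horder : M.HasClassicalOrder p)
    (A : Y → (X →ₗ.[ℝ] X)) (B : ℕ → Y → (X →L[ℝ] X))
    (hK1 : Kato.MAccretive ι A)
    (hK2 : ∀ k : ℕ, 1 ≤ k → k ≤ p - q → Kato.Commutator ι S k A (B k))
    (hK3 : Kato.LocallyLip ι A (B 1))
    (hA : Kato.SmoothInLYX ι A)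
    (hB : ∀ k : ℕ, 1 ≤ k → k ≤ p - q → Kato.SmoothLocallyBounded (B k))
    (T : ℝ) (hT : 0 < T) (u : ℝ → Y) (hu : Kato.IsSolution ι A T u)
    (hreg : ContDiffOn ℝ (p + 1 : ℕ) u (Set.Icc 0 T))
    (hregS : ∀ k : ℕ, 1 ≤ k → k ≤ p - q → Kato.PowRegular ι S T u k (p + 1 - k)) :
    ∃ ρ₀ C : ℝ, ∀ ρ : ℝ, ρ₀ ≤ ρ → ∃ τ₀ : ℝ, 0 < τ₀ ∧
      ∀ τ : ℝ, 0 < τ → τ ≤ τ₀ → ∀ N : ℕ, N * τ ≤ T →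
        ∃ (un : Fin (N + 1) → Y) (U : Fin N → Fin m → Y),
          M.IsNumericalSolution ι A (u 0) τ N un U ∧
          (∀ n i, ‖U n i‖ ≤ ρ) ∧
          (∀ (un' : Fin (N + 1) → Y) (U' : Fin N → Fin m → Y),
            M.IsNumericalSolution ι A (u 0) τ N un' U' → (∀ n i, ‖U' n i‖ ≤ ρ) →
              un' = un ∧ U' = U) ∧
          ∀ n : Fin (N + 1), ‖un n - u ((n : ℕ) * τ)‖ ≤ C * τ ^ p := by
  obtain ⟨AY, hAY, hAYs⟩ := hA
  have hp : 1 ≤ p := by omega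
  have hB1 : Kato.Commutator ι S 1 A (B 1) := hK2 1 le_rfl (by omega)
  obtain ⟨Ku, hKu⟩ := isCompact_Icc.exists_bound_of_continuousOn hreg.continuousOn
  obtain ⟨ρ₁, hρ₁, τa, hτa, hex⟩ :=
    Kato.exists_isStep (M := M) hι hS hcoer hK1 hB1 hAY hK3 (Ku + 1)
  obtain ⟨Cc, τb, hCc, hτb, hcons⟩ := Kato.exists_consistent_stages hι hqp hpq hstage horder hK2
    hAY hAYs hB hT hu hreg hregS
  obtain ⟨C, hC, τc, hτc, hst⟩ := Kato.RungeKutta.IsStep.stability hι hstab hcoer hK1 hB1 hAY hK3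
    (max ρ₁ Cc)
  set E : ℝ := Real.exp (C * T)
  have hE : 1 ≤ E := Real.one_le_exp (by positivity)
  refine ⟨ρ₁, E * Cc, fun ρ hρ => ?_⟩
  obtain ⟨τd, hτd, hun⟩ := Kato.RungeKutta.IsStep.unique hι hcoer hK1 hAY hK3 ρ
  -- Only `τd`, from uniqueness, depends on ρ. The last two bounds make the error E Cc τ^p at most
  -- 1, so that approximations stay in the ball of radius `Ku + 1` where steps exist.
  refine ⟨min (min (min τa τb) (min τc τd)) (min 1 (1 / (E * Cc + 1))), by positivity, ?_⟩
  intro τ hτ hτ0 N hN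
  simp only [le_min_iff] at hτ0
  obtain ⟨⟨⟨hta, htb⟩, htc, htd⟩, ht1, htC⟩ := hτ0
  have hsmall : E * Cc * τ ^ p ≤ 1 := by
    have h1 : τ ^ p ≤ τ := pow_le_of_le_one hτ.le ht1 (by omega)
    rw [le_div_iff₀ (by positivity)] at htC
    have h2 : E * Cc * τ ^ p ≤ E * Cc * τ := by gcongr
    nlinarith
  have hnext : ∀ w : Y, ∃ (U D : Fin m → Y) (w' : Y), ‖w‖ ≤ Ku + 1 →
      M.IsStep ι A τ w U D w' ∧ ∀ i, ‖U i‖ ≤ ρ₁ := fun w => by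
    by_cases hw : ‖w‖ ≤ Ku + 1
    · obtain ⟨U, D, w', h⟩ := hex τ hτ hta w hw
      exact ⟨U, D, w', fun _ => h⟩
    · exact ⟨0, 0, 0, fun h => absurd h hw⟩
  choose U D next hnext using hnext
  let w : ℕ → Y := fun n => next^[n] (u 0)
  have hw : ∀ n, w (n + 1) = next (w n) := fun n => Function.iterate_succ_apply' _ _ _
  have hmem : ∀ n : ℕ, n * τ ≤ T → (n : ℝ) * τ ∈ Set.Icc 0 T := fun n hn => ⟨by positivity, hn⟩
  -- Since E ≥ 1, the bound E may be replaced by E² before taking the square root.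
  have hsq : ∀ n : ℕ, ‖w n - u (n * τ)‖ ^ 2 ≤ E * (Cc * τ ^ p) ^ 2 →
      ‖w n - u (n * τ)‖ ≤ E * Cc * τ ^ p := fun n h => by
    refine abs_le_of_sq_le_sq' (h.trans ?_) (by positivity) |>.2
    rw [mul_assoc, mul_pow E]
    exact mul_le_mul_of_nonneg_right (le_self_pow₀ hE two_ne_zero) (sq_nonneg _)
  have hball : ∀ n : ℕ, n * τ ≤ T → ‖w n - u (n * τ)‖ ≤ E * Cc * τ ^ p → ‖w n‖ ≤ Ku + 1 :=
    fun n hn h => by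
      have := norm_le_norm_add_norm_sub' (w n) (u (n * τ))
      linarith [hKu _ (hmem n hn)]
  -- Bootstrap: the bound at n places w n in the ball, so `next` is a genuine step there and
  -- stability applies with η = Cc τ^p, giving the recursion to n + 1.
  have herr : ∀ n : ℕ, n * τ ≤ T → ‖w n - u (n * τ)‖ ^ 2 ≤ E * (Cc * τ ^ p) ^ 2 := by
    refine Kato.discrete_gronwall (e := fun n : ℕ => ‖w n - u (n * τ)‖ ^ 2) hC hτ.le (sq_nonneg _)
      (by simp [w]) fun n hn hle => ?_
    have hnT : n * τ ≤ T := le_trans (by push_cast; linarith) hn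
    have hn1 : ((n + 1 : ℕ) : ℝ) * τ = n * τ + τ := by push_cast; ring
    obtain ⟨hs, hU⟩ := hnext (w n) (hball n hnT (hsq n hle))
    obtain ⟨v, F, hF, hv, hd1, hd2⟩ := hcons (n * τ) τ (hmem n hnT).1 hτ htb (hn1 ▸ hn)
    have hη : Cc * τ ^ (p + 1) = τ * (Cc * τ ^ p) := by ring
    rw [hη] at hd1 hd2
    have := hst τ (Cc * τ ^ p) hτ htc (by positivity) _ _ (u (n * τ)) (u (n * τ + τ)) _ _ v F hs hF
      (fun i => (hU i).trans (le_max_left _ _)) (fun i => (hv i).trans (le_max_right _ _)) hd1 hd2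
    simpa only [hw, hn1] using this
  have hle : ∀ n ≤ N, (n : ℝ) * τ ≤ T := fun n hn => le_trans (by gcongr) hN
  have hstep : ∀ n : ℕ, n ≤ N →
      M.IsStep ι A τ (w n) (U (w n)) (D (w n)) (w (n + 1)) ∧ ∀ i, ‖U (w n) i‖ ≤ ρ₁ :=
    fun n hn => hw n ▸ hnext _ (hball n (hle n hn) (hsq n (herr n (hle n hn))))
  have hsol : M.IsNumericalSolution ι A (u 0) τ N (fun n => w n) (fun n => U (w n)) :=
    Kato.RungeKutta.isNumericalSolution_of_isStep (D := fun n => D (w n)) rfl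
      fun n => (hstep n n.2.le).1
  have hUρ : ∀ (n : Fin N) i, ‖U (w n) i‖ ≤ ρ := fun n i => ((hstep n n.2.le).2 i).trans hρ
  refine ⟨fun n => w n, fun n => U (w n), hsol, hUρ, fun un' U' h' hU' => ?_, fun n => ?_⟩
  · exact Kato.RungeKutta.IsNumericalSolution.unique hι.injective hcoer hτ.ne'
      (hun τ hτ htd) h' hsol hU' hUρ
  · exact hsq n (herr n (hle n (Nat.lt_succ_iff.1 n.2)))
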